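/- **Setting.** Let $(a,b)\sim\mathcal D$ with $a\in\mathbb R^d$, let $\ell(u,b)$ be a loss that is twice differentiable in $u$ (derivatives $\ell',\ell''$ in $u$), and let $F(x)=\mathbb E\,\ell(a^\top x,b)$ be finite for every $x$. Assume there are $\mu_\ell,L_\ell>0$ with $\mu_\ell\le\ell''(a^\top x,b)\le L_\ell$ for all $x$, almost surely; that $\Sigma=\mathbb E\,aa^\top$ is finite with least eigenvalue $\mu>0$; and that $R>0$ and $\tilde\kappa$ satisfy $\mathbb E\big(\|a\|^2aa^\top\big)\preceq R^2\Sigma$ and $\mathbb E\big((a^\top\Sigma^{-1}a)\,aa^\top\big)\preceq\tilde\kappa\,\Sigma$ (finite fourth moments). Put $\alpha=L_\ell/\mu_\ell$, $\kappa=R^2/\mu$, $H=L_\ell\Sigma$, let $x^*$ be the minimizer of $F$, and let $Q=\mathbb E\big(\ell'(a^\top x^*,b)^2aa^\top\big)$ be finite. **Algorithm (SADA).** Given $\tilde x_0=\tilde x_{-1}\in\mathbb R^d$, $\eta>0$, $K\ge1$ and $T$ even, for $k=1,\dots,K$: set $\tilde y=\tilde x_{k-1}+\beta_k(\tilde x_{k-1}-\tilde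 x_{k-2})$ and $x_0=z_0=\tilde y$; for $t=1,\dots,T$ draw a fresh sample $(a_t,b_t)\sim\mathcal D$ and set $y_{t-1}=\frac{1}{1+\theta}x_{t-1}+\frac{\theta}{1+\theta}z_{t-1}$, $\hat g_t=h_k\ell'(a_t^\top\tilde y,b_t)a_t+\big[a_t^\top(y_{t-1}-\tilde y)\big]a_t$, $x_t=y_{t-1}-\eta\hat g_t$, $z_t=\theta y_{t-1}+(1-\theta)z_{t-1}-\gamma\hat g_t$; then set $\tilde x_k=\frac2T\sum_{t=T/2+1}^Tx_t$. Return $\tilde x_K$. The parameters are $\gamma=\frac14\sqrt{\eta/(\tilde\kappa\mu)}$, $\theta=\frac14\sqrt{\mu\eta/\tilde\kappa}$, $h_k=2\alpha\tilde\theta_k^2/L_\ell$, $\beta_k=(1-\tilde\theta_k)/(1+\tilde\theta_k)$, with $\tilde\theta_k=\tilde\theta_{\max}$ for $k\le K/2$, $\tilde\theta_k=4/(4/\tilde\theta_{\max}+k-K/2)$ for $k>K/2$, and $\tilde\theta_{\max}=c_0\min\{1/\sqrt\alpha,\ T/(\alpha^2\tilde\kappa)\}$. **Statement.** There are universal constants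 $C>0$, $c_0\in(0,1]$, $c_1>0$, $c_2\in(0,\frac1{16}]$, $c_3\ge1$ such that the following holds in every such setting, for every $\tilde x_0$ and every $\varepsilon>0$. Put $\Delta=F(\tilde x_0)-F(x^*)$, $$X=\Big(\sqrt{\alpha\kappa\tilde\kappa}+\alpha^2\tilde\kappa\Big)+\frac{\alpha\operatorname{tr}(H^{-1}Q)}{\varepsilon}+\Big(\frac{\alpha^2\tilde\kappa^2\operatorname{tr}Q}{L_\ell\,\mu\,\varepsilon}\Big)^{1/3},$$ and $\mathcal L(s)=\log(e+s+\Delta/\varepsilon)$. Let the number $n\in\mathbb N$ of available samples satisfy $n\ge C\,\mathcal L(X)^2\,X$ (that is, $n=\tilde O(X)$ samples suffice). Then there is a step size $\eta$ with $$c_1\mathcal L(n)^4\,\frac{\alpha\tilde\kappa}{\mu n^2}\ \le\ \eta\ \le\ c_2\min\Big\{\frac1{R^2},\ \frac{n\varepsilon L_\ell}{\alpha\tilde\kappa\operatorname{tr}Q}\Big\}$$ (the second term of the minimum being $+\infty$ if $\operatorname{tr}Q=0$); for every such $\eta$ there is an even integer $T$ with $$c_3\mathcal L(n)\sqrt{\tilde\kappa/(\mu\eta)}\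 \le\ T\ \le\ 2c_3\mathcal L(n)\sqrt{\tilde\kappa/(\mu\eta)};$$ and for every such $\eta$ and $T$, with $K=\lfloor n/T\rfloor$, one has $K\ge1$, and SADA, run with these parameters on independent samples from $\mathcal D$ (of which it uses $KT\le n$), returns $\tilde x_K$ with $F(\tilde x_K)$ integrable and $\mathbb E F(\tilde x_K)-F(x^*)\le\varepsilon$. -/

import Mathlib

noncomputable section

namespace SADA

open MeasureTheory

/-- The feature space `ℝ^d` with the Euclidean norm. -/
abbrev Vec (d : ℕ) := EuclideanSpace ℝ (Fin d)

section Problem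

variable {d : ℕ} {B : Type*} [MeasurableSpace B]

/-- First derivative `ℓ'(u, b)` of the loss in its first argument. -/
def dloss (loss : ℝ → B → ℝ) (u : ℝ) (b : B) : ℝ := deriv (fun s => loss s b) u

/-- Second derivative `ℓ''(u, b)` of the loss in its first argument. -/
def ddloss (loss : ℝ → B → ℝ) (u : ℝ) (b : B) : ℝ := deriv (fun s => dloss loss s b) u

/-- The objective `F(x) = 𝔼 ℓ(aᵀx, b)`. -/
def risk (D : Measure (Vec d × B)) (loss : ℝ → B → ℝ) (x : Vec d) : ℝ :=
  ∫ p, loss (inner ℝ p.1 x) p.2 ∂D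

/-- The matrix `𝔼 [w(a, b) a aᵀ]`. -/
def weightedMoment (D : Measure (Vec d × B)) (w : Vec d × B → ℝ) : Matrix (Fin d) (Fin d) ℝ :=
  Matrix.of fun i j => ∫ p, w p * (p.1 i * p.1 j) ∂D

/-- `Σ = 𝔼 [a aᵀ]`. -/
def covMat (D : Measure (Vec d × B)) : Matrix (Fin d) (Fin d) ℝ :=
  weightedMoment D fun _ => 1

/-- The squared norm `‖v‖²_A = vᵀ A v`. -/
def sqNorm (A : Matrix (Fin d) (Fin d) ℝ) (v : Vec d) : ℝ :=
  ∑ i, ∑ j, v i * A i j * v j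

/-- `Q = 𝔼 [ℓ'(aᵀx⋆, b)² a aᵀ]`. -/
def gradNoise (D : Measure (Vec d × B)) (loss : ℝ → B → ℝ) (xstar : Vec d) :
    Matrix (Fin d) (Fin d) ℝ :=
  weightedMoment D fun p => (dloss loss (inner ℝ p.1 xstar) p.2) ^ 2

/-- The standing assumptions on the loss, the data distribution and the minimizer. -/
structure Assumptions (D : Measure (Vec d × B)) (loss : ℝ → B → ℝ) (xstar : Vec d)
    (muLoss LLoss mu R kappaT : ℝ) : Prop where
  /-- the loss is measurable, twice differentiable in its first argument, and `F` is well defined -/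
  measurable_loss : Measurable (Function.uncurry loss)
  differentiable_loss : ∀ b, Differentiable ℝ fun s => loss s b
  differentiable_dloss : ∀ b, Differentiable ℝ fun s => dloss loss s b
  integrable_loss : ∀ x : Vec d, Integrable (fun p : Vec d × B => loss (inner ℝ p.1 x) p.2) D
  /-- `μ_ℓ ≤ ℓ''(aᵀx, b) ≤ L_ℓ` with `μ_ℓ, L_ℓ > 0` -/
  muLoss_pos : 0 < muLoss
  LLoss_pos : 0 < LLoss
  curvature : ∀ᵐ p ∂D, ∀ x : Vec d,
    muLoss ≤ ddloss loss (inner ℝ p.1 x) p.2 ∧ ddloss loss (inner ℝ p.1 x) p.2 ≤ LLoss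
  /-- `Σ` is finite, with minimum eigenvalue `μ > 0` -/
  integrable_sq : Integrable (fun p : Vec d × B => ‖p.1‖ ^ 2) D
  isLeast_mu : IsLeast (spectrum ℝ (covMat D)) mu
  mu_pos : 0 < mu
  /-- `𝔼 [‖a‖² a aᵀ] ⪯ R² Σ` and `𝔼 [‖a‖²_{Σ⁻¹} a aᵀ] ⪯ κ̃ Σ` (the moments being finite) -/
  integrable_fourth : Integrable (fun p : Vec d × B => ‖p.1‖ ^ 4) D
  R_pos : 0 < R
  fourth_moment :
    (R ^ 2 • covMat D - weightedMoment D fun p => ‖p.1‖ ^ 2).PosSemidef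
  fourth_moment_inv :
    (kappaT • covMat D - weightedMoment D fun p => sqNorm (covMat D)⁻¹ p.1).PosSemidef
  /-- `x⋆` minimizes `F`, and the gradient noise at `x⋆` has a finite second moment -/
  isMinimizer : ∀ x : Vec d, risk D loss xstar ≤ risk D loss x
  integrable_noise :
    Integrable (fun p : Vec d × B => (dloss loss (inner ℝ p.1 xstar) p.2) ^ 2 * ‖p.1‖ ^ 2) D

end Problem

section Algorithm

variable {d : ℕ} {B : Type*}

/-- One inner update `(x_{t-1}, z_{t-1}) ↦ (x_t, z_t)` with the fresh sample `p = (a_t, b_t)`;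
`ytil` is the extrapolated outer point and `h` the regularization parameter. -/
def innerStep (loss : ℝ → B → ℝ) (eta gamma theta h : ℝ) (ytil : Vec d) (p : Vec d × B)
    (s : Vec d × Vec d) : Vec d × Vec d :=
  let y : Vec d := (1 / (1 + theta)) • s.1 + (theta / (1 + theta)) • s.2
  let g : Vec d :=
    (h * dloss loss (inner ℝ p.1 ytil) p.2) • p.1 + (inner ℝ p.1 (y - ytil) : ℝ) • p.1
  (y - eta • g, theta • y + (1 - theta) • s.2 - gamma • g)

/-- The pair `(x_t, z_t)` after `t` inner updates started at `x_0 = z_0 = ytil`;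
`data t` is the sample used by update number `t + 1`. -/
def innerIter (loss : ℝ → B → ℝ) (eta gamma theta h : ℝ) (ytil : Vec d)
    (data : ℕ → Vec d × B) : ℕ → Vec d × Vec d
  | 0 => (ytil, ytil)
  | t + 1 => innerStep loss eta gamma theta h ytil (data t)
      (innerIter loss eta gamma theta h ytil data t)

/-- Output `(2/T) ∑_{t = T/2+1}^T x_t` of an inner loop of (even) length `T`. -/
def innerLoop (loss : ℝ → B → ℝ) (eta gamma theta h : ℝ) (T : ℕ) (ytil : Vec d)
    (data : ℕ → Vec d × B) : Vec d :=
  (2 / (T : ℝ)) • ∑ t ∈ Finset.Icc (T / 2 + 1) T,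
    (innerIter loss eta gamma theta h ytil data t).1

/-- The pair `(x̃_k, x̃_{k-1})` after `k` outer iterations, with `x̃_{-1} = x̃_0 = x0`.
Outer iteration `k + 1` consumes the `T` fresh samples `data (k T), …, data (k T + T - 1)`. -/
def outerIter (loss : ℝ → B → ℝ) (eta gamma theta : ℝ) (h beta : ℕ → ℝ) (T : ℕ) (x0 : Vec d)
    (data : ℕ → Vec d × B) : ℕ → Vec d × Vec d
  | 0 => (x0, x0)
  | k + 1 =>
    let s := outerIter loss eta gamma theta h beta T x0 data k
    (innerLoop loss eta gamma theta (h (k + 1)) T (s.1 + beta (k + 1) • (s.1 - s.2))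
      (fun t => data (k * T + t)), s.1)

/-- The output `x̃_K` of the algorithm; it depends on the first `K T` samples only. -/
def sada (loss : ℝ → B → ℝ) (eta gamma theta : ℝ) (h beta : ℕ → ℝ) (K T : ℕ) (x0 : Vec d)
    (data : ℕ → Vec d × B) : Vec d :=
  (outerIter loss eta gamma theta h beta T x0 data K).1

end Algorithm

section Hyperparameters

/-- Inner momentum step size `γ = ¼ √(η / (κ̃ μ))`. -/
def gammaPar (mu kappaT eta : ℝ) : ℝ := 1 / 4 * √(eta / (kappaT * mu))

/-- Inner momentum parameter `θ = ¼ √(μ η / κ̃)`. -/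
def thetaPar (mu kappaT eta : ℝ) : ℝ := 1 / 4 * √(mu * eta / kappaT)

/-- `θ̃_max = c · min {1/√α, T/(α² κ̃)}`. -/
def thetaMax (c alpha kappaT : ℝ) (T : ℕ) : ℝ :=
  c * min (1 / √alpha) ((T : ℝ) / (alpha ^ 2 * kappaT))

/-- `θ̃_k`: constant for `k ≤ K/2`, then `4 / (4/θ̃_max + k - K/2)`. -/
def thetaTilde (tmax : ℝ) (K k : ℕ) : ℝ :=
  if (k : ℝ) ≤ (K : ℝ) / 2 then tmax else 4 / (4 / tmax + (k : ℝ) - (K : ℝ) / 2)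

/-- Outer step size `h_k = 2 α θ̃_k² / L_ℓ`. -/
def hPar (alpha LLoss tmax : ℝ) (K k : ℕ) : ℝ := 2 * alpha * thetaTilde tmax K k ^ 2 / LLoss

/-- Outer momentum `β_k = (1 - θ̃_k) / (1 + θ̃_k)`. -/
def betaPar (tmax : ℝ) (K k : ℕ) : ℝ := (1 - thetaTilde tmax K k) / (1 + thetaTilde tmax K k)

/-- The algorithm with all the prescribed hyperparameters. -/
def sadaTuned {d : ℕ} {B : Type*} (loss : ℝ → B → ℝ) (c muLoss LLoss mu kappaT eta : ℝ)
    (K T : ℕ) (x0 : Vec d) (data : ℕ → Vec d × B) : Vec d :=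
  sada loss eta (gammaPar mu kappaT eta) (thetaPar mu kappaT eta)
    (hPar (LLoss / muLoss) LLoss (thetaMax c (LLoss / muLoss) kappaT T) K)
    (betaPar (thetaMax c (LLoss / muLoss) kappaT T) K) K T x0 data

/-- `(√(α κ κ̃) + α² κ̃) + α tr(H⁻¹Q)/ε + (α² κ̃² tr Q / (L_ℓ μ ε))^{1/3}`,
where `α = L_ℓ/μ_ℓ`, `κ = R²/μ` and `H = L_ℓ Σ`. -/
def complexity {d : ℕ} (Sig Q : Matrix (Fin d) (Fin d) ℝ)
    (muLoss LLoss mu R kappaT eps : ℝ) : ℝ :=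
  (√((LLoss / muLoss) * (R ^ 2 / mu) * kappaT) + (LLoss / muLoss) ^ 2 * kappaT)
    + (LLoss / muLoss) * Matrix.trace ((LLoss • Sig)⁻¹ * Q) / eps
    + ((LLoss / muLoss) ^ 2 * kappaT ^ 2 * Matrix.trace Q / (LLoss * mu * eps)) ^ (1 / 3 : ℝ)

/-- The logarithmic factor `log (e + s + gap/ε)`. -/
def logFactor (s gap eps : ℝ) : ℝ := Real.log (Real.exp 1 + s + gap / eps)

/-- The admissible step sizes:
`c₁ 𝓛⁴ α κ̃ / (μ n²) ≤ η ≤ c₂ min {1/R², n ε L_ℓ / (α κ̃ tr Q)}`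
(the last bound being void when `tr Q = 0`). -/
def StepSizeOK (c₁ c₂ : ℝ) (logn alpha LLoss mu R kappaT trQ eps : ℝ) (n : ℕ) (eta : ℝ) : Prop :=
  c₁ * logn ^ 4 * (alpha * kappaT / (mu * (n : ℝ) ^ 2)) ≤ eta ∧
  eta ≤ c₂ * (1 / R ^ 2) ∧
  eta * (alpha * kappaT * trQ) ≤ c₂ * ((n : ℝ) * eps * LLoss)

/-- The admissible inner lengths: `T` even with `c₃ 𝓛 √(κ̃/(μη)) ≤ T ≤ 2 c₃ 𝓛 √(κ̃/(μη))`. -/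
def InnerLengthOK (c₃ : ℝ) (logn mu kappaT eta : ℝ) (T : ℕ) : Prop :=
  Even T ∧
  c₃ * logn * √(kappaT / (mu * eta)) ≤ (T : ℝ) ∧
  (T : ℝ) ≤ 2 * (c₃ * logn * √(kappaT / (mu * eta)))

end Hyperparameters

end SADA

end

/-!
The proof is in two layers, glued together by conditioning on the past.

An inner loop anchored at `ỹ` is an accelerated stochastic least-squares method: centred at the point
`ỹ - h Σ⁻¹∇F(ỹ)` it is driven by the gradients `(⟪a, w⟫ + r) a`, whose residual `r` is uncorrelated
with `a` (`innerIter_eq`, `LossModel.residual`). The potential `‖u‖² + μ‖v‖²_{Σ⁻¹}` of its two error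
sequences contracts by `1 - θ` per step up to noise (`integral_pot_lsStep_le`). Since `u + v` moves by
exactly `γ + η` times the gradient used, the gradients of a window telescope; hence the tail average
is governed by the two ends of the window and by a martingale, which yields the second moment of its
error (`tailSum_bound`), proportional to `(κ̃ η tr Q + tr (Σ⁻¹ Q)) / T` apart from a multiplicative
part. The mean error only carries the initial condition, with a factor `κ (1 - θ)^{T/2}`
(`exists_mean_tailSum`).

An outer iteration is therefore an accelerated gradient step preconditioned by `Σ`, for a function
that is `L_ℓ`-smooth and `μ_ℓ`-strongly convex in the `Σ`-norm, with a random error of small variance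
and negligible mean. The Lyapunov function `F(x) - F⋆ + (μ_ℓ/4)‖z - x⋆‖²_Σ` contracts by
`1 - 2θ̃_k/5` per iteration, the multiplicative noise being absorbed by the strong convexity
(`lyap_step_le`, `lyap_reparam_le`, `LossModel.integral_outer_step_le`). As `1/θ̃_k` grows by at most
`1/4` per step, the additive noise stays at a level proportional to `θ̃_k` along the whole run
(`LossModel.integral_lyap_le`), and `θ̃_K ≤ 8/K` turns it into a variance of order `1/n`.

What is left is arithmetic. The condition `n ≥ C 𝓛(X)² X` implies `n ≥ C' 𝓛(n)² X`
(`mul_log_sq_mul_le`), and under it the prescribed `η` and `T` make both loops long enough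
(`SampleBudget`, `Assumptions.integral_excess_le`).
-/

namespace SADA

open MeasureTheory ProbabilityTheory

set_option linter.unusedSectionVars false

/-! ### Integrating out fresh samples -/

/-- If a nonnegative cost `V` of the past `S` and of an independent variable `Y` has mean at most
`U s` whenever the past is frozen at `s`, then its full mean is at most the mean of `U S`. Only
`U S` has to be known to be integrable: integrability of the cost comes for free, which is what
lets second-moment bounds be propagated along the algorithm. -/
theorem integral_le_of_indepFun {Ω σ τ : Type*} [MeasurableSpace Ω] [MeasurableSpace σ]
    [MeasurableSpace τ] {P : Measure Ω} [IsProbabilityMeasure P] {S : Ω → σ} {Y : Ω → τ}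
    (hS : Measurable S) (hY : Measurable Y) (hSY : IndepFun S Y P)
    {V : σ × τ → ℝ} (hV : Measurable V) (hV0 : ∀ q, 0 ≤ V q) {U : σ → ℝ}
    (hVi : ∀ s, Integrable (fun ω => V (s, Y ω)) P)
    (hVU : ∀ s, ∫ ω, V (s, Y ω) ∂P ≤ U s)
    (hU : Integrable (fun ω => U (S ω)) P) :
    Integrable (fun ω => V (S ω, Y ω)) P ∧ ∫ ω, V (S ω, Y ω) ∂P ≤ ∫ ω, U (S ω) ∂P := by
  have hm : Measurable fun q => ENNReal.ofReal (V q) := hV.ennreal_ofReal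
  have hU0 : ∀ s, 0 ≤ U s := fun s => (integral_nonneg fun ω => hV0 _).trans (hVU s)
  have key : ∫⁻ ω, ENNReal.ofReal (V (S ω, Y ω)) ∂P ≤ ∫⁻ ω, ENNReal.ofReal (U (S ω)) ∂P := by
    have h1 : ∫⁻ ω, ENNReal.ofReal (V (S ω, Y ω)) ∂P
        = ∫⁻ q, ENNReal.ofReal (V q) ∂(P.map fun ω => (S ω, Y ω)) :=
      (lintegral_map hm (hS.prodMk hY)).symm
    rw [h1, (indepFun_iff_map_prod_eq_prod_map_map hS.aemeasurable hY.aemeasurable).1 hSY,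
      lintegral_prod _ hm.aemeasurable, lintegral_map hm.lintegral_prod_right' hS]
    refine lintegral_mono fun ω => ?_
    rw [lintegral_map (f := fun y => ENNReal.ofReal (V (S ω, y)))
        (hm.comp measurable_prodMk_left) hY,
      ← ofReal_integral_eq_lintegral_ofReal (hVi _) (Filter.Eventually.of_forall fun _ => hV0 _)]
    exact ENNReal.ofReal_le_ofReal (hVU _)
  have hUeq := ofReal_integral_eq_lintegral_ofReal hU (Filter.Eventually.of_forall fun _ => hU0 _)
  have hint : Integrable (fun ω => V (S ω, Y ω)) P := by
    refine ⟨(hV.comp (hS.prodMk hY)).aestronglyMeasurable, ?_⟩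
    rw [hasFiniteIntegral_iff_ofReal (Filter.Eventually.of_forall fun _ => hV0 _)]
    exact key.trans_lt (hUeq ▸ ENNReal.ofReal_lt_top)
  refine ⟨hint, ?_⟩
  rw [← hUeq, ← ofReal_integral_eq_lintegral_ofReal hint
    (Filter.Eventually.of_forall fun _ => hV0 _)] at key
  exact (ENNReal.ofReal_le_ofReal_iff (integral_nonneg fun ω => hU0 _)).1 key

theorem integral_eq_of_indepFun {Ω σ τ : Type*} [MeasurableSpace Ω] [MeasurableSpace σ]
    [MeasurableSpace τ] {P : Measure Ω} [IsProbabilityMeasure P] {S : Ω → σ} {Y : Ω → τ}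
    (hS : Measurable S) (hY : Measurable Y) (hSY : IndepFun S Y P)
    {f : σ × τ → ℝ} (hf : Measurable f) (hfi : Integrable (fun ω => f (S ω, Y ω)) P) :
    ∫ ω, f (S ω, Y ω) ∂P = ∫ ω, (∫ ω', f (S ω, Y ω') ∂P) ∂P := by
  have hmap := (indepFun_iff_map_prod_eq_prod_map_map hS.aemeasurable hY.aemeasurable).1 hSY
  have h1 : ∫ ω, f (S ω, Y ω) ∂P = ∫ q, f q ∂(P.map fun ω => (S ω, Y ω)) :=
    (integral_map (hS.prodMk hY).aemeasurable hf.aestronglyMeasurable).symm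
  have h2 : Integrable f (P.map fun ω => (S ω, Y ω)) :=
    (integrable_map_measure hf.aestronglyMeasurable (hS.prodMk hY).aemeasurable).2 hfi
  have : IsProbabilityMeasure (P.map Y) := Measure.isProbabilityMeasure_map hY.aemeasurable
  have : IsProbabilityMeasure (P.map S) := Measure.isProbabilityMeasure_map hS.aemeasurable
  rw [hmap] at h1 h2
  rw [h1, integral_prod _ h2, integral_map hS.aemeasurable
    (hf.stronglyMeasurable.integral_prod_right').aestronglyMeasurable]
  refine integral_congr_ae (Filter.Eventually.of_forall fun ω => ?_)
  exact integral_map hY.aemeasurable (hf.comp measurable_prodMk_left).aestronglyMeasurable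

/-- Functionals of an independent sequence that look at disjoint finite blocks of coordinates are
independent. -/
theorem indepFun_of_dependsOn {Ω A σ τ : Type*} [MeasurableSpace Ω] [MeasurableSpace A]
    [MeasurableSpace σ] [MeasurableSpace τ] {P : Measure Ω} [IsProbabilityMeasure P]
    {X : ℕ → Ω → A} (hX : ∀ i, Measurable (X i)) (hind : iIndepFun X P)
    {G : (ℕ → A) → σ} {H : (ℕ → A) → τ} (hG : Measurable G) (hH : Measurable H)
    {I J : Finset ℕ} (hIJ : Disjoint I J) (hGI : DependsOn G (I : Set ℕ))
    (hHJ : DependsOn H (J : Set ℕ)) :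
    IndepFun (fun ω => G fun i => X i ω) (fun ω => H fun i => X i ω) P := by
  obtain ⟨ω₀⟩ : Nonempty Ω := nonempty_of_isProbabilityMeasure P
  have hext : ∀ K : Finset ℕ, Measurable fun (y : K → A) (i : ℕ) =>
      if h : i ∈ K then y ⟨i, h⟩ else X 0 ω₀ := by
    intro K
    refine measurable_pi_lambda _ fun i => ?_
    by_cases h : i ∈ K
    · simpa [h] using measurable_pi_apply (⟨i, h⟩ : K)
    · simp [h]
  have hfin := hind.indepFun_finset I J hIJ hX
  have hcomp := hfin.comp (hG.comp (hext I)) (hH.comp (hext J))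
  have e1 : (fun ω => G fun i => X i ω) = (G ∘ fun (y : I → A) (i : ℕ) =>
      if h : i ∈ I then y ⟨i, h⟩ else X 0 ω₀) ∘ fun ω (i : I) => X i ω := by
    funext ω
    refine hGI fun i hi => ?_
    have : i ∈ I := by exact_mod_cast hi
    simp [this]
  have e2 : (fun ω => H fun i => X i ω) = (H ∘ fun (y : J → A) (i : ℕ) =>
      if h : i ∈ J then y ⟨i, h⟩ else X 0 ω₀) ∘ fun ω (i : J) => X i ω := by
    funext ω
    refine hHJ fun i hi => ?_
    have : i ∈ J := by exact_mod_cast hi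
    simp [this]
  rw [e1, e2]
  exact hcomp

/-! ### Quadratic forms -/

section Quad

variable {E : Type*} [NormedAddCommGroup E] [InnerProductSpace ℝ E]

/-- The quadratic form `⟪x, T x⟫` of an operator `T`; for `T = Σ` and `T = Σ⁻¹` this is the squared
`Σ`-norm and the squared dual norm. -/
def quad (T : E →L[ℝ] E) (x : E) : ℝ := inner ℝ x (T x)

/-- `T` is symmetric and positive semidefinite. -/
structure IsSymmPos (T : E →L[ℝ] E) : Prop where
  symm : ∀ x y, inner ℝ x (T y) = inner ℝ y (T x)
  nonneg : ∀ x, 0 ≤ quad T x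

theorem quad_smul (T : E →L[ℝ] E) (c : ℝ) (x : E) : quad T (c • x) = c ^ 2 * quad T x := by
  simp only [quad, map_smul, inner_smul_left, inner_smul_right, conj_trivial]; ring

theorem quad_neg (T : E →L[ℝ] E) (x : E) : quad T (-x) = quad T x := by
  simp [quad]

theorem quad_zero (T : E →L[ℝ] E) : quad T 0 = 0 := by simp [quad]

theorem continuous_quad (T : E →L[ℝ] E) : Continuous (quad T) :=
  continuous_id.inner T.continuous

theorem inner_sq_le_norm (a x : E) : inner ℝ a x ^ 2 ≤ ‖a‖ ^ 2 * ‖x‖ ^ 2 := by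
  rw [← mul_pow]
  exact sq_le_sq' (by linarith [neg_le_of_abs_le (abs_real_inner_le_norm a x)])
    (real_inner_le_norm a x)

namespace IsSymmPos

variable {T : E →L[ℝ] E}

theorem quad_add (hT : IsSymmPos T) (x y : E) :
    quad T (x + y) = quad T x + 2 * inner ℝ x (T y) + quad T y := by
  simp only [quad, map_add, inner_add_left, inner_add_right, hT.symm y x]; ring

theorem quad_sub (hT : IsSymmPos T) (x y : E) :
    quad T (x - y) = quad T x - 2 * inner ℝ x (T y) + quad T y := by
  simp only [quad, map_sub, inner_sub_left, inner_sub_right, hT.symm y x]; ring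

theorem quad_add_le (hT : IsSymmPos T) (x y : E) :
    quad T (x + y) ≤ 2 * quad T x + 2 * quad T y := by
  have h := hT.nonneg (x - y)
  rw [hT.quad_sub] at h
  rw [hT.quad_add]
  linarith

theorem quad_sub_le (hT : IsSymmPos T) (x y : E) :
    quad T (x - y) ≤ 2 * quad T x + 2 * quad T y := by
  rw [sub_eq_add_neg]
  simpa [quad_neg] using hT.quad_add_le x (-y)

theorem two_mul_inner_le (hT : IsSymmPos T) {c : ℝ} (hc : 0 < c) (x y : E) :
    2 * inner ℝ x (T y) ≤ c * quad T x + quad T y / c := by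
  have h := hT.nonneg (c • x - y)
  rw [hT.quad_sub, quad_smul, inner_smul_left, conj_trivial] at h
  have h2 : 0 ≤ (c ^ 2 * quad T x - 2 * (c * inner ℝ x (T y)) + quad T y) / c := by positivity
  have h3 : (c ^ 2 * quad T x - 2 * (c * inner ℝ x (T y)) + quad T y) / c
      = c * quad T x - 2 * inner ℝ x (T y) + quad T y / c := by field_simp
  linarith

theorem inner_sq_le (hT : IsSymmPos T) (x y : E) :
    inner ℝ x (T y) ^ 2 ≤ quad T x * quad T y := by
  have h : ∀ t : ℝ, 0 ≤ quad T y * (t * t) + (2 * inner ℝ x (T y)) * t + quad T x := by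
    intro t
    have := hT.nonneg (x + t • y)
    rw [hT.quad_add, quad_smul, map_smul, inner_smul_right] at this
    linarith
  have := discrim_le_zero h
  rw [discrim] at this
  linarith

theorem quad_convex (hT : IsSymmPos T) {t : ℝ} (h0 : 0 ≤ t) (h1 : t ≤ 1) (x y : E) :
    quad T (t • x + (1 - t) • y) ≤ t * quad T x + (1 - t) * quad T y := by
  have h := mul_nonneg (mul_nonneg h0 (sub_nonneg.2 h1)) (hT.nonneg (x - y))
  rw [hT.quad_sub] at h
  rw [hT.quad_add, quad_smul, quad_smul, map_smul, inner_smul_left, inner_smul_right,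
    conj_trivial]
  nlinarith

theorem quad_sum_le (hT : IsSymmPos T) {ι : Type*} (s : Finset ι) (f : ι → E) :
    quad T (∑ i ∈ s, f i) ≤ s.card * ∑ i ∈ s, quad T (f i) := by
  classical
  induction s using Finset.induction_on with
  | empty => simp [quad_zero]
  | insert j s hj ih =>
    rw [Finset.sum_insert hj, Finset.sum_insert hj, Finset.card_insert_of_notMem hj, hT.quad_add]
    have hcross : 2 * inner ℝ (f j) (T (∑ i ∈ s, f i))
        ≤ ∑ i ∈ s, quad T (f i) + s.card * quad T (f j) := by
      rw [map_sum, inner_sum, Finset.mul_sum]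
      calc ∑ i ∈ s, 2 * inner ℝ (f j) (T (f i))
          ≤ ∑ i ∈ s, (quad T (f j) + quad T (f i)) := by
            refine Finset.sum_le_sum fun i _ => ?_
            simpa using hT.two_mul_inner_le one_pos (f j) (f i)
        _ = _ := by rw [Finset.sum_add_distrib, Finset.sum_const, nsmul_eq_mul]; ring
    push_cast
    nlinarith

end IsSymmPos

end Quad

/-! ### Random features with a fourth moment -/

/-- A random feature `a` with covariance operator `S` (inverse `Si`), the spectral bounds
`μ ≤ S ≤ R²`, and the two fourth-moment bounds with constants `R²` and `κ̃`. -/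
structure CovModel {E : Type*} [NormedAddCommGroup E] [InnerProductSpace ℝ E] [MeasurableSpace E]
    {A : Type*} [MeasurableSpace A] (D : Measure A) (a : A → E)
    (S Si : E →L[ℝ] E) (mu R kap : ℝ) : Prop where
  measurable_feature : Measurable a
  integrable_norm_pow_four : Integrable (fun p => ‖a p‖ ^ 4) D
  integral_inner_mul_inner : ∀ x y, ∫ p, inner ℝ (a p) x * inner ℝ (a p) y ∂D = inner ℝ x (S y)
  S_Si : ∀ x, S (Si x) = x
  Si_S : ∀ x, Si (S x) = x
  mu_pos : 0 < mu
  one_le_kap : 1 ≤ kap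
  mu_le : ∀ x, mu * ‖x‖ ^ 2 ≤ quad S x
  le_R : ∀ x, quad S x ≤ R ^ 2 * ‖x‖ ^ 2
  fourth : ∀ x, ∫ p, ‖a p‖ ^ 2 * inner ℝ (a p) x ^ 2 ∂D ≤ R ^ 2 * quad S x
  fourth_inv : ∀ x, ∫ p, quad Si (a p) * inner ℝ (a p) x ^ 2 ∂D ≤ kap * quad S x

namespace CovModel

variable {E : Type*} [NormedAddCommGroup E] [InnerProductSpace ℝ E] [MeasurableSpace E]
  {A : Type*} [MeasurableSpace A] {D : Measure A} {a : A → E} {S Si : E →L[ℝ] E} {mu R kap : ℝ}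

theorem symmPos (hM : CovModel D a S Si mu R kap) : IsSymmPos S where
  symm x y := by
    rw [← hM.integral_inner_mul_inner, ← hM.integral_inner_mul_inner]
    simp_rw [mul_comm]
  nonneg x := (mul_nonneg hM.mu_pos.le (sq_nonneg _)).trans (hM.mu_le x)

theorem symm_inv (hM : CovModel D a S Si mu R kap) (x y : E) :
    inner ℝ x (Si y) = inner ℝ y (Si x) := by
  have h := hM.symmPos.symm (Si y) (Si x)
  rw [hM.S_Si, hM.S_Si, real_inner_comm, real_inner_comm y] at h
  exact h

theorem quad_S_Si (hM : CovModel D a S Si mu R kap) (x : E) : quad S (Si x) = quad Si x := by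
  rw [quad, quad, hM.S_Si, real_inner_comm]

theorem quad_Si_S (hM : CovModel D a S Si mu R kap) (x : E) : quad Si (S x) = quad S x := by
  rw [quad, quad, hM.Si_S, real_inner_comm]

theorem symmPos_inv (hM : CovModel D a S Si mu R kap) : IsSymmPos Si where
  symm := hM.symm_inv
  nonneg x := hM.quad_S_Si x ▸ hM.symmPos.nonneg (Si x)

theorem inner_S_Si (hM : CovModel D a S Si mu R kap) (x y : E) :
    inner ℝ (S x) (Si y) = inner ℝ x y := by
  rw [hM.symm_inv, hM.Si_S, real_inner_comm]

theorem mu_mul_quad_inv_le (hM : CovModel D a S Si mu R kap) (x : E) :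
    mu * quad Si x ≤ ‖x‖ ^ 2 := by
  have h1 := hM.mu_le (Si x)
  rw [hM.quad_S_Si] at h1
  have h2 : quad Si x ≤ ‖x‖ * ‖Si x‖ := real_inner_le_norm _ _
  have h0 := hM.symmPos_inv.nonneg x
  nlinarith [hM.mu_pos, sq_nonneg (‖x‖ - mu * ‖Si x‖)]

theorem norm_sq_le_quad_inv (hM : CovModel D a S Si mu R kap) (x : E) :
    ‖x‖ ^ 2 ≤ R ^ 2 * quad Si x := by
  have h1 := hM.symmPos.inner_sq_le x (Si x)
  rw [hM.S_Si, hM.quad_S_Si, real_inner_self_eq_norm_sq] at h1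
  have h2 := mul_le_mul_of_nonneg_right (hM.le_R x) (hM.symmPos_inv.nonneg x)
  rcases (sq_nonneg ‖x‖).eq_or_lt with h | h
  · rw [← h]; exact mul_nonneg (sq_nonneg _) (hM.symmPos_inv.nonneg x)
  · nlinarith

theorem quad_le_quad_inv (hM : CovModel D a S Si mu R kap) (x : E) :
    quad S x ≤ R ^ 4 * quad Si x := by
  have h1 := hM.le_R x
  have h2 := mul_le_mul_of_nonneg_left (hM.norm_sq_le_quad_inv x) (sq_nonneg R)
  nlinarith

/-! Integrability of the moments that enter a single stochastic step. -/

variable [IsProbabilityMeasure D]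

theorem integrable_norm_sq (hM : CovModel D a S Si mu R kap) [BorelSpace E] :
    Integrable (fun p => ‖a p‖ ^ 2) D := by
  refine ((integrable_const (1 : ℝ)).add hM.integrable_norm_pow_four).mono'
    (hM.measurable_feature.norm.pow_const 2).aestronglyMeasurable
    (Filter.Eventually.of_forall fun p => ?_)
  rw [Real.norm_of_nonneg (by positivity)]
  simp only [Pi.add_apply]
  nlinarith [sq_nonneg (‖a p‖ ^ 2 - 1), sq_nonneg (‖a p‖ ^ 2)]

variable [BorelSpace E] [SecondCountableTopology E]

theorem integrable_inner_mul_inner (hM : CovModel D a S Si mu R kap) (x y : E) :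
    Integrable (fun p => inner ℝ (a p) x * inner ℝ (a p) y) D := by
  refine (hM.integrable_norm_sq.mul_const (‖x‖ * ‖y‖)).mono'
    ((hM.measurable_feature.inner_const).mul
      (hM.measurable_feature.inner_const)).aestronglyMeasurable
    (Filter.Eventually.of_forall fun p => ?_)
  rw [norm_mul]
  calc ‖inner ℝ (a p) x‖ * ‖inner ℝ (a p) y‖ ≤ (‖a p‖ * ‖x‖) * (‖a p‖ * ‖y‖) :=
        mul_le_mul (norm_inner_le_norm _ _) (norm_inner_le_norm _ _) (norm_nonneg _)
          (by positivity)
    _ = _ := by ring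

theorem integrable_fourth (hM : CovModel D a S Si mu R kap) (x : E) :
    Integrable (fun p => ‖a p‖ ^ 2 * inner ℝ (a p) x ^ 2) D := by
  refine (hM.integrable_norm_pow_four.mul_const (‖x‖ ^ 2)).mono'
    ((hM.measurable_feature.norm.pow_const 2).mul
      (hM.measurable_feature.inner_const.pow_const 2)).aestronglyMeasurable
    (Filter.Eventually.of_forall fun p => ?_)
  rw [Real.norm_of_nonneg (by positivity)]
  have := mul_le_mul_of_nonneg_left (inner_sq_le_norm (a p) x) (sq_nonneg ‖a p‖)
  linarith

theorem measurable_quad {T : E →L[ℝ] E} (hM : CovModel D a S Si mu R kap) :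
    Measurable fun p => quad T (a p) :=
  (continuous_quad T).measurable.comp hM.measurable_feature

theorem integrable_fourth_inv (hM : CovModel D a S Si mu R kap) (x : E) :
    Integrable (fun p => quad Si (a p) * inner ℝ (a p) x ^ 2) D := by
  refine ((hM.integrable_fourth x).div_const mu).mono'
    (hM.measurable_quad.mul
      (hM.measurable_feature.inner_const.pow_const 2)).aestronglyMeasurable
    (Filter.Eventually.of_forall fun p => ?_)
  rw [Real.norm_of_nonneg (mul_nonneg (hM.symmPos_inv.nonneg _) (sq_nonneg _)),
    le_div_iff₀ hM.mu_pos]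
  have := mul_le_mul_of_nonneg_right (hM.mu_mul_quad_inv_le (a p)) (sq_nonneg (inner ℝ (a p) x))
  linarith

end CovModel

/-- A residual `r` for the features `a`: it is uncorrelated with them and `r • a` has a finite
second moment. -/
structure Residual {E : Type*} [NormedAddCommGroup E] [InnerProductSpace ℝ E]
    {A : Type*} [MeasurableSpace A] (D : Measure A) (a : A → E) (r : A → ℝ) : Prop where
  measurable : Measurable r
  integrable_sq : Integrable (fun p => r p ^ 2 * ‖a p‖ ^ 2) D
  integral_mul_inner : ∀ x, ∫ p, r p * inner ℝ (a p) x ∂D = 0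

/-- The stochastic gradient `(⟪a, w⟫ + r) a` of the least-squares problem centred at its solution,
`w` being the current error. -/
def lsGrad {E A : Type*} [NormedAddCommGroup E] [InnerProductSpace ℝ E] (a : A → E) (r : A → ℝ)
    (w : E) (p : A) : E := (inner ℝ (a p) w + r p) • a p

section lsGrad

variable {E : Type*} [NormedAddCommGroup E] [InnerProductSpace ℝ E] [MeasurableSpace E]
  [BorelSpace E] [SecondCountableTopology E]
  {A : Type*} [MeasurableSpace A] {D : Measure A} [IsProbabilityMeasure D]
  {a : A → E} {r : A → ℝ} {S Si : E →L[ℝ] E} {mu R kap : ℝ}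

theorem measurable_lsGrad (hM : CovModel D a S Si mu R kap) (hr : Residual D a r) :
    Measurable fun q : E × A => lsGrad a r q.1 q.2 := by
  have h1 : Measurable fun q : E × A => a q.2 := hM.measurable_feature.comp measurable_snd
  have h2 : Measurable fun q : E × A => r q.2 := hr.measurable.comp measurable_snd
  exact ((h1.inner measurable_fst).add h2).smul h1

theorem Residual.integrable_mul_inner (hM : CovModel D a S Si mu R kap) (hr : Residual D a r)
    (x : E) : Integrable (fun p => r p * inner ℝ (a p) x) D := by
  refine ((hr.integrable_sq.add (integrable_const (1 : ℝ))).mul_const ‖x‖).mono'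
    (hr.measurable.mul hM.measurable_feature.inner_const).aestronglyMeasurable
    (Filter.Eventually.of_forall fun p => ?_)
  rw [norm_mul, Real.norm_eq_abs]
  have h1 : |inner ℝ (a p) x| ≤ ‖a p‖ * ‖x‖ := abs_real_inner_le_norm _ _
  simp only [Pi.add_apply]
  have h2 : |r p| * ‖a p‖ ≤ r p ^ 2 * ‖a p‖ ^ 2 + 1 := by
    rw [← sq_abs (r p)]
    nlinarith [sq_nonneg (|r p| * ‖a p‖ - 1), sq_nonneg (|r p| * ‖a p‖)]
  calc |r p| * ‖inner ℝ (a p) x‖ ≤ |r p| * (‖a p‖ * ‖x‖) := by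
        exact mul_le_mul_of_nonneg_left h1 (abs_nonneg _)
    _ = (|r p| * ‖a p‖) * ‖x‖ := by ring
    _ ≤ _ := mul_le_mul_of_nonneg_right h2 (norm_nonneg _)

theorem Residual.integrable_sq_mul_quad (hM : CovModel D a S Si mu R kap) (hr : Residual D a r) :
    Integrable (fun p => r p ^ 2 * quad Si (a p)) D := by
  refine (hr.integrable_sq.div_const mu).mono'
    ((hr.measurable.pow_const 2).mul hM.measurable_quad).aestronglyMeasurable
    (Filter.Eventually.of_forall fun p => ?_)
  rw [Real.norm_of_nonneg (mul_nonneg (sq_nonneg _) (hM.symmPos_inv.nonneg _)),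
    le_div_iff₀ hM.mu_pos]
  have := mul_le_mul_of_nonneg_left (hM.mu_mul_quad_inv_le (a p)) (sq_nonneg (r p))
  linarith

theorem inner_lsGrad (w x : E) (p : A) :
    inner ℝ (lsGrad a r w p) x = inner ℝ (a p) w * inner ℝ (a p) x + r p * inner ℝ (a p) x := by
  rw [lsGrad, inner_smul_left, conj_trivial, add_mul]

theorem integrable_inner_lsGrad (hM : CovModel D a S Si mu R kap) (hr : Residual D a r) (w x : E) :
    Integrable (fun p => inner ℝ (lsGrad a r w p) x) D := by
  simp_rw [inner_lsGrad]
  exact (hM.integrable_inner_mul_inner w x).add (hr.integrable_mul_inner hM x)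

/-- The stochastic gradient is unbiased. -/
theorem integral_inner_lsGrad (hM : CovModel D a S Si mu R kap) (hr : Residual D a r) (w x : E) :
    ∫ p, inner ℝ (lsGrad a r w p) x ∂D = inner ℝ (S w) x := by
  simp_rw [inner_lsGrad]
  rw [integral_add (hM.integrable_inner_mul_inner w x) (hr.integrable_mul_inner hM x),
    hM.integral_inner_mul_inner, hr.integral_mul_inner, add_zero, hM.symmPos.symm,
    real_inner_comm]

theorem norm_lsGrad_sq_le (w : E) (p : A) :
    ‖lsGrad a r w p‖ ^ 2
      ≤ 2 * (‖a p‖ ^ 2 * inner ℝ (a p) w ^ 2) + 2 * (r p ^ 2 * ‖a p‖ ^ 2) := by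
  rw [lsGrad, norm_smul, mul_pow, Real.norm_eq_abs, sq_abs]
  nlinarith [mul_nonneg (sq_nonneg (inner ℝ (a p) w - r p)) (sq_nonneg ‖a p‖)]

theorem quad_lsGrad_le (hM : CovModel D a S Si mu R kap) (w : E) (p : A) :
    quad Si (lsGrad a r w p)
      ≤ 2 * (quad Si (a p) * inner ℝ (a p) w ^ 2) + 2 * (r p ^ 2 * quad Si (a p)) := by
  rw [lsGrad, quad_smul]
  nlinarith [mul_nonneg (sq_nonneg (inner ℝ (a p) w - r p)) (hM.symmPos_inv.nonneg (a p))]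

theorem integrable_norm_lsGrad_sq (hM : CovModel D a S Si mu R kap) (hr : Residual D a r) (w : E) :
    Integrable (fun p => ‖lsGrad a r w p‖ ^ 2) D := by
  refine (((hM.integrable_fourth w).const_mul 2).add (hr.integrable_sq.const_mul 2)).mono'
    (((measurable_lsGrad hM hr).comp measurable_prodMk_left).norm.pow_const 2).aestronglyMeasurable
    (Filter.Eventually.of_forall fun p => ?_)
  rw [Real.norm_of_nonneg (by positivity)]
  exact norm_lsGrad_sq_le w p

theorem integral_norm_lsGrad_sq_le (hM : CovModel D a S Si mu R kap) (hr : Residual D a r) (w : E) :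
    ∫ p, ‖lsGrad a r w p‖ ^ 2 ∂D
      ≤ 2 * (R ^ 2 * quad S w) + 2 * ∫ p, r p ^ 2 * ‖a p‖ ^ 2 ∂D := by
  have h := integral_mono (integrable_norm_lsGrad_sq hM hr w)
    (((hM.integrable_fourth w).const_mul 2).add (hr.integrable_sq.const_mul 2))
    (fun p => norm_lsGrad_sq_le w p)
  simp only [Pi.add_apply] at h
  rw [integral_add ((hM.integrable_fourth w).const_mul 2) (hr.integrable_sq.const_mul 2),
    integral_const_mul, integral_const_mul] at h
  linarith [hM.fourth w]

theorem integrable_quad_lsGrad (hM : CovModel D a S Si mu R kap) (hr : Residual D a r) (w : E) :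
    Integrable (fun p => quad Si (lsGrad a r w p)) D := by
  refine (((hM.integrable_fourth_inv w).const_mul 2).add
    ((hr.integrable_sq_mul_quad hM).const_mul 2)).mono'
    ((continuous_quad Si).measurable.comp
      ((measurable_lsGrad hM hr).comp measurable_prodMk_left)).aestronglyMeasurable
    (Filter.Eventually.of_forall fun p => ?_)
  rw [Real.norm_of_nonneg (hM.symmPos_inv.nonneg _)]
  exact quad_lsGrad_le hM w p

theorem integral_quad_lsGrad_le (hM : CovModel D a S Si mu R kap) (hr : Residual D a r) (w : E) :
    ∫ p, quad Si (lsGrad a r w p) ∂D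
      ≤ 2 * (kap * quad S w) + 2 * ∫ p, r p ^ 2 * quad Si (a p) ∂D := by
  have h := integral_mono (integrable_quad_lsGrad hM hr w)
    (((hM.integrable_fourth_inv w).const_mul 2).add
      ((hr.integrable_sq_mul_quad hM).const_mul 2))
    (fun p => quad_lsGrad_le hM w p)
  simp only [Pi.add_apply] at h
  rw [integral_add ((hM.integrable_fourth_inv w).const_mul 2)
    ((hr.integrable_sq_mul_quad hM).const_mul 2),
    integral_const_mul, integral_const_mul] at h
  linarith [hM.fourth_inv w]

end lsGrad

/-! ### One step of the centred inner loop -/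

/-- The relations between the inner-loop parameters that the analysis uses; they determine `γ` and
`θ` from the step size `η`. -/
structure InnerParams (mu R kap eta gamma theta : ℝ) : Prop where
  eta_pos : 0 < eta
  eta_mul_sq_le : eta * R ^ 2 ≤ 1 / 16
  gamma_pos : 0 < gamma
  gamma_mul_mu : gamma * mu = theta
  mu_mul_gamma_sq : mu * gamma ^ 2 * kap = eta / 16
  theta_pos : 0 < theta
  theta_le_one : theta ≤ 1

section Step

variable {E : Type*} [NormedAddCommGroup E] [InnerProductSpace ℝ E]

/-- The query point `x/(1+θ) + θz/(1+θ)` of the inner loop. -/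
noncomputable def mid (theta : ℝ) (s : E × E) : E :=
  (1 / (1 + theta)) • s.1 + (theta / (1 + theta)) • s.2

/-- The inner update of the pair of errors, driven by the gradient `g`. -/
noncomputable def gradStep (eta gamma theta : ℝ) (s : E × E) (g : E) : E × E :=
  (mid theta s - eta • g, theta • mid theta s + (1 - theta) • s.2 - gamma • g)

/-- The potential `‖u‖² + μ ‖v‖²_{Σ⁻¹}` of a pair of errors. -/
def pot (Si : E →L[ℝ] E) (mu : ℝ) (s : E × E) : ℝ := ‖s.1‖ ^ 2 + mu * quad Si s.2

variable {A : Type*} [MeasurableSpace E] [MeasurableSpace A] {D : Measure A} {a : A → E}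
  {r : A → ℝ} {S Si : E →L[ℝ] E} {mu R kap eta gamma theta : ℝ}

theorem pot_nonneg (hM : CovModel D a S Si mu R kap) (s : E × E) : 0 ≤ pot Si mu s :=
  add_nonneg (sq_nonneg _) (mul_nonneg hM.mu_pos.le (hM.symmPos_inv.nonneg _))

theorem continuous_pot (Si : E →L[ℝ] E) (mu : ℝ) : Continuous (pot Si mu) :=
  (continuous_fst.norm.pow 2).add (((continuous_quad Si).comp continuous_snd).const_mul mu)

theorem continuous_mid (theta : ℝ) : Continuous (mid theta : E × E → E) :=
  (continuous_fst.const_smul _).add (continuous_snd.const_smul _)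

theorem smul_mid {theta : ℝ} (h : 0 < theta) (s : E × E) :
    (1 + theta) • mid theta s = s.1 + theta • s.2 := by
  have : 1 + theta ≠ 0 := by positivity
  rw [mid, smul_add, smul_smul, smul_smul, mul_one_div_cancel this, one_smul,
    mul_div_cancel₀ _ this]

/-- The direction against which the gradient is tested when the potential is expanded. -/
noncomputable def testVec (Si : E →L[ℝ] E) (mu eta gamma theta : ℝ) (s : E × E) : E :=
  (2 * eta) • mid theta s + (2 * (gamma * mu)) • Si (theta • mid theta s + (1 - theta) • s.2)

/-- Expansion of the potential after one update with an arbitrary gradient `g`. With `w` the query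
point, the terms of order zero collapse to `(1 - θ)` times the old potential because
`θ (θ w + (1 - θ) v) = w - (1 - θ) u`. -/
theorem pot_gradStep_le (hM : CovModel D a S Si mu R kap)
    (hp : InnerParams mu R kap eta gamma theta) (s : E × E) (g : E) :
    pot Si mu (gradStep eta gamma theta s g) ≤ (1 - theta) * pot Si mu s
      + (inner ℝ (S (mid theta s)) (testVec Si mu eta gamma theta s)
        - inner ℝ g (testVec Si mu eta gamma theta s))
      - 2 * eta * quad S (mid theta s) + eta ^ 2 * ‖g‖ ^ 2 + mu * gamma ^ 2 * quad Si g := by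
  obtain ⟨u, v⟩ := s
  set w := mid theta (u, v) with hw
  have hwe : (1 + theta) • w = u + theta • v := smul_mid hp.theta_pos _
  set w' := theta • w + (1 - theta) • v with hw'
  have hkey : theta • w' = w - (1 - theta) • u := by
    have : theta • v = (1 + theta) • w - u := by rw [hwe]; abel
    rw [hw', smul_add, smul_comm theta (1 - theta) v, this]
    module
  have hconv := hM.symmPos_inv.quad_convex hp.theta_pos.le hp.theta_le_one w v
  rw [← hw'] at hconv
  have hmw := hM.mu_mul_quad_inv_le w
  -- the potential at `g = 0`, corrected by the `w'`-part of the test against `Σ w`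
  have hzero : ‖w‖ ^ 2 + mu * quad Si w' - 2 * theta * inner ℝ w w'
      ≤ (1 - theta) * pot Si mu (u, v) := by
    have h1 : theta * inner ℝ w w' = ‖w‖ ^ 2 - (1 - theta) * inner ℝ w u := by
      rw [← inner_smul_right, hkey, inner_sub_right, inner_smul_right, real_inner_self_eq_norm_sq]
    have h2 : 2 * inner ℝ w u ≤ ‖w‖ ^ 2 + ‖u‖ ^ 2 := by
      have := real_inner_le_norm w u
      nlinarith [sq_nonneg (‖w‖ - ‖u‖)]
    have h3 : (1 - theta) * (2 * inner ℝ w u) ≤ (1 - theta) * (‖w‖ ^ 2 + ‖u‖ ^ 2) :=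
      mul_le_mul_of_nonneg_left h2 (by linarith [hp.theta_le_one])
    have h4 := mul_le_mul_of_nonneg_left hconv hM.mu_pos.le
    have h5 := mul_le_mul_of_nonneg_left hmw hp.theta_pos.le
    simp only [pot]
    nlinarith
  have hL : inner ℝ (S w) (testVec Si mu eta gamma theta (u, v))
      = 2 * eta * quad S w + 2 * theta * inner ℝ w w' := by
    rw [testVec, ← hw, ← hw', inner_add_right, inner_smul_right, inner_smul_right,
      hM.inner_S_Si, hp.gamma_mul_mu, quad, real_inner_comm w]
  have hg : inner ℝ g (testVec Si mu eta gamma theta (u, v))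
      = 2 * eta * inner ℝ w g + 2 * (gamma * mu) * inner ℝ w' (Si g) := by
    rw [testVec, ← hw, ← hw', inner_add_right, inner_smul_right, inner_smul_right,
      hM.symm_inv, real_inner_comm w]
  have hexp : pot Si mu (gradStep eta gamma theta (u, v) g)
      = ‖w‖ ^ 2 - 2 * eta * inner ℝ w g + eta ^ 2 * ‖g‖ ^ 2
        + mu * (quad Si w' - 2 * gamma * inner ℝ w' (Si g) + gamma ^ 2 * quad Si g) := by
    simp only [pot, gradStep, ← hw]
    rw [← hw', hM.symmPos_inv.quad_sub, quad_smul, map_smul, inner_smul_right, norm_sub_sq_real,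
      inner_smul_right, norm_smul, mul_pow, Real.norm_eq_abs, sq_abs]
    ring
  rw [hexp, hL, hg]
  linarith

theorem pot_gradStep_mean_le (hM : CovModel D a S Si mu R kap)
    (hp : InnerParams mu R kap eta gamma theta) (s : E × E) :
    pot Si mu (gradStep eta gamma theta s (S (mid theta s))) ≤ (1 - theta) * pot Si mu s := by
  have h := pot_gradStep_le hM hp s (S (mid theta s))
  rw [hM.quad_Si_S] at h
  have hN := hM.symmPos.nonneg (mid theta s)
  have h1 := hM.norm_sq_le_quad_inv (S (mid theta s))
  rw [hM.quad_Si_S] at h1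
  have h2 : eta ^ 2 * ‖S (mid theta s)‖ ^ 2 ≤ eta / 16 * quad S (mid theta s) := by
    calc eta ^ 2 * ‖S (mid theta s)‖ ^ 2 ≤ eta ^ 2 * (R ^ 2 * quad S (mid theta s)) := by gcongr
      _ = eta * (eta * R ^ 2) * quad S (mid theta s) := by ring
      _ ≤ eta * (1 / 16) * quad S (mid theta s) := by
        have := hp.eta_pos; have := hp.eta_mul_sq_le; gcongr
      _ = _ := by ring
  have h3 : mu * gamma ^ 2 * quad S (mid theta s) ≤ eta / 16 * quad S (mid theta s) := by
    refine mul_le_mul_of_nonneg_right ?_ hN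
    rw [← hp.mu_mul_gamma_sq]
    have : 0 ≤ mu * gamma ^ 2 := mul_nonneg hM.mu_pos.le (sq_nonneg _)
    nlinarith [hM.one_le_kap]
  have h4 := mul_nonneg hp.eta_pos.le hN
  linarith

/-- The additive noise level of the potential recursion. -/
noncomputable def noiseLevel (D : Measure A) (a : A → E) (r : A → ℝ) (Si : E →L[ℝ] E)
    (mu eta gamma : ℝ) : ℝ :=
  2 * eta ^ 2 * ∫ p, r p ^ 2 * ‖a p‖ ^ 2 ∂D
    + 2 * (mu * gamma ^ 2) * ∫ p, r p ^ 2 * quad Si (a p) ∂D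

theorem noiseLevel_nonneg (hM : CovModel D a S Si mu R kap) :
    0 ≤ noiseLevel D a r Si mu eta gamma := by
  have h1 : 0 ≤ ∫ p, r p ^ 2 * ‖a p‖ ^ 2 ∂D := integral_nonneg fun p => by positivity
  have h2 : 0 ≤ ∫ p, r p ^ 2 * quad Si (a p) ∂D :=
    integral_nonneg fun p => mul_nonneg (sq_nonneg _) (hM.symmPos_inv.nonneg _)
  have := hM.mu_pos
  rw [noiseLevel]; positivity

variable [BorelSpace E] [SecondCountableTopology E] [IsProbabilityMeasure D]

/-- One inner update with a fresh sample. -/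
noncomputable def lsStep (eta gamma theta : ℝ) (a : A → E) (r : A → ℝ) (s : E × E)
    (p : A) : E × E :=
  gradStep eta gamma theta s (lsGrad a r (mid theta s) p)

theorem measurable_lsStep (hM : CovModel D a S Si mu R kap) (hr : Residual D a r) :
    Measurable fun q : (E × E) × A => lsStep eta gamma theta a r q.1 q.2 := by
  have hm : Measurable fun q : (E × E) × A => mid theta q.1 :=
    (continuous_mid theta).measurable.comp measurable_fst
  have hg : Measurable fun q : (E × E) × A => lsGrad a r (mid theta q.1) q.2 :=
    (measurable_lsGrad hM hr).comp (hm.prodMk measurable_snd)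
  exact (hm.sub (hg.const_smul eta)).prodMk
    (((hm.const_smul theta).add ((measurable_snd.comp measurable_fst).const_smul (1 - theta))).sub
      (hg.const_smul gamma))

/-- Right-hand side of `pot_gradStep_le` as a function of the sample. -/
theorem integrable_pot_bound (hM : CovModel D a S Si mu R kap) (hr : Residual D a r) (s : E × E)
    (k : ℝ) (x : E) :
    Integrable (fun p => k - inner ℝ (lsGrad a r (mid theta s) p) x
      + eta ^ 2 * ‖lsGrad a r (mid theta s) p‖ ^ 2
      + mu * gamma ^ 2 * quad Si (lsGrad a r (mid theta s) p)) D :=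
  (((integrable_const k).sub (integrable_inner_lsGrad hM hr _ x)).add
    ((integrable_norm_lsGrad_sq hM hr _).const_mul _)).add
    ((integrable_quad_lsGrad hM hr _).const_mul _)

theorem integrable_pot_lsStep (hM : CovModel D a S Si mu R kap)
    (hp : InnerParams mu R kap eta gamma theta) (hr : Residual D a r) (s : E × E) :
    Integrable (fun p => pot Si mu (lsStep eta gamma theta a r s p)) D := by
  refine (integrable_pot_bound (eta := eta) (gamma := gamma) (theta := theta) hM hr s
    ((1 - theta) * pot Si mu s + inner ℝ (S (mid theta s)) (testVec Si mu eta gamma theta s)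
      - 2 * eta * quad S (mid theta s)) (testVec Si mu eta gamma theta s)).mono'
    ((continuous_pot Si mu).measurable.comp
      ((measurable_lsStep hM hr).comp measurable_prodMk_left)).aestronglyMeasurable
    (Filter.Eventually.of_forall fun p => ?_)
  rw [Real.norm_of_nonneg (pot_nonneg hM _)]
  have := pot_gradStep_le hM hp s (lsGrad a r (mid theta s) p)
  rw [lsStep]
  linarith

theorem integral_pot_lsStep_le (hM : CovModel D a S Si mu R kap)
    (hp : InnerParams mu R kap eta gamma theta) (hr : Residual D a r) (s : E × E) :
    ∫ p, pot Si mu (lsStep eta gamma theta a r s p) ∂D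
      ≤ (1 - theta) * pot Si mu s - eta * quad S (mid theta s)
        + noiseLevel D a r Si mu eta gamma := by
  set k := (1 - theta) * pot Si mu s
    + inner ℝ (S (mid theta s)) (testVec Si mu eta gamma theta s)
    - 2 * eta * quad S (mid theta s) with hk
  set x := testVec Si mu eta gamma theta s with hx
  set w := mid theta s with hw
  have h1 : ∫ p, pot Si mu (lsStep eta gamma theta a r s p) ∂D
      ≤ ∫ p, (k - inner ℝ (lsGrad a r w p) x + eta ^ 2 * ‖lsGrad a r w p‖ ^ 2
        + mu * gamma ^ 2 * quad Si (lsGrad a r w p)) ∂D := by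
    refine integral_mono (integrable_pot_lsStep hM hp hr s)
      (integrable_pot_bound hM hr s k x) fun p => ?_
    have := pot_gradStep_le hM hp s (lsGrad a r (mid theta s) p)
    simp only [lsStep]
    linarith
  have hi1 := integrable_inner_lsGrad hM hr w x
  have hi2 := (integrable_norm_lsGrad_sq hM hr w).const_mul (eta ^ 2)
  have hi3 := (integrable_quad_lsGrad hM hr w).const_mul (mu * gamma ^ 2)
  have hi4 : Integrable (fun p => k - inner ℝ (lsGrad a r w p) x) D := (integrable_const k).sub hi1
  have hi5 : Integrable (fun p => k - inner ℝ (lsGrad a r w p) x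
      + eta ^ 2 * ‖lsGrad a r w p‖ ^ 2) D := hi4.add hi2
  rw [integral_add hi5 hi3, integral_add hi4 hi2, integral_sub (integrable_const k) hi1,
    integral_inner_lsGrad hM hr, integral_const, probReal_univ, one_smul, integral_const_mul,
    integral_const_mul] at h1
  have hN := hM.symmPos.nonneg w
  have h2 := mul_le_mul_of_nonneg_left (integral_norm_lsGrad_sq_le hM hr w) (sq_nonneg eta)
  have h3 := mul_le_mul_of_nonneg_left (integral_quad_lsGrad_le hM hr w)
    (mul_nonneg hM.mu_pos.le (sq_nonneg gamma))
  have h4 : eta ^ 2 * (2 * (R ^ 2 * quad S w)) ≤ eta / 8 * quad S w := by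
    have := mul_le_mul_of_nonneg_left hp.eta_mul_sq_le (mul_nonneg hp.eta_pos.le hN)
    nlinarith
  have h5 : mu * gamma ^ 2 * (2 * (kap * quad S w)) = eta / 8 * quad S w := by
    have := hp.mu_mul_gamma_sq
    linear_combination (2 * quad S w) * this
  have h6 := mul_nonneg hp.eta_pos.le hN
  rw [noiseLevel]
  linarith

/-- Adding the centred gradient to a martingale increases its second moment by at most the second
moment of the gradient. -/
theorem integral_quad_add_noise_le (hM : CovModel D a S Si mu R kap) (hr : Residual D a r)
    (w n : E) :
    Integrable (fun p => quad Si (n + (lsGrad a r w p - S w))) D ∧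
    ∫ p, quad Si (n + (lsGrad a r w p - S w)) ∂D
      ≤ quad Si n + (2 * (kap * quad S w) + 2 * ∫ p, r p ^ 2 * quad Si (a p) ∂D) := by
  have hexp : ∀ p, quad Si (n + (lsGrad a r w p - S w)) = quad Si (n - S w)
      + 2 * inner ℝ (lsGrad a r w p) (Si (n - S w)) + quad Si (lsGrad a r w p) := by
    intro p
    rw [show n + (lsGrad a r w p - S w) = (n - S w) + lsGrad a r w p by abel,
      hM.symmPos_inv.quad_add, hM.symm_inv]
  have hi1 := (integrable_inner_lsGrad hM hr w (Si (n - S w))).const_mul 2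
  have hi2 := integrable_quad_lsGrad hM hr w
  simp_rw [hexp]
  have hi3 : Integrable (fun p => quad Si (n - S w)
      + 2 * inner ℝ (lsGrad a r w p) (Si (n - S w))) D := (integrable_const _).add hi1
  refine ⟨hi3.add hi2, ?_⟩
  rw [integral_add hi3 hi2, integral_add (integrable_const _) hi1,
    integral_const_mul, integral_inner_lsGrad hM hr, integral_const, probReal_univ, one_smul,
    hM.inner_S_Si, inner_sub_right, hM.symmPos_inv.quad_sub, hM.quad_Si_S, hM.Si_S]
  have h1 := integral_quad_lsGrad_le hM hr w
  have hN := hM.symmPos.nonneg w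
  have h2 : inner ℝ w (S w) = quad S w := rfl
  rw [h2, real_inner_comm n w]
  linarith

end Step

/-! ### The inner loop run on independent samples -/

/-- `X 0, X 1, …` are independent samples from `D`. -/
structure IIDSample {Ω A : Type*} [MeasurableSpace Ω] [MeasurableSpace A] (X : ℕ → Ω → A)
    (D : Measure A) (P : Measure Ω) : Prop where
  measurable : ∀ i, Measurable (X i)
  indep : iIndepFun X P
  law : ∀ i, P.map (X i) = D

section Chain

variable {E : Type*} [NormedAddCommGroup E] [InnerProductSpace ℝ E] [MeasurableSpace E]
  [BorelSpace E] [SecondCountableTopology E]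
  {A : Type*} [MeasurableSpace A] {D : Measure A} [IsProbabilityMeasure D] {a : A → E}
  {r : A → ℝ} {S Si : E →L[ℝ] E} {mu R kap eta gamma theta : ℝ}

/-- The pair of errors after `t` inner updates. -/
noncomputable def lsIter (eta gamma theta : ℝ) (a : A → E) (r : A → ℝ) (s0 : E × E)
    (x : ℕ → A) : ℕ → E × E
  | 0 => s0
  | t + 1 => lsStep eta gamma theta a r (lsIter eta gamma theta a r s0 x t) (x t)

theorem measurable_lsIter (hM : CovModel D a S Si mu R kap) (hr : Residual D a r) (s0 : E × E)
    (t : ℕ) : Measurable fun x : ℕ → A => lsIter eta gamma theta a r s0 x t := by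
  induction t with
  | zero => exact measurable_const
  | succ t ih => exact (measurable_lsStep hM hr).comp (ih.prodMk (measurable_pi_apply t))

theorem dependsOn_lsIter (s0 : E × E) (t : ℕ) :
    DependsOn (fun x : ℕ → A => lsIter eta gamma theta a r s0 x t) (Finset.range t : Set ℕ) := by
  induction t with
  | zero => intro x y _; rfl
  | succ t ih =>
    intro x y hxy
    have h1 : lsIter eta gamma theta a r s0 x t = lsIter eta gamma theta a r s0 y t :=
      ih fun i hi => hxy i (by simp at hi ⊢; omega)
    have h2 : x t = y t := hxy t (by simp)
    simp only [lsIter]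
    rw [h1, h2]

/-- The centred gradient noise accumulated between the times `m` and `n`. -/
noncomputable def noiseSum (eta gamma theta : ℝ) (a : A → E) (r : A → ℝ) (S : E →L[ℝ] E)
    (s0 : E × E) (m n : ℕ) (x : ℕ → A) : E :=
  ∑ t ∈ Finset.Ico m n, (lsGrad a r (mid theta (lsIter eta gamma theta a r s0 x t)) (x t)
    - S (mid theta (lsIter eta gamma theta a r s0 x t)))

theorem measurable_noiseSum (hM : CovModel D a S Si mu R kap) (hr : Residual D a r) (s0 : E × E)
    (m n : ℕ) : Measurable (noiseSum eta gamma theta a r S s0 m n) := by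
  refine Finset.measurable_sum _ fun t _ => ?_
  have h := (continuous_mid (E := E) theta).measurable.comp
    (measurable_lsIter (eta := eta) (gamma := gamma) (theta := theta) hM hr s0 t)
  exact ((measurable_lsGrad hM hr).comp (h.prodMk (measurable_pi_apply t))).sub
    (S.continuous.measurable.comp h)

theorem dependsOn_noiseSum (s0 : E × E) (m n : ℕ) :
    DependsOn (noiseSum eta gamma theta a r S s0 m n) (Finset.range n : Set ℕ) := by
  intro x y hxy
  refine Finset.sum_congr rfl fun t ht => ?_
  have htn := (Finset.mem_Ico.1 ht).2
  have h1 : lsIter eta gamma theta a r s0 x t = lsIter eta gamma theta a r s0 y t :=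
    dependsOn_lsIter s0 t fun i hi => hxy i (by simp at hi ⊢; omega)
  have h2 : x t = y t := hxy t (by simpa using htn)
  rw [h1, h2]

variable {Ω : Type*} [MeasurableSpace Ω] {P : Measure Ω} [IsProbabilityMeasure P] {X : ℕ → Ω → A}

/-- Freezing the past at time `t` and averaging over the fresh sample. -/
theorem IIDSample.integral_le (hX : IIDSample X D P) {σ : Type*} [MeasurableSpace σ] {t : ℕ}
    {G : (ℕ → A) → σ} (hG : Measurable G) (hGt : DependsOn G (Finset.range t : Set ℕ))
    {V : σ × A → ℝ} (hV : Measurable V) (hV0 : ∀ q, 0 ≤ V q) {U : σ → ℝ}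
    (hVi : ∀ s, Integrable (fun p => V (s, p)) D) (hVU : ∀ s, ∫ p, V (s, p) ∂D ≤ U s)
    (hU : Integrable (fun ω => U (G fun i => X i ω)) P) :
    Integrable (fun ω => V (G fun i => X i ω, X t ω)) P ∧
      ∫ ω, V (G fun i => X i ω, X t ω) ∂P ≤ ∫ ω, U (G fun i => X i ω) ∂P := by
  have hind : IndepFun (fun ω => G fun i => X i ω) (X t) P :=
    indepFun_of_dependsOn hX.measurable hX.indep hG (measurable_pi_apply t)
      (I := Finset.range t) (J := {t}) (by simp) hGt
      (fun x y hxy => hxy t (by simp))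
  refine integral_le_of_indepFun (hG.comp (measurable_pi_lambda _ hX.measurable))
    (hX.measurable t) hind hV hV0 (fun s => ?_) (fun s => ?_) hU
  · have := hVi s
    rw [← hX.law t] at this
    exact (integrable_map_measure (hV.comp measurable_prodMk_left).aestronglyMeasurable
      (hX.measurable t).aemeasurable).1 this
  · have := hVU s
    rw [← hX.law t, integral_map (f := fun p => V (s, p)) (hX.measurable t).aemeasurable
      (hV.comp measurable_prodMk_left).aestronglyMeasurable] at this
    exact this

theorem IIDSample.integral_eq (hX : IIDSample X D P) {σ : Type*} [MeasurableSpace σ] {t : ℕ}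
    {G : (ℕ → A) → σ} (hG : Measurable G) (hGt : DependsOn G (Finset.range t : Set ℕ))
    {f : σ × A → ℝ} (hf : Measurable f)
    (hfi : Integrable (fun ω => f (G fun i => X i ω, X t ω)) P) :
    ∫ ω, f (G fun i => X i ω, X t ω) ∂P = ∫ ω, (∫ p, f (G fun i => X i ω, p) ∂D) ∂P := by
  have hind : IndepFun (fun ω => G fun i => X i ω) (X t) P :=
    indepFun_of_dependsOn hX.measurable hX.indep hG (measurable_pi_apply t)
      (I := Finset.range t) (J := {t}) (by simp) hGt
      (fun x y hxy => hxy t (by simp))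
  rw [integral_eq_of_indepFun (S := fun ω => G fun i => X i ω)
    (hG.comp (measurable_pi_lambda _ hX.measurable)) (hX.measurable t) hind hf hfi]
  refine integral_congr_ae (Filter.Eventually.of_forall fun ω => ?_)
  have := integral_map (hX.measurable t).aemeasurable (μ := P)
    (f := fun p => f (G fun i => X i ω, p))
    (hf.comp measurable_prodMk_left).aestronglyMeasurable
  rw [hX.law t] at this
  exact this.symm

variable (s0 : E × E)

/-- `𝔼 ‖w_t‖²_Σ`, the mean squared error of the query point at time `t`. -/
noncomputable def midErr (P : Measure Ω) (X : ℕ → Ω → A) (S : E →L[ℝ] E) (eta gamma theta : ℝ)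
    (a : A → E) (r : A → ℝ) (s0 : E × E) (t : ℕ) : ℝ :=
  ∫ ω, quad S (mid theta (lsIter eta gamma theta a r s0 (fun i => X i ω) t)) ∂P

/-- The mean potential at time `t`. -/
noncomputable def meanPot (P : Measure Ω) (X : ℕ → Ω → A) (Si : E →L[ℝ] E) (mu eta gamma theta : ℝ)
    (a : A → E) (r : A → ℝ) (s0 : E × E) (t : ℕ) : ℝ :=
  ∫ ω, pot Si mu (lsIter eta gamma theta a r s0 (fun i => X i ω) t) ∂P

theorem measurable_lsIter_sample (hM : CovModel D a S Si mu R kap) (hr : Residual D a r)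
    (hX : IIDSample X D P) (t : ℕ) :
    Measurable fun ω => lsIter eta gamma theta a r s0 (fun i => X i ω) t :=
  (measurable_lsIter hM hr s0 t).comp (measurable_pi_lambda _ hX.measurable)

theorem meanPot_aux (hM : CovModel D a S Si mu R kap) (hp : InnerParams mu R kap eta gamma theta)
    (hr : Residual D a r) (hX : IIDSample X D P) (t : ℕ)
    (h : Integrable
      (fun ω => pot Si mu (lsIter eta gamma theta a r s0 (fun i => X i ω) t)) P) :
    Integrable (fun ω => quad S (mid theta (lsIter eta gamma theta a r s0 (fun i => X i ω) t))) P ∧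
    Integrable (fun ω => pot Si mu (lsIter eta gamma theta a r s0 (fun i => X i ω) (t + 1))) P ∧
    meanPot P X Si mu eta gamma theta a r s0 (t + 1)
        + eta * midErr P X S eta gamma theta a r s0 t
      ≤ (1 - theta) * meanPot P X Si mu eta gamma theta a r s0 t
        + noiseLevel D a r Si mu eta gamma := by
  have hmeas := measurable_lsIter_sample (eta := eta) (gamma := gamma) (theta := theta)
    s0 hM hr hX t
  have hstep : ∀ s : E × E, 0 ≤ (1 - theta) * pot Si mu s - eta * quad S (mid theta s)
      + noiseLevel D a r Si mu eta gamma := fun s =>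
    (integral_nonneg fun p => pot_nonneg hM _).trans (integral_pot_lsStep_le hM hp hr s)
  -- nonnegativity of the expected potential controls the error of the query point
  have hN : Integrable
      (fun ω => quad S (mid theta (lsIter eta gamma theta a r s0 (fun i => X i ω) t))) P := by
    refine (((h.const_mul (1 - theta)).add
      (integrable_const (noiseLevel D a r Si mu eta gamma))).div_const eta).mono'
      ((continuous_quad S).measurable.comp
        ((continuous_mid theta).measurable.comp hmeas)).aestronglyMeasurable
      (Filter.Eventually.of_forall fun ω => ?_)
    rw [Real.norm_of_nonneg (hM.symmPos.nonneg _), le_div_iff₀ hp.eta_pos]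
    have := hstep (lsIter eta gamma theta a r s0 (fun i => X i ω) t)
    simp only [Pi.add_apply]
    linarith
  have hU1 := (h.const_mul (1 - theta)).sub (hN.const_mul eta)
  have hU : Integrable (fun ω => (1 - theta)
        * pot Si mu (lsIter eta gamma theta a r s0 (fun i => X i ω) t)
      - eta * quad S (mid theta (lsIter eta gamma theta a r s0 (fun i => X i ω) t))
      + noiseLevel D a r Si mu eta gamma) P := hU1.add (integrable_const _)
  have key := hX.integral_le (G := fun x => lsIter eta gamma theta a r s0 x t)
    (measurable_lsIter hM hr s0 t) (dependsOn_lsIter s0 t)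
    (V := fun q => pot Si mu (lsStep eta gamma theta a r q.1 q.2))
    ((continuous_pot Si mu).measurable.comp (measurable_lsStep hM hr))
    (fun q => pot_nonneg hM _) (integrable_pot_lsStep hM hp hr)
    (integral_pot_lsStep_le hM hp hr) hU
  refine ⟨hN, key.1, ?_⟩
  have h2 := key.2
  rw [integral_add (by exact hU1) (integrable_const _), integral_sub (h.const_mul _)
    (hN.const_mul _), integral_const_mul, integral_const_mul, integral_const, probReal_univ,
    one_smul] at h2
  have h3 : meanPot P X Si mu eta gamma theta a r s0 (t + 1) ≤ _ := h2
  simp only [meanPot, midErr] at h3 ⊢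
  linarith

theorem integrable_pot_lsIter (hM : CovModel D a S Si mu R kap)
    (hp : InnerParams mu R kap eta gamma theta) (hr : Residual D a r) (hX : IIDSample X D P)
    (t : ℕ) :
    Integrable (fun ω => pot Si mu (lsIter eta gamma theta a r s0 (fun i => X i ω) t)) P := by
  induction t with
  | zero => exact (integrable_const (pot Si mu s0) : Integrable (fun _ : Ω => pot Si mu s0) P)
  | succ t ih => exact (meanPot_aux s0 hM hp hr hX t ih).2.1

theorem integrable_quad_mid (hM : CovModel D a S Si mu R kap)
    (hp : InnerParams mu R kap eta gamma theta) (hr : Residual D a r) (hX : IIDSample X D P)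
    (t : ℕ) : Integrable
      (fun ω => quad S (mid theta (lsIter eta gamma theta a r s0 (fun i => X i ω) t))) P :=
  (meanPot_aux s0 hM hp hr hX t (integrable_pot_lsIter s0 hM hp hr hX t)).1

theorem meanPot_succ_le (hM : CovModel D a S Si mu R kap)
    (hp : InnerParams mu R kap eta gamma theta) (hr : Residual D a r) (hX : IIDSample X D P)
    (t : ℕ) : meanPot P X Si mu eta gamma theta a r s0 (t + 1)
        + eta * midErr P X S eta gamma theta a r s0 t
      ≤ (1 - theta) * meanPot P X Si mu eta gamma theta a r s0 t
        + noiseLevel D a r Si mu eta gamma :=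
  (meanPot_aux s0 hM hp hr hX t (integrable_pot_lsIter s0 hM hp hr hX t)).2.2

theorem midErr_nonneg (hM : CovModel D a S Si mu R kap) (t : ℕ) :
    0 ≤ midErr P X S eta gamma theta a r s0 t :=
  integral_nonneg fun _ => hM.symmPos.nonneg _

theorem meanPot_nonneg (hM : CovModel D a S Si mu R kap) (t : ℕ) :
    0 ≤ meanPot P X Si mu eta gamma theta a r s0 t :=
  integral_nonneg fun _ => pot_nonneg hM _

theorem meanPot_le (hM : CovModel D a S Si mu R kap)
    (hp : InnerParams mu R kap eta gamma theta) (hr : Residual D a r) (hX : IIDSample X D P)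
    (t : ℕ) : meanPot P X Si mu eta gamma theta a r s0 t
      ≤ (1 - theta) ^ t * pot Si mu s0 + noiseLevel D a r Si mu eta gamma / theta := by
  have hc := noiseLevel_nonneg (r := r) (eta := eta) (gamma := gamma) hM
  induction t with
  | zero =>
    have : 0 ≤ noiseLevel D a r Si mu eta gamma / theta := div_nonneg hc hp.theta_pos.le
    simp only [meanPot, lsIter, integral_const, probReal_univ, one_smul, pow_zero, one_mul]
    linarith
  | succ t ih =>
    have h1 := meanPot_succ_le s0 hM hp hr hX t
    have h2 := mul_nonneg hp.eta_pos.le (midErr_nonneg (P := P) (X := X) (eta := eta)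
      (gamma := gamma) (theta := theta) (r := r) s0 hM t)
    have h3 := mul_le_mul_of_nonneg_left ih (sub_nonneg.2 hp.theta_le_one)
    have h4 : theta * (noiseLevel D a r Si mu eta gamma / theta)
        = noiseLevel D a r Si mu eta gamma := mul_div_cancel₀ _ hp.theta_pos.ne'
    rw [pow_succ]
    linarith

theorem sum_midErr_le (hM : CovModel D a S Si mu R kap)
    (hp : InnerParams mu R kap eta gamma theta) (hr : Residual D a r) (hX : IIDSample X D P)
    (m k : ℕ) : eta * ∑ t ∈ Finset.Ico m (m + k), midErr P X S eta gamma theta a r s0 t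
      ≤ meanPot P X Si mu eta gamma theta a r s0 m + k * noiseLevel D a r Si mu eta gamma := by
  suffices h : meanPot P X Si mu eta gamma theta a r s0 (m + k)
      + eta * ∑ t ∈ Finset.Ico m (m + k), midErr P X S eta gamma theta a r s0 t
      ≤ meanPot P X Si mu eta gamma theta a r s0 m + k * noiseLevel D a r Si mu eta gamma by
    linarith [meanPot_nonneg (P := P) (X := X) (eta := eta) (gamma := gamma) (theta := theta)
      (r := r) s0 hM (m + k)]
  induction k with
  | zero => simp
  | succ k ih =>
    have h1 := meanPot_succ_le s0 hM hp hr hX (m + k)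
    have h2 := mul_nonneg hp.theta_pos.le (meanPot_nonneg (P := P) (X := X) (eta := eta)
      (gamma := gamma) (theta := theta) (r := r) s0 hM (m + k))
    rw [← add_assoc, Finset.sum_Ico_succ_top (by omega), mul_add]
    push_cast
    linarith

theorem noiseSum_bound (hM : CovModel D a S Si mu R kap)
    (hp : InnerParams mu R kap eta gamma theta) (hr : Residual D a r) (hX : IIDSample X D P)
    (m k : ℕ) :
    Integrable (fun ω =>
      quad Si (noiseSum eta gamma theta a r S s0 m (m + k) fun i => X i ω)) P ∧
    ∫ ω, quad Si (noiseSum eta gamma theta a r S s0 m (m + k) fun i => X i ω) ∂P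
      ≤ 2 * kap * ∑ t ∈ Finset.Ico m (m + k), midErr P X S eta gamma theta a r s0 t
        + 2 * k * ∫ p, r p ^ 2 * quad Si (a p) ∂D := by
  induction k with
  | zero => simp [noiseSum, quad_zero]
  | succ k ih =>
    have hN := integrable_quad_mid s0 hM hp hr hX (m + k)
    set ψ := ∫ p, r p ^ 2 * quad Si (a p) ∂D
    have hU2 : Integrable (fun ω => 2 * (kap * quad S (mid theta
        (lsIter eta gamma theta a r s0 (fun i => X i ω) (m + k)))) + 2 * ψ) P :=
      ((hN.const_mul kap).const_mul 2).add (integrable_const _)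
    have key := hX.integral_le (t := m + k)
      (G := fun x => (lsIter eta gamma theta a r s0 x (m + k),
        noiseSum eta gamma theta a r S s0 m (m + k) x))
      ((measurable_lsIter hM hr s0 _).prodMk (measurable_noiseSum hM hr s0 _ _))
      (fun x y hxy => Prod.ext (dependsOn_lsIter s0 _ hxy) (dependsOn_noiseSum s0 _ _ hxy))
      (V := fun q => quad Si (q.1.2 + (lsGrad a r (mid theta q.1.1) q.2 - S (mid theta q.1.1))))
      (by
        have hm : Measurable fun q : ((E × E) × E) × A => mid theta q.1.1 :=
          (continuous_mid theta).measurable.comp (measurable_fst.comp measurable_fst)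
        exact (continuous_quad Si).measurable.comp ((measurable_snd.comp measurable_fst).add
          (((measurable_lsGrad hM hr).comp (hm.prodMk measurable_snd)).sub
            (S.continuous.measurable.comp hm))))
      (fun q => hM.symmPos_inv.nonneg _)
      (U := fun s => quad Si s.2 + (2 * (kap * quad S (mid theta s.1)) + 2 * ψ))
      (fun s => (integral_quad_add_noise_le hM hr (mid theta s.1) s.2).1)
      (fun s => (integral_quad_add_noise_le hM hr (mid theta s.1) s.2).2)
      (ih.1.add hU2)
    have hsucc : ∀ ω, noiseSum eta gamma theta a r S s0 m (m + (k + 1)) (fun i => X i ω)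
        = noiseSum eta gamma theta a r S s0 m (m + k) (fun i => X i ω)
        + (lsGrad a r (mid theta (lsIter eta gamma theta a r s0 (fun i => X i ω) (m + k)))
            (X (m + k) ω)
          - S (mid theta (lsIter eta gamma theta a r s0 (fun i => X i ω) (m + k)))) := by
      intro ω
      rw [noiseSum, ← add_assoc, Finset.sum_Ico_succ_top (by omega)]
      rfl
    simp_rw [hsucc]
    refine ⟨key.1, key.2.trans ?_⟩
    rw [integral_add ih.1 hU2, integral_add ((hN.const_mul kap).const_mul 2) (integrable_const _),
      integral_const_mul, integral_const_mul, integral_const, probReal_univ, one_smul, ← add_assoc m,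
      Finset.sum_Ico_succ_top (by omega)]
    have h3 := ih.2
    have h4 : midErr P X S eta gamma theta a r s0 (m + k) = ∫ ω, quad S (mid theta
        (lsIter eta gamma theta a r s0 (fun i => X i ω) (m + k))) ∂P := rfl
    rw [← h4]
    push_cast
    linarith

end Chain

/-! ### Tail averaging -/

section Average

variable {E : Type*} [NormedAddCommGroup E] [InnerProductSpace ℝ E] [MeasurableSpace E]
  [BorelSpace E] [SecondCountableTopology E]
  {A : Type*} [MeasurableSpace A] {D : Measure A} [IsProbabilityMeasure D] {a : A → E}
  {r : A → ℝ} {S Si : E →L[ℝ] E} {mu R kap eta gamma theta : ℝ}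

/-- The window sum `∑ x_{t+1}` over `m ≤ t < n`. -/
noncomputable def tailSum (eta gamma theta : ℝ) (a : A → E) (r : A → ℝ) (s0 : E × E) (m n : ℕ)
    (x : ℕ → A) : E :=
  ∑ t ∈ Finset.Ico m n, (lsIter eta gamma theta a r s0 x (t + 1)).1

/-- The total gradient over a window, read off from its two ends. -/
noncomputable def boundaryTerm (eta gamma theta : ℝ) (a : A → E) (r : A → ℝ) (s0 : E × E) (m n : ℕ)
    (x : ℕ → A) : E :=
  (1 / (gamma + eta)) • (((lsIter eta gamma theta a r s0 x m).1
      + (lsIter eta gamma theta a r s0 x m).2)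
    - ((lsIter eta gamma theta a r s0 x n).1 + (lsIter eta gamma theta a r s0 x n).2))

theorem gradStep_add (h : 0 < theta) (s : E × E) (g : E) :
    (s.1 + s.2) - ((gradStep eta gamma theta s g).1 + (gradStep eta gamma theta s g).2)
      = (gamma + eta) • g := by
  have h1 : s.1 = (1 + theta) • mid theta s - theta • s.2 := by
    rw [smul_mid h]; abel
  simp only [gradStep]
  generalize mid theta s = w at *
  rw [h1]
  module

/-- The sum of both errors moves by exactly `γ + η` times the gradient, so gradients telescope. -/
theorem sum_lsGrad_eq (hp : InnerParams mu R kap eta gamma theta) (s0 : E × E) {m n : ℕ}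
    (hmn : m ≤ n) (x : ℕ → A) :
    ∑ t ∈ Finset.Ico m n, lsGrad a r (mid theta (lsIter eta gamma theta a r s0 x t)) (x t)
      = boundaryTerm eta gamma theta a r s0 m n x := by
  have hpos : gamma + eta ≠ 0 := (add_pos hp.gamma_pos hp.eta_pos).ne'
  have h : ∀ t, lsGrad a r (mid theta (lsIter eta gamma theta a r s0 x t)) (x t)
      = (1 / (gamma + eta)) • (((lsIter eta gamma theta a r s0 x t).1
        + (lsIter eta gamma theta a r s0 x t).2)
      - ((lsIter eta gamma theta a r s0 x (t + 1)).1
        + (lsIter eta gamma theta a r s0 x (t + 1)).2)) := by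
    intro t
    rw [lsIter, lsStep, gradStep_add hp.theta_pos, smul_smul, one_div_mul_cancel hpos, one_smul]
  rw [Finset.sum_congr rfl fun t _ => h t, ← Finset.smul_sum, boundaryTerm]
  congr 1
  induction n, hmn using Nat.le_induction with
  | base => simp
  | succ n hmn ih => rw [Finset.sum_Ico_succ_top hmn, ih]; abel

theorem tailSum_eq (hM : CovModel D a S Si mu R kap) (hp : InnerParams mu R kap eta gamma theta)
    (s0 : E × E) {m n : ℕ} (hmn : m ≤ n) (x : ℕ → A) :
    tailSum eta gamma theta a r s0 m n x
      = Si (boundaryTerm eta gamma theta a r s0 m n x - noiseSum eta gamma theta a r S s0 m n x)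
        - eta • boundaryTerm eta gamma theta a r s0 m n x := by
  have h1 : Si (boundaryTerm eta gamma theta a r s0 m n x
        - noiseSum eta gamma theta a r S s0 m n x)
      = ∑ t ∈ Finset.Ico m n, mid theta (lsIter eta gamma theta a r s0 x t) := by
    rw [← sum_lsGrad_eq hp s0 hmn, noiseSum, ← Finset.sum_sub_distrib, map_sum]
    refine Finset.sum_congr rfl fun t _ => ?_
    rw [sub_sub_cancel, hM.Si_S]
  rw [h1, ← sum_lsGrad_eq hp s0 hmn, Finset.smul_sum, ← Finset.sum_sub_distrib, tailSum]
  rfl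

theorem quad_boundaryTerm_le (hM : CovModel D a S Si mu R kap)
    (hp : InnerParams mu R kap eta gamma theta) (s0 : E × E) (m n : ℕ) (x : ℕ → A) :
    quad Si (boundaryTerm eta gamma theta a r s0 m n x)
      ≤ 64 * (kap / eta) * (pot Si mu (lsIter eta gamma theta a r s0 x m)
        + pot Si mu (lsIter eta gamma theta a r s0 x n)) := by
  have hI := hM.symmPos_inv
  have hpot : ∀ s : E × E, mu * quad Si (s.1 + s.2) ≤ 2 * pot Si mu s := by
    intro s
    have h1 := mul_le_mul_of_nonneg_left (hI.quad_add_le s.1 s.2) hM.mu_pos.le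
    have h2 := hM.mu_mul_quad_inv_le s.1
    rw [pot]; linarith
  set p := lsIter eta gamma theta a r s0 x m
  set q := lsIter eta gamma theta a r s0 x n
  have h1 := mul_le_mul_of_nonneg_left (hI.quad_sub_le (p.1 + p.2) (q.1 + q.2)) hM.mu_pos.le
  have h2 : mu * quad Si ((p.1 + p.2) - (q.1 + q.2)) ≤ 4 * (pot Si mu p + pot Si mu q) := by
    linarith [hpot p, hpot q]
  have hγ := hp.gamma_pos
  have hη := hp.eta_pos
  have hμ := hM.mu_pos
  have hk : 0 < kap := one_pos.trans_le hM.one_le_kap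
  have hQ := hI.nonneg ((p.1 + p.2) - (q.1 + q.2))
  have h3 : quad Si (boundaryTerm eta gamma theta a r s0 m n x)
      ≤ (1 / gamma) ^ 2 * quad Si ((p.1 + p.2) - (q.1 + q.2)) := by
    rw [boundaryTerm, quad_smul]
    gcongr
    linarith
  have h4 : (1 / gamma) ^ 2 = 16 * (kap / eta) * mu := by
    have := hp.mu_mul_gamma_sq
    field_simp
    linarith
  rw [h4] at h3
  have h5 := mul_le_mul_of_nonneg_left h2 (by positivity : 0 ≤ 16 * (kap / eta))
  linarith

/-- Pathwise control of the tail sum by the potential at the two ends of the window and by the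
accumulated noise. -/
theorem quad_tailSum_le (hM : CovModel D a S Si mu R kap)
    (hp : InnerParams mu R kap eta gamma theta) (s0 : E × E) {m n : ℕ} (hmn : m ≤ n) (x : ℕ → A) :
    quad S (tailSum eta gamma theta a r s0 m n x)
      ≤ 320 * (kap / eta) * (pot Si mu (lsIter eta gamma theta a r s0 x m)
        + pot Si mu (lsIter eta gamma theta a r s0 x n))
        + 4 * quad Si (noiseSum eta gamma theta a r S s0 m n x) := by
  rw [tailSum_eq hM hp s0 hmn]
  set b := boundaryTerm eta gamma theta a r s0 m n x with hb
  set ξ := noiseSum eta gamma theta a r S s0 m n x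
  have h1 := hM.symmPos.quad_sub_le (Si (b - ξ)) (eta • b)
  rw [hM.quad_S_Si, quad_smul] at h1
  have h2 := hM.symmPos_inv.quad_sub_le b ξ
  have h3 := hM.quad_le_quad_inv b
  have hb0 := hM.symmPos_inv.nonneg b
  have h4 : eta ^ 2 * quad S b ≤ (1 / 16) ^ 2 * quad Si b := by
    calc eta ^ 2 * quad S b ≤ eta ^ 2 * (R ^ 4 * quad Si b) := by gcongr
      _ = (eta * R ^ 2) ^ 2 * quad Si b := by ring
      _ ≤ (1 / 16) ^ 2 * quad Si b := by
        have := mul_nonneg hp.eta_pos.le (sq_nonneg R)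
        have := hp.eta_mul_sq_le
        gcongr
  have h5 := quad_boundaryTerm_le (r := r) hM hp s0 m n x
  rw [← hb] at h5
  linarith

variable {Ω : Type*} [MeasurableSpace Ω] {P : Measure Ω} [IsProbabilityMeasure P] {X : ℕ → Ω → A}

theorem measurable_tailSum (hM : CovModel D a S Si mu R kap) (hr : Residual D a r) (s0 : E × E)
    (m n : ℕ) : Measurable (tailSum eta gamma theta a r s0 m n) :=
  Finset.measurable_sum _ fun t _ => measurable_fst.comp (measurable_lsIter hM hr s0 (t + 1))

/-- The effective noise `κ̃ η tr Q + tr (Σ⁻¹ Q)` of the residual with second moment `Q`. -/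
noncomputable def effNoise (D : Measure A) (a : A → E) (r : A → ℝ) (Si : E →L[ℝ] E)
    (kap eta : ℝ) : ℝ :=
  kap * eta * ∫ p, r p ^ 2 * ‖a p‖ ^ 2 ∂D + ∫ p, r p ^ 2 * quad Si (a p) ∂D

theorem noiseLevel_le (hM : CovModel D a S Si mu R kap)
    (hp : InnerParams mu R kap eta gamma theta) :
    kap / eta * noiseLevel D a r Si mu eta gamma ≤ 2 * effNoise D a r Si kap eta := by
  have h2 : 0 ≤ ∫ p, r p ^ 2 * quad Si (a p) ∂D :=
    integral_nonneg fun p => mul_nonneg (sq_nonneg _) (hM.symmPos_inv.nonneg _)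
  have hη := hp.eta_pos
  have h3 : kap / eta * (2 * (mu * gamma ^ 2)) = 1 / 8 := by
    have := hp.mu_mul_gamma_sq
    field_simp
    linarith
  rw [noiseLevel, effNoise, mul_add, ← mul_assoc (kap / eta) (2 * (mu * gamma ^ 2)), h3]
  have h4 : kap / eta * (2 * eta ^ 2 * ∫ p, r p ^ 2 * ‖a p‖ ^ 2 ∂D)
      = 2 * (kap * eta * ∫ p, r p ^ 2 * ‖a p‖ ^ 2 ∂D) := by field_simp
  rw [h4]
  linarith

/-- Second moment of the tail average started from a pair `(w₀, w₀)`: a forgotten initial error,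
and a statistical error of order one over the length of the window. -/
theorem tailSum_bound (hM : CovModel D a S Si mu R kap)
    (hp : InnerParams mu R kap eta gamma theta) (hr : Residual D a r) (hX : IIDSample X D P)
    (w₀ : E) {m : ℕ} (hm : 1 ≤ theta * m) :
    Integrable (fun ω => quad S (tailSum eta gamma theta a r (w₀, w₀) m (2 * m) fun i => X i ω)) P ∧
    ∫ ω, quad S (tailSum eta gamma theta a r (w₀, w₀) m (2 * m) fun i => X i ω) ∂P
      ≤ m ^ 2 * (81 * (1 - theta) ^ m * quad S w₀) + 1320 * m * effNoise D a r Si kap eta := by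
  set s0 : E × E := (w₀, w₀) with hs0
  have hΦm := integrable_pot_lsIter s0 hM hp hr hX m
  have hΦn := integrable_pot_lsIter s0 hM hp hr hX (2 * m)
  have hΞ := noiseSum_bound s0 hM hp hr hX m m
  rw [← two_mul] at hΞ
  have hbd1 : Integrable (fun ω => 320 * (kap / eta)
      * (pot Si mu (lsIter eta gamma theta a r s0 (fun i => X i ω) m)
        + pot Si mu (lsIter eta gamma theta a r s0 (fun i => X i ω) (2 * m)))) P :=
    (hΦm.add hΦn).const_mul _
  have hbd2 := hΞ.1.const_mul 4
  have hint : Integrable (fun ω =>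
      quad S (tailSum eta gamma theta a r s0 m (2 * m) fun i => X i ω)) P := by
    refine (hbd1.add hbd2).mono' ((continuous_quad S).measurable.comp
      ((measurable_tailSum hM hr s0 _ _).comp
        (measurable_pi_lambda _ hX.measurable))).aestronglyMeasurable
      (Filter.Eventually.of_forall fun ω => ?_)
    rw [Real.norm_of_nonneg (hM.symmPos.nonneg _)]
    exact quad_tailSum_le hM hp s0 (by omega) _
  refine ⟨hint, ?_⟩
  have h1 := integral_mono hint (hbd1.add hbd2)
    (fun ω => quad_tailSum_le hM hp s0 (by omega) _)
  simp only [Pi.add_apply] at h1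
  rw [integral_add hbd1 hbd2, integral_const_mul, integral_const_mul, integral_add hΦm hΦn] at h1
  have hη := hp.eta_pos
  have hμ := hM.mu_pos
  have hθ := hp.theta_pos
  have hk : 0 < kap := one_pos.trans_le hM.one_le_kap
  set c := noiseLevel D a r Si mu eta gamma with hc
  have hc0 : 0 ≤ c := noiseLevel_nonneg hM
  set ρ := (1 - theta) ^ m with hρ
  have hq0 : 0 ≤ 1 - theta := sub_nonneg.2 hp.theta_le_one
  have hρ0 : 0 ≤ ρ := pow_nonneg hq0 _
  have hpot0 : pot Si mu s0 ≤ 2 / mu * quad S w₀ := by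
    have e1 := hM.mu_mul_quad_inv_le w₀
    have e2 := hM.mu_le w₀
    have e3 : 2 / mu * quad S w₀ = 2 * (quad S w₀ / mu) := by ring
    have e4 : ‖w₀‖ ^ 2 ≤ quad S w₀ / mu := by rw [le_div_iff₀ hμ]; linarith
    rw [e3, pot, hs0]
    simp only
    linarith
  have hpp := pot_nonneg hM s0
  have hcθ : c / theta ≤ m * c := by
    rw [div_le_iff₀ hθ]
    nlinarith
  have hm1 : meanPot P X Si mu eta gamma theta a r s0 m ≤ ρ * pot Si mu s0 + m * c :=
    (meanPot_le s0 hM hp hr hX m).trans (by linarith)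
  have hm2 : meanPot P X Si mu eta gamma theta a r s0 (2 * m) ≤ ρ * pot Si mu s0 + m * c := by
    refine (meanPot_le s0 hM hp hr hX (2 * m)).trans ?_
    have : (1 - theta) ^ (2 * m) ≤ ρ :=
      pow_le_pow_of_le_one hq0 (by linarith) (by omega)
    have := mul_le_mul_of_nonneg_right this hpp
    linarith
  have hsum := sum_midErr_le s0 hM hp hr hX m m
  rw [← two_mul] at hsum
  set Nsum := ∑ t ∈ Finset.Ico m (2 * m), midErr P X S eta gamma theta a r s0 t
  set ψ := ∫ p, r p ^ 2 * quad Si (a p) ∂D with hψ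
  set Ψ := effNoise D a r Si kap eta with hΨ
  have hψΨ : ψ ≤ Ψ := by
    have : 0 ≤ ∫ p, r p ^ 2 * ‖a p‖ ^ 2 ∂D := integral_nonneg fun p => by positivity
    rw [hΨ, effNoise]
    have := mul_nonneg (mul_nonneg hk.le hη.le) this
    linarith
  have hcΨ : kap / eta * c ≤ 2 * Ψ := noiseLevel_le hM hp
  have hmc : kap / eta * (m * c) ≤ 2 * (m * Ψ) := by
    have := mul_le_mul_of_nonneg_left hcΨ (Nat.cast_nonneg (α := ℝ) m)
    linarith
  have hsum' : kap * Nsum ≤ kap / eta * (ρ * pot Si mu s0) + 4 * (m * Ψ) := by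
    have e1 : kap * Nsum = kap / eta * (eta * Nsum) := by field_simp
    have e2 := mul_le_mul_of_nonneg_left (hsum.trans (by linarith :
      _ ≤ (ρ * pot Si mu s0 + m * c) + m * c)) (by positivity : 0 ≤ kap / eta)
    rw [e1]; linarith
  have hmean1 := mul_le_mul_of_nonneg_left (add_le_add hm1 hm2)
    (by positivity : 0 ≤ 320 * (kap / eta))
  have hfin : 648 * (kap / eta * (ρ * pot Si mu s0)) ≤ m ^ 2 * (81 * ρ * quad S w₀) := by
    have hkey : theta ^ 2 * kap = eta * mu / 16 := by
      have e := hp.mu_mul_gamma_sq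
      rw [← hp.gamma_mul_mu]
      linear_combination mu * e
    have hkm : kap / eta * (2 / mu) ≤ m ^ 2 / 8 := by
      rw [div_mul_div_comm, div_le_div_iff₀ (by positivity) (by norm_num)]
      have e1 : 1 ≤ (theta * m) ^ 2 := one_le_pow₀ hm
      have e2 : kap ≤ kap * (theta * m) ^ 2 := le_mul_of_one_le_right hk.le e1
      have e3 : kap * (theta * m) ^ 2 = eta * mu / 16 * m ^ 2 := by rw [← hkey]; ring
      linarith
    have hN := hM.symmPos.nonneg w₀
    calc 648 * (kap / eta * (ρ * pot Si mu s0))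
        ≤ 648 * (kap / eta * (ρ * (2 / mu * quad S w₀))) := by gcongr
      _ = 648 * (kap / eta * (2 / mu)) * (ρ * quad S w₀) := by ring
      _ ≤ 648 * (m ^ 2 / 8) * (ρ * quad S w₀) := by gcongr
      _ = _ := by ring
  have hΞ2 := hΞ.2
  have hmψ := mul_le_mul_of_nonneg_left hψΨ (Nat.cast_nonneg (α := ℝ) m)
  have hh : ∫ ω, quad S (tailSum eta gamma theta a r s0 m (2 * m) fun i => X i ω) ∂P
      ≤ 320 * (kap / eta) * (meanPot P X Si mu eta gamma theta a r s0 m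
        + meanPot P X Si mu eta gamma theta a r s0 (2 * m))
        + 4 * (2 * kap * Nsum + 2 * m * ψ) := h1.trans (by
          simp only [meanPot]; linarith)
  linarith

/-! ### The mean trajectory -/

/-- The inner loop driven by the exact gradient: the mean of the stochastic trajectory. -/
noncomputable def meanIter (eta gamma theta : ℝ) (S : E →L[ℝ] E) (s0 : E × E) : ℕ → E × E
  | 0 => s0
  | t + 1 => gradStep eta gamma theta (meanIter eta gamma theta S s0 t)
      (S (mid theta (meanIter eta gamma theta S s0 t)))

theorem pot_meanIter_le (hM : CovModel D a S Si mu R kap)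
    (hp : InnerParams mu R kap eta gamma theta) (s0 : E × E) (t : ℕ) :
    pot Si mu (meanIter eta gamma theta S s0 t) ≤ (1 - theta) ^ t * pot Si mu s0 := by
  induction t with
  | zero => simp [meanIter]
  | succ t ih =>
    refine (pot_gradStep_mean_le hM hp _).trans ?_
    rw [pow_succ']
    have := mul_le_mul_of_nonneg_left ih (sub_nonneg.2 hp.theta_le_one)
    linarith

theorem integrable_inner_of_sq {f : Ω → E} (hf : Measurable f)
    (h : Integrable (fun ω => ‖f ω‖ ^ 2) P) (x : E) : Integrable (fun ω => inner ℝ (f ω) x) P := by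
  refine ((h.add (integrable_const (1 : ℝ))).mul_const ‖x‖).mono'
    hf.inner_const.aestronglyMeasurable (Filter.Eventually.of_forall fun ω => ?_)
  refine (norm_inner_le_norm _ _).trans (mul_le_mul_of_nonneg_right ?_ (norm_nonneg _))
  simp only [Pi.add_apply]
  nlinarith [sq_nonneg (‖f ω‖ - 1), sq_nonneg ‖f ω‖]

theorem integrable_inner_lsIter (hM : CovModel D a S Si mu R kap)
    (hp : InnerParams mu R kap eta gamma theta) (hr : Residual D a r) (hX : IIDSample X D P)
    (s0 : E × E) (t : ℕ) (x : E) :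
    Integrable (fun ω => inner ℝ (lsIter eta gamma theta a r s0 (fun i => X i ω) t).1 x) P ∧
    Integrable (fun ω => inner ℝ (lsIter eta gamma theta a r s0 (fun i => X i ω) t).2 x) P := by
  have hpot := integrable_pot_lsIter s0 hM hp hr hX t
  have hm := measurable_lsIter_sample (eta := eta) (gamma := gamma) (theta := theta)
    s0 hM hr hX t
  constructor
  · refine integrable_inner_of_sq (measurable_fst.comp hm) (hpot.mono'
      ((measurable_fst.comp hm).norm.pow_const 2).aestronglyMeasurable
      (Filter.Eventually.of_forall fun ω => ?_)) x
    rw [Real.norm_of_nonneg (sq_nonneg _), pot]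
    have := mul_nonneg hM.mu_pos.le
      (hM.symmPos_inv.nonneg (lsIter eta gamma theta a r s0 (fun i => X i ω) t).2)
    simp only [Function.comp]
    linarith
  · refine integrable_inner_of_sq (measurable_snd.comp hm) ((hpot.const_mul (R ^ 2 / mu)).mono'
      ((measurable_snd.comp hm).norm.pow_const 2).aestronglyMeasurable
      (Filter.Eventually.of_forall fun ω => ?_)) x
    rw [Real.norm_of_nonneg (sq_nonneg _), pot]
    have h1 := hM.norm_sq_le_quad_inv (lsIter eta gamma theta a r s0 (fun i => X i ω) t).2
    have h2 : 0 ≤ R ^ 2 / mu * ‖(lsIter eta gamma theta a r s0 (fun i => X i ω) t).1‖ ^ 2 :=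
      mul_nonneg (div_nonneg (sq_nonneg _) hM.mu_pos.le) (sq_nonneg _)
    have h3 : R ^ 2 / mu * (mu * quad Si (lsIter eta gamma theta a r s0 (fun i => X i ω) t).2)
        = R ^ 2 * quad Si (lsIter eta gamma theta a r s0 (fun i => X i ω) t).2 := by
      have := hM.mu_pos
      field_simp
    simp only [Function.comp]
    rw [mul_add, h3]
    linarith

theorem integral_inner_lsIter (hM : CovModel D a S Si mu R kap)
    (hp : InnerParams mu R kap eta gamma theta) (hr : Residual D a r) (hX : IIDSample X D P)
    (s0 : E × E) (t : ℕ) (x : E) :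
    ∫ ω, inner ℝ (lsIter eta gamma theta a r s0 (fun i => X i ω) t).1 x ∂P
      = inner ℝ (meanIter eta gamma theta S s0 t).1 x ∧
    ∫ ω, inner ℝ (lsIter eta gamma theta a r s0 (fun i => X i ω) t).2 x ∂P
      = inner ℝ (meanIter eta gamma theta S s0 t).2 x := by
  induction t generalizing x with
  | zero => simp [lsIter, meanIter]
  | succ t ih =>
    have hi := integrable_inner_lsIter hM hp hr hX s0
    have hmidi : ∀ x, Integrable (fun ω => inner ℝ
        (mid theta (lsIter eta gamma theta a r s0 (fun i => X i ω) t)) x) P := by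
      intro x
      simp only [mid, inner_add_left, inner_smul_left, conj_trivial]
      exact ((hi t x).1.const_mul _).add ((hi t x).2.const_mul _)
    have hmid : ∀ x, ∫ ω, inner ℝ
        (mid theta (lsIter eta gamma theta a r s0 (fun i => X i ω) t)) x ∂P
        = inner ℝ (mid theta (meanIter eta gamma theta S s0 t)) x := by
      intro x
      simp only [mid, inner_add_left, inner_smul_left, conj_trivial]
      rw [integral_add ((hi t x).1.const_mul _) ((hi t x).2.const_mul _), integral_const_mul,
        integral_const_mul, (ih x).1, (ih x).2]
    -- the gradient is integrable because it is a combination of two consecutive iterates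
    have hgi : Integrable (fun ω => inner ℝ (lsGrad a r
        (mid theta (lsIter eta gamma theta a r s0 (fun i => X i ω) t)) (X t ω)) x) P := by
      refine (((hmidi x).sub (hi (t + 1) x).1).const_mul (1 / eta)).congr
        (Filter.Eventually.of_forall fun ω => ?_)
      have := hp.eta_pos.ne'
      simp only [Pi.sub_apply, lsIter, lsStep, gradStep, inner_sub_left, inner_smul_left,
        conj_trivial]
      field_simp
      ring
    have hg : ∫ ω, inner ℝ (lsGrad a r
        (mid theta (lsIter eta gamma theta a r s0 (fun i => X i ω) t)) (X t ω)) x ∂P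
        = inner ℝ (S (mid theta (meanIter eta gamma theta S s0 t))) x := by
      rw [hX.integral_eq (t := t) (G := fun x => lsIter eta gamma theta a r s0 x t)
        (measurable_lsIter hM hr s0 t) (dependsOn_lsIter s0 t)
        (f := fun q => inner ℝ (lsGrad a r (mid theta q.1) q.2) x)
        (((measurable_lsGrad hM hr).comp (((continuous_mid theta).measurable.comp
          measurable_fst).prodMk measurable_snd)).inner_const) hgi]
      simp_rw [integral_inner_lsGrad hM hr]
      have hsymm : ∀ w : E, inner ℝ (S w) x = inner ℝ w (S x) := fun w => by
        rw [real_inner_comm, hM.symmPos.symm]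
      simp_rw [hsymm]
      exact hmid (S x)
    constructor
    · simp only [lsIter, lsStep, gradStep, meanIter, inner_sub_left, inner_smul_left, conj_trivial]
      rw [integral_sub (hmidi x) (hgi.const_mul _), integral_const_mul, hmid, hg]
    · simp only [lsIter, lsStep, gradStep, meanIter, inner_sub_left, inner_add_left,
        inner_smul_left, conj_trivial]
      have h1 : Integrable (fun ω => theta * inner ℝ
          (mid theta (lsIter eta gamma theta a r s0 (fun i => X i ω) t)) x
          + (1 - theta) * inner ℝ (lsIter eta gamma theta a r s0 (fun i => X i ω) t).2 x) P :=
        ((hmidi x).const_mul _).add ((hi t x).2.const_mul _)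
      rw [integral_sub h1 (hgi.const_mul _), integral_add ((hmidi x).const_mul _)
        ((hi t x).2.const_mul _), integral_const_mul, integral_const_mul, integral_const_mul,
        hmid, hg, (ih x).2]

/-- The mean of the tail sum, tested against vectors, is a vector `b` that has forgotten the
initial error up to the factor `(1 - θ)^m` and the condition number. -/
theorem exists_mean_tailSum (hM : CovModel D a S Si mu R kap)
    (hp : InnerParams mu R kap eta gamma theta) (hr : Residual D a r) (hX : IIDSample X D P)
    (w₀ : E) (m : ℕ) :
    ∃ b : E, quad S b ≤ m ^ 2 * (2 * (R ^ 2 / mu) * (1 - theta) ^ m * quad S w₀) ∧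
      ∀ x, Integrable (fun ω => inner ℝ
          (tailSum eta gamma theta a r (w₀, w₀) m (2 * m) fun i => X i ω) x) P ∧
        ∫ ω, inner ℝ (tailSum eta gamma theta a r (w₀, w₀) m (2 * m) fun i => X i ω) x ∂P
          = inner ℝ b x := by
  refine ⟨∑ t ∈ Finset.Ico m (2 * m), (meanIter eta gamma theta S (w₀, w₀) (t + 1)).1, ?_, ?_⟩
  · have hμ := hM.mu_pos
    have hq0 : 0 ≤ 1 - theta := sub_nonneg.2 hp.theta_le_one
    have hterm : ∀ t ∈ Finset.Ico m (2 * m),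
        quad S (meanIter eta gamma theta S (w₀, w₀) (t + 1)).1
          ≤ 2 * (R ^ 2 / mu) * (1 - theta) ^ m * quad S w₀ := by
      intro t ht
      have h1 := pot_meanIter_le hM hp (w₀, w₀) (t + 1)
      have h2 : (1 - theta) ^ (t + 1) ≤ (1 - theta) ^ m :=
        pow_le_pow_of_le_one hq0 (by linarith [hp.theta_pos])
          (by have := (Finset.mem_Ico.1 ht).1; omega)
      have h3 : pot Si mu (w₀, w₀) ≤ 2 / mu * quad S w₀ := by
        have e1 := hM.mu_mul_quad_inv_le w₀
        have e4 : ‖w₀‖ ^ 2 ≤ quad S w₀ / mu := by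
          rw [le_div_iff₀ hμ]; linarith [hM.mu_le w₀]
        have e3 : 2 / mu * quad S w₀ = 2 * (quad S w₀ / mu) := by ring
        rw [e3, pot]
        simp only
        linarith
      have h4 : ‖(meanIter eta gamma theta S (w₀, w₀) (t + 1)).1‖ ^ 2
          ≤ pot Si mu (meanIter eta gamma theta S (w₀, w₀) (t + 1)) := by
        rw [pot]
        linarith [mul_nonneg hμ.le
          (hM.symmPos_inv.nonneg (meanIter eta gamma theta S (w₀, w₀) (t + 1)).2)]
      have hpp := pot_nonneg hM (w₀, w₀)
      calc quad S (meanIter eta gamma theta S (w₀, w₀) (t + 1)).1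
          ≤ R ^ 2 * ‖(meanIter eta gamma theta S (w₀, w₀) (t + 1)).1‖ ^ 2 := hM.le_R _
        _ ≤ R ^ 2 * ((1 - theta) ^ (t + 1) * pot Si mu (w₀, w₀)) := by
          gcongr; exact h4.trans h1
        _ ≤ R ^ 2 * ((1 - theta) ^ m * (2 / mu * quad S w₀)) := by gcongr
        _ = _ := by ring
    refine (hM.symmPos.quad_sum_le _ _).trans ?_
    have hcard : (Finset.Ico m (2 * m)).card = m := by simp; omega
    have := Finset.sum_le_card_nsmul _ _ _ hterm
    rw [hcard, nsmul_eq_mul] at this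
    rw [hcard, pow_two, mul_assoc (m : ℝ)]
    exact mul_le_mul_of_nonneg_left this (Nat.cast_nonneg _)
  · intro x
    simp only [tailSum, sum_inner]
    have hi : ∀ t ∈ Finset.Ico m (2 * m), Integrable (fun ω => inner ℝ
        (lsIter eta gamma theta a r (w₀, w₀) (fun i => X i ω) (t + 1)).1 x) P :=
      fun t _ => (integrable_inner_lsIter hM hp hr hX _ _ x).1
    refine ⟨integrable_finsetSum _ hi, ?_⟩
    rw [integral_finsetSum _ hi]
    exact Finset.sum_congr rfl fun t _ => (integral_inner_lsIter hM hp hr hX _ _ x).1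

end Average

/-! ### One step of the outer loop -/

section Outer

variable {E : Type*} [NormedAddCommGroup E] [InnerProductSpace ℝ E]

/-- `F` is `mL`-strongly convex and `L`-smooth in the norm of `S`, with gradient `G`, and has the
stationary point `xs`. -/
structure RelSmooth (S : E →L[ℝ] E) (F : E → ℝ) (G : E → E) (mL L : ℝ) (xs : E) : Prop where
  mL_pos : 0 < mL
  L_pos : 0 < L
  lower : ∀ x y, F x + inner ℝ (G x) (y - x) + mL / 2 * quad S (y - x) ≤ F y
  upper : ∀ x y, F y ≤ F x + inner ℝ (G x) (y - x) + L / 2 * quad S (y - x)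
  grad_eq_zero : G xs = 0

theorem RelSmooth.growth {S : E →L[ℝ] E} {F : E → ℝ} {G : E → E} {mL L : ℝ} {xs : E}
    (hF : RelSmooth S F G mL L xs) (x : E) : mL / 2 * quad S (x - xs) ≤ F x - F xs := by
  have := hF.lower xs x
  rw [hF.grad_eq_zero, inner_zero_left] at this
  linarith

/-- The momentum point `x⁻ + (x - x⁻)/θ` minus the minimizer, for the pair `(x, x⁻)`. -/
noncomputable def momErr (xs : E) (θ : ℝ) (s : E × E) : E := s.2 + (1 / θ) • (s.1 - s.2) - xs

/-- The Lyapunov function of the outer loop. -/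
noncomputable def lyap (S : E →L[ℝ] E) (F : E → ℝ) (mL : ℝ) (xs : E) (θ : ℝ) (s : E × E) : ℝ :=
  F s.1 - F xs + mL / 4 * quad S (momErr xs θ s)

/-- The extrapolated point of the outer loop. -/
noncomputable def extrap (θ : ℝ) (s : E × E) : E := s.1 + ((1 - θ) / (1 + θ)) • (s.1 - s.2)

variable {S Si : E →L[ℝ] E} {F : E → ℝ} {G : E → E} {mL L : ℝ} {xs : E}

theorem lyap_nonneg (hS : IsSymmPos S) (hF : RelSmooth S F G mL L xs) (θ : ℝ) (s : E × E) :
    0 ≤ lyap S F mL xs θ s := by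
  have h1 := hF.growth s.1
  have h2 := mul_nonneg (by linarith [hF.mL_pos] : 0 ≤ mL / 2) (hS.nonneg (s.1 - xs))
  have h3 := mul_nonneg (by linarith [hF.mL_pos] : 0 ≤ mL / 4) (hS.nonneg (momErr xs θ s))
  rw [lyap]; linarith

/-- Lyapunov decrease of one outer step with the inexact update `x⁺ = y - h Σ⁻¹∇F(y) + e`, where
`h = 2θ²/mL`. The error enters through a linear term, which only sees its mean, and through a
quadratic one. The old momentum point is `x + (1/θ - 1)(x - x⁻)`, formed with the new `θ`. -/
theorem lyap_step_le (hS : IsSymmPos S) (hSi : ∀ x, S (Si x) = x)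
    (hF : RelSmooth S F G mL L xs) {θ h : ℝ} (hθ : 0 < θ) (hθ1 : θ ≤ 1)
    (hh : h = 2 * θ ^ 2 / mL) (hL : 4 * L * h ≤ 1) (s : E × E) (e : E) :
    lyap S F mL xs θ (extrap θ s - h • Si (G (extrap θ s)) + e, s.1)
      ≤ (1 - θ) * (F s.1 - F xs + mL / 4 * quad S (s.1 + (1 / θ - 1) • (s.1 - s.2) - xs))
        - θ * (mL / 4) * quad S (extrap θ s - xs)
        - (1 - θ) * (mL / 2) * quad S (extrap θ s - s.1)
        + 1 / h * inner ℝ e (S ((1 - θ) • (extrap θ s - s.1) + θ • (extrap θ s - xs)))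
        + 1 / h * quad S e := by
  obtain ⟨x, xp⟩ := s
  set y := extrap θ (x, xp) with hy
  set p := Si (G y) with hp
  have hm := hF.mL_pos
  have hLp := hF.L_pos
  have hh0 : 0 < h := by rw [hh]; positivity
  have hGp : ∀ v, inner ℝ (G y) v = inner ℝ p (S v) := by
    intro v
    rw [hS.symm, ← hSi (G y), real_inner_comm]
  obtain ⟨X, hX⟩ : ∃ X, X = y - x := ⟨_, rfl⟩
  obtain ⟨Y, hY⟩ : ∃ Y, Y = y - xs := ⟨_, rfl⟩
  have hZ : x + (1 / θ - 1) • (x - xp) - xs = Y + (1 / θ) • X := by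
    have h1 : X = ((1 - θ) / (1 + θ)) • (x - xp) := by rw [hX, hy, extrap]; simp
    have h2 : (1 / θ - 1) • (x - xp) = (1 + 1 / θ) • X := by
      rw [h1, smul_smul]; congr 1; field_simp; ring
    have h3 : Y = x + X - xs := by rw [hX, hY]; abel
    rw [h2, h3]; module
  obtain ⟨W, hW⟩ : ∃ W, W = (1 - θ) • X + θ • Y := ⟨_, rfl⟩
  have hmom : momErr xs θ (y - h • p + e, x) = (1 / θ) • (W + (e - h • p)) := by
    have h3 : x = y - X := by rw [hX]; abel
    have h4 : xs = y - Y := by rw [hY]; abel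
    have h5 : Y = (1 / θ) • (θ • Y) := by rw [smul_smul, one_div_mul_cancel hθ.ne', one_smul]
    have h6 : X = (1 / θ) • (θ • X) := by rw [smul_smul, one_div_mul_cancel hθ.ne', one_smul]
    simp only [momErr]
    rw [hW, h4, h3]
    calc y - X + (1 / θ) • (y - h • p + e - (y - X)) - (y - Y)
        = Y - X + (1 / θ) • (e - h • p + X) := by module
      _ = (1 / θ) • (θ • Y) - (1 / θ) • (θ • X) + (1 / θ) • (e - h • p + X) := by
        rw [← h5, ← h6]
      _ = _ := by module
  -- the convex combination behind the contraction of the momentum term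
  have hconv : quad S W ≤ θ ^ 2 * (θ * quad S Y + (1 - θ) * quad S (Y + (1 / θ) • X)) := by
    have h1 := hS.quad_convex hθ.le hθ1 Y (Y + (1 / θ) • X)
    have h2 : W = θ • (θ • Y + (1 - θ) • (Y + (1 / θ) • X)) := by
      have h6 : X = (1 / θ) • (θ • X) := by rw [smul_smul, one_div_mul_cancel hθ.ne', one_smul]
      have h7 : (θ * (1 / θ)) • X = X := by rw [mul_one_div_cancel hθ.ne', one_smul]
      rw [hW]
      calc (1 - θ) • X + θ • Y = (1 - θ) • ((θ * (1 / θ)) • X) + θ • Y := by rw [h7]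
        _ = _ := by module
    rw [h2, quad_smul]
    exact mul_le_mul_of_nonneg_left h1 (sq_nonneg _)
  have hup := hF.upper y (y - h • p + e)
  rw [show y - h • p + e - y = e - h • p by abel, hGp] at hup
  have hlx := hF.lower y x
  rw [hGp, show x - y = -X by rw [hX]; abel, quad_neg, map_neg, inner_neg_right] at hlx
  have hls := hF.lower y xs
  rw [hGp, show xs - y = -Y by rw [hY]; abel, quad_neg, map_neg, inner_neg_right] at hls
  have hep : quad S (e - h • p) = quad S e - 2 * h * inner ℝ p (S e) + h ^ 2 * quad S p := by
    rw [hS.quad_sub, quad_smul, map_smul, inner_smul_right, hS.symm e p]; ring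
  have hpe : inner ℝ p (S (e - h • p)) = inner ℝ p (S e) - h * quad S p := by
    rw [map_sub, map_smul, inner_sub_right, inner_smul_right]; rfl
  have hWe : inner ℝ W (S (e - h • p)) = inner ℝ e (S W) - h * inner ℝ p (S W) := by
    rw [map_sub, map_smul, inner_sub_right, inner_smul_right, hS.symm W e, hS.symm W p]
  have hpW : inner ℝ p (S W) = (1 - θ) * inner ℝ p (S X) + θ * inner ℝ p (S Y) := by
    rw [hW, map_add, map_smul, map_smul, inner_add_right, inner_smul_right, inner_smul_right]
  have hcoef : mL / 4 * (1 / θ) ^ 2 = 1 / (2 * h) := by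
    rw [hh]; field_simp; ring
  have hyoung : -(L * h * inner ℝ p (S e)) ≤ L / 2 * (h ^ 2 * quad S p + quad S e) := by
    have := hS.nonneg (e + h • p)
    rw [hS.quad_add, quad_smul, map_smul, inner_smul_right, hS.symm e p] at this
    nlinarith
  have hNp := hS.nonneg p
  have hNe := hS.nonneg e
  rw [hpe, hep] at hup
  rw [lyap, hmom, quad_smul, ← mul_assoc, hcoef, hS.quad_add, hWe, hep]
  rw [hZ, ← hX, ← hY, ← hW]
  have e1 : 1 / (2 * h) * (quad S W + 2 * (inner ℝ e (S W) - h * inner ℝ p (S W))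
      + (quad S e - 2 * h * inner ℝ p (S e) + h ^ 2 * quad S p))
      = 1 / (2 * h) * quad S W + 1 / h * inner ℝ e (S W) - inner ℝ p (S W)
        + 1 / (2 * h) * quad S e - inner ℝ p (S e) + h / 2 * quad S p := by
    field_simp; ring
  have e2 : 1 / (2 * h) * quad S W
      ≤ mL / 4 * (θ * quad S Y + (1 - θ) * quad S (Y + (1 / θ) • X)) := by
    rw [← hcoef]
    have := mul_le_mul_of_nonneg_left hconv (by positivity : 0 ≤ mL / 4 * (1 / θ) ^ 2)
    refine this.trans (le_of_eq ?_)
    field_simp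
  have e3 : (1 - θ) * F y - (1 - θ) * inner ℝ p (S X) + (1 - θ) * (mL / 2 * quad S X)
      ≤ (1 - θ) * F x := by
    have := mul_le_mul_of_nonneg_left hlx (sub_nonneg.2 hθ1)
    linarith
  have e4 : θ * F y - θ * inner ℝ p (S Y) + θ * (mL / 2 * quad S Y) ≤ θ * F xs := by
    have := mul_le_mul_of_nonneg_left hls hθ.le
    linarith
  have e5 : L * quad S e ≤ 1 / (4 * h) * quad S e := by
    refine mul_le_mul_of_nonneg_right ?_ hNe
    rw [le_div_iff₀ (by positivity)]; linarith
  have e6 : L * h ^ 2 * quad S p ≤ h / 4 * quad S p := by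
    refine mul_le_mul_of_nonneg_right ?_ hNp
    nlinarith
  have e7 : 1 / h * quad S e = 1 / (2 * h) * quad S e + 1 / (4 * h) * quad S e
      + 1 / (4 * h) * quad S e := by field_simp; ring
  have e8 : 0 ≤ 1 / (4 * h) * quad S e := by positivity
  have e9 : 0 ≤ h / 4 * quad S p := by positivity
  simp only
  rw [e1, e7]
  rw [hpW]
  linarith

/-- Replacing the old momentum parameter `θ` by the next one `θ'`, with `1/θ' ≤ 1/θ + 1/4`, costs
a factor that the contraction `1 - θ'` still beats. -/
theorem lyap_reparam_le (hS : IsSymmPos S) (hF : RelSmooth S F G mL L xs) {θ θ' : ℝ}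
    (hθ : 0 < θ) (hθ' : 0 < θ') (hle : θ' ≤ θ) (hsmall : θ ≤ 1 / 100)
    (hinv : 1 / θ' ≤ 1 / θ + 1 / 4) (s : E × E) :
    (1 - θ') * (F s.1 - F xs + mL / 4 * quad S (s.1 + (1 / θ' - 1) • (s.1 - s.2) - xs))
      ≤ (1 - 2 / 5 * θ') * lyap S F mL xs θ s := by
  obtain ⟨x, xp⟩ := s
  have hm := hF.mL_pos
  simp only [lyap]
  obtain ⟨Z, hZ⟩ : ∃ Z, Z = momErr xs θ (x, xp) := ⟨_, rfl⟩
  obtain ⟨Y, hY⟩ : ∃ Y, Y = x - xs := ⟨_, rfl⟩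
  have h1θ : 0 < 1 - θ := by linarith
  obtain ⟨c, hc⟩ : ∃ c, c = (1 / θ' - 1 / θ) * (θ / (1 - θ)) := ⟨_, rfl⟩
  have hd0 : 0 ≤ 1 / θ' - 1 / θ := sub_nonneg.2 (one_div_le_one_div_of_le hθ' hle)
  have hc0 : 0 ≤ c := by rw [hc]; positivity
  have hcle : c ≤ 13 / 50 * θ' := by
    have h1 : c ≤ 1 / 4 * (θ / (1 - θ)) := by
      rw [hc]; exact mul_le_mul_of_nonneg_right (by linarith) (by positivity)
    have h2 : θ ≤ θ' * (401 / 400) := by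
      have : θ ≤ θ' + θ * θ' / 4 := by
        have := mul_le_mul_of_nonneg_left hinv (by positivity : 0 ≤ θ * θ')
        field_simp at this
        nlinarith
      nlinarith
    have h3 : θ / (1 - θ) ≤ 26 / 25 * θ' := by
      rw [div_le_iff₀ h1θ]; nlinarith
    linarith
  have hZY : Z - Y = (1 / θ - 1) • (x - xp) := by
    rw [hZ, hY, momErr]; module
  have hvec : x + (1 / θ' - 1) • (x - xp) - xs = Z + c • (Z - Y) := by
    have h1 : c * (1 / θ - 1) = 1 / θ' - 1 / θ := by rw [hc]; field_simp
    have h2 : Z = Y + (1 / θ - 1) • (x - xp) := by rw [← hZY]; abel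
    rw [hZY, smul_smul, h1, h2, hY]; module
  rw [hvec, ← hZ]
  have hgr := hF.growth x
  rw [← hY] at hgr
  have hNZ := hS.nonneg Z
  have hNY := hS.nonneg Y
  have hq : quad S (Z + c • (Z - Y)) ≤ ((1 + c) ^ 2 + c * (1 + c) / 4) * quad S Z
      + (4 * c * (1 + c) + c ^ 2) * quad S Y := by
    have h1 : Z + c • (Z - Y) = (1 + c) • Z - c • Y := by module
    have h2 := hS.two_mul_inner_le (c := 1 / 4) (by norm_num) Z (-Y)
    rw [quad_neg, map_neg, inner_neg_right] at h2
    rw [h1, hS.quad_sub, quad_smul, quad_smul, map_smul, inner_smul_left, inner_smul_right,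
      conj_trivial]
    have h3 := mul_le_mul_of_nonneg_left h2 (by positivity : 0 ≤ c * (1 + c))
    nlinarith
  have hc1 : c ≤ 1 / 100 := by linarith
  have hcc : c ^ 2 ≤ c / 100 := by nlinarith
  -- both coefficients are below `1 + 3θ'/5`
  have hA : (1 + c) ^ 2 + c * (1 + c) / 4 ≤ 1 + 3 / 5 * θ' := by nlinarith
  have hB : (4 * c * (1 + c) + c ^ 2) / 2 ≤ 3 / 5 * θ' := by nlinarith
  have h5 : mL / 4 * quad S (Z + c • (Z - Y))
      ≤ (1 + 3 / 5 * θ') * (mL / 4 * quad S Z) + 3 / 5 * θ' * (F x - F xs) := by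
    have e1 := mul_le_mul_of_nonneg_left hq (by positivity : 0 ≤ mL / 4)
    have e2 := mul_le_mul_of_nonneg_right hA (by positivity : 0 ≤ mL / 4 * quad S Z)
    have e3 := mul_le_mul_of_nonneg_right hB (by positivity : 0 ≤ mL / 2 * quad S Y)
    have e4 := mul_le_mul_of_nonneg_left hgr (by positivity : 0 ≤ 3 / 5 * θ')
    linarith
  have hV : 0 ≤ F x - F xs + mL / 4 * quad S Z := by
    have : 0 ≤ mL / 2 * quad S Y := by positivity
    have : 0 ≤ mL / 4 * quad S Z := by positivity
    linarith
  have h6 : (1 - θ') * (1 + 3 / 5 * θ') ≤ 1 - 2 / 5 * θ' := by nlinarith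
  calc (1 - θ') * (F x - F xs + mL / 4 * quad S (Z + c • (Z - Y)))
      ≤ (1 - θ') * ((1 + 3 / 5 * θ') * (F x - F xs + mL / 4 * quad S Z)) := by
        refine mul_le_mul_of_nonneg_left ?_ (by linarith)
        linarith
    _ = ((1 - θ') * (1 + 3 / 5 * θ')) * (F x - F xs + mL / 4 * quad S Z) := by ring
    _ ≤ _ := mul_le_mul_of_nonneg_right h6 hV

variable [MeasurableSpace E] [BorelSpace E] [SecondCountableTopology E]
  {Ω : Type*} [MeasurableSpace Ω] {P : Measure Ω} [IsProbabilityMeasure P]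

/-- Expected Lyapunov decrease for a random update error `e` with mean `b`. -/
theorem integral_lyap_step_le (hS : IsSymmPos S) (hSi : ∀ x, S (Si x) = x)
    (hF : RelSmooth S F G mL L xs) (hFm : Measurable F) {θ θ' h σ : ℝ}
    (hθ : 0 < θ) (hθ' : 0 < θ') (hle : θ' ≤ θ) (hsmall : θ ≤ 1 / 100)
    (hinv : 1 / θ' ≤ 1 / θ + 1 / 4) (hh : h = 2 * θ' ^ 2 / mL) (hL : 4 * L * h ≤ 1) (s : E × E)
    {e : Ω → E} (hem : Measurable e) (heN : Integrable (fun ω => quad S (e ω)) P) {b : E}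
    (hei : ∀ x, Integrable (fun ω => inner ℝ (e ω) x) P)
    (heb : ∀ x, ∫ ω, inner ℝ (e ω) x ∂P = inner ℝ b x)
    (heσ : ∫ ω, quad S (e ω) ∂P
      ≤ h * (σ + θ' * (mL / 16) * quad S (extrap θ' s - xs)))
    (hbb : 2 * quad S b ≤ h ^ 2 * (θ' * (mL ^ 2 / 16) * quad S (extrap θ' s - xs))) :
    Integrable (fun ω =>
      lyap S F mL xs θ' (extrap θ' s - h • Si (G (extrap θ' s)) + e ω, s.1)) P ∧
    ∫ ω, lyap S F mL xs θ' (extrap θ' s - h • Si (G (extrap θ' s)) + e ω, s.1) ∂P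
      ≤ (1 - 2 / 5 * θ') * lyap S F mL xs θ s + σ := by
  set y := extrap θ' s with hy
  have hm := hF.mL_pos
  have hh0 : 0 < h := by rw [hh]; positivity
  have hθ1 : θ' ≤ 1 := by linarith
  set k := (1 - θ') * (F s.1 - F xs + mL / 4 * quad S (s.1 + (1 / θ' - 1) • (s.1 - s.2) - xs))
        - θ' * (mL / 4) * quad S (y - xs) - (1 - θ') * (mL / 2) * quad S (y - s.1) with hk
  set W := (1 - θ') • (y - s.1) + θ' • (y - xs) with hW
  have hbound : ∀ ω, lyap S F mL xs θ' (y - h • Si (G y) + e ω, s.1)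
      ≤ k + 1 / h * inner ℝ (e ω) (S W) + 1 / h * quad S (e ω) :=
    fun ω => lyap_step_le hS hSi hF hθ' hθ1 hh hL s (e ω)
  have hi1 := (hei (S W)).const_mul (1 / h)
  have hi2 := heN.const_mul (1 / h)
  have hi3 : Integrable (fun ω => k + 1 / h * inner ℝ (e ω) (S W)) P :=
    (integrable_const k).add hi1
  have hmeas : Measurable fun ω => lyap S F mL xs θ' (y - h • Si (G y) + e ω, s.1) := by
    have h1 : Measurable fun ω => y - h • Si (G y) + e ω := measurable_const.add hem
    refine ((hFm.comp h1).sub_const _).add (((continuous_quad S).measurable.comp ?_).const_mul _)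
    exact (measurable_const.add ((h1.sub_const _).const_smul (1 / θ'))).sub_const xs
  have hint : Integrable (fun ω => lyap S F mL xs θ' (y - h • Si (G y) + e ω, s.1)) P := by
    refine (hi3.add hi2).mono' hmeas.aestronglyMeasurable (Filter.Eventually.of_forall fun ω => ?_)
    rw [Real.norm_of_nonneg (lyap_nonneg hS hF _ _)]
    exact hbound ω
  refine ⟨hint, ?_⟩
  have h1 := integral_mono hint (hi3.add hi2) hbound
  simp only [Pi.add_apply] at h1
  rw [integral_add hi3 hi2, integral_add (integrable_const k) hi1, integral_const_mul,
    integral_const_mul, heb, integral_const, probReal_univ, one_smul] at h1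
  have h2 : 1 / h * ∫ ω, quad S (e ω) ∂P ≤ σ + θ' * (mL / 16) * quad S (y - xs) := by
    have := mul_le_mul_of_nonneg_left heσ (by positivity : 0 ≤ 1 / h)
    rwa [← mul_assoc, one_div_mul_cancel hh0.ne', one_mul] at this
  have hNY := hS.nonneg (y - xs)
  have hNX := hS.nonneg (y - s.1)
  have hNb := hS.nonneg b
  -- the mean error is tested against `W` by Young's inequality on each of its two parts
  have h3 : 1 / h * inner ℝ b (S W) ≤ (1 - θ') * (mL / 4) * quad S (y - s.1)
      + θ' * (mL / 8) * quad S (y - xs) := by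
    have e1 := hS.two_mul_inner_le (c := 2 / (mL * h)) (by positivity) b (y - s.1)
    have e2 := hS.two_mul_inner_le (c := 8 / (mL * h)) (by positivity) b (y - xs)
    have e3 : inner ℝ b (S W) = (1 - θ') * inner ℝ b (S (y - s.1))
        + θ' * inner ℝ b (S (y - xs)) := by
      rw [hW, map_add, map_smul, map_smul, inner_add_right, inner_smul_right, inner_smul_right]
    have e4 : 1 / h * (2 * inner ℝ b (S (y - s.1)))
        ≤ 2 / (mL * h ^ 2) * quad S b + mL / 2 * quad S (y - s.1) := by
      refine (mul_le_mul_of_nonneg_left e1 (by positivity : 0 ≤ 1 / h)).trans (le_of_eq ?_)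
      field_simp
    have e5 : 1 / h * (2 * inner ℝ b (S (y - xs)))
        ≤ 8 / (mL * h ^ 2) * quad S b + mL / 8 * quad S (y - xs) := by
      refine (mul_le_mul_of_nonneg_left e2 (by positivity : 0 ≤ 1 / h)).trans (le_of_eq ?_)
      field_simp
    have e6 := mul_le_mul_of_nonneg_left e4 (by linarith : 0 ≤ 1 - θ')
    have e7 := mul_le_mul_of_nonneg_left e5 hθ'.le
    have e8 : 1 / (mL * h ^ 2) * (2 * quad S b) ≤ θ' * (mL / 16) * quad S (y - xs) := by
      refine (mul_le_mul_of_nonneg_left hbb (by positivity : 0 ≤ 1 / (mL * h ^ 2))).trans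
        (le_of_eq ?_)
      field_simp
    have e9 : 0 ≤ 1 / (mL * h ^ 2) * quad S b := by positivity
    have e10 : θ' * (1 / (mL * h ^ 2) * quad S b) ≤ 1 / 100 * (1 / (mL * h ^ 2) * quad S b) :=
      mul_le_mul_of_nonneg_right (by linarith) e9
    have f1 : 2 / (mL * h ^ 2) * quad S b = 2 * (1 / (mL * h ^ 2) * quad S b) := by ring
    have f2 : 8 / (mL * h ^ 2) * quad S b = 8 * (1 / (mL * h ^ 2) * quad S b) := by ring
    rw [f1] at e6
    rw [f2] at e7
    have f3 : 1 / (mL * h ^ 2) * (2 * quad S b) = 2 * (1 / (mL * h ^ 2) * quad S b) := by ring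
    rw [f3] at e8
    rw [e3]
    generalize 1 / (mL * h ^ 2) * quad S b = B at *
    linarith
  have h4 := lyap_reparam_le hS hF hθ hθ' hle hsmall hinv s
  have h5 : 0 ≤ (1 - θ') * (mL / 4) * quad S (y - s.1) :=
    mul_nonneg (mul_nonneg (by linarith) (by linarith)) hNX
  have h6 : 0 ≤ θ' * mL * quad S (y - xs) := by positivity
  linarith

end Outer

/-! ### From the inner loop to the outer loop -/

section Wire

variable {d : ℕ} {B : Type*} [MeasurableSpace B]

/-- The part of the assumptions on the loss and the data that the analysis of the algorithm uses,
with the covariance matrix and the gradient of the risk replaced by operators. -/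
structure LossModel (D : Measure (Vec d × B)) (loss : ℝ → B → ℝ) (S Si : Vec d →L[ℝ] Vec d)
    (mu R kap : ℝ) (G : Vec d → Vec d) (mL L : ℝ) (xs : Vec d) : Prop where
  cov : CovModel D Prod.fst S Si mu R kap
  smooth : RelSmooth S (risk D loss) G mL L xs
  measurable_risk : Measurable (risk D loss)
  measurable_dloss : Measurable fun q : ℝ × B => dloss loss q.1 q.2
  lipschitz : ∀ᵐ p ∂D, ∀ y : Vec d,
    |dloss loss (inner ℝ p.1 y) p.2 - dloss loss (inner ℝ p.1 xs) p.2|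
      ≤ L * |(inner ℝ p.1 (y - xs) : ℝ)|
  integrable_noise :
    Integrable (fun p : Vec d × B => (dloss loss (inner ℝ p.1 xs) p.2) ^ 2 * ‖p.1‖ ^ 2) D
  integrable_grad : ∀ y x,
    Integrable (fun p : Vec d × B => dloss loss (inner ℝ p.1 y) p.2 * inner ℝ p.1 x) D
  integral_grad : ∀ y x,
    ∫ p, dloss loss (inner ℝ p.1 y) p.2 * inner ℝ p.1 x ∂D = inner ℝ (G y) x

/-- The least-squares residual seen by an inner loop anchored at `y` with solution `y - w₀`. -/
noncomputable def anchorResidual (loss : ℝ → B → ℝ) (h : ℝ) (y w₀ : Vec d) (p : Vec d × B) : ℝ :=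
  h * dloss loss (inner ℝ p.1 y) p.2 - inner ℝ p.1 w₀

theorem mid_add_const {θ : ℝ} (hθ : 0 < θ) (s : Vec d × Vec d) (c : Vec d) :
    mid θ (s + (c, c)) = mid θ s + c := by
  have h : (1 / (1 + θ)) • c + (θ / (1 + θ)) • c = c := by
    rw [← add_smul, ← add_div, div_self (by positivity), one_smul]
  calc mid θ (s + (c, c)) = mid θ s + ((1 / (1 + θ)) • c + (θ / (1 + θ)) • c) := by
        simp only [mid, Prod.fst_add, Prod.snd_add]; module
    _ = _ := by rw [h]

/-- Centred at its solution, the inner loop is stochastic least squares. -/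
theorem innerIter_eq (loss : ℝ → B → ℝ) {eta gamma theta h : ℝ} (hθ : 0 < theta) (y w₀ : Vec d)
    (data : ℕ → Vec d × B) (t : ℕ) :
    innerIter loss eta gamma theta h y data t
      = lsIter eta gamma theta Prod.fst (anchorResidual loss h y w₀) (w₀, w₀) data t
        + (y - w₀, y - w₀) := by
  induction t with
  | zero => simp [innerIter, lsIter]
  | succ t ih =>
    simp only [innerIter, lsIter]
    rw [ih]
    set s := lsIter eta gamma theta Prod.fst (anchorResidual loss h y w₀) (w₀, w₀) data t
    set p := data t
    have hy : (1 / (1 + theta)) • (s + (y - w₀, y - w₀)).1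
        + (theta / (1 + theta)) • (s + (y - w₀, y - w₀)).2 = mid theta s + (y - w₀) :=
      mid_add_const hθ s (y - w₀)
    have hg : (h * dloss loss (inner ℝ p.1 y) p.2) • p.1
        + (inner ℝ p.1 (mid theta s + (y - w₀) - y) : ℝ) • p.1
        = lsGrad Prod.fst (anchorResidual loss h y w₀) (mid theta s) p := by
      rw [lsGrad, ← add_smul]
      congr 1
      rw [anchorResidual, show mid theta s + (y - w₀) - y = mid theta s - w₀ by abel,
        inner_sub_right]
      ring
    rw [innerStep]
    simp only [hy, hg]
    rw [lsStep, gradStep]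
    refine Prod.ext ?_ ?_
    · simp only [Prod.fst_add]; abel
    · simp only [Prod.snd_add]; module

theorem innerLoop_eq (loss : ℝ → B → ℝ) {eta gamma theta h : ℝ} (hθ : 0 < theta) (y w₀ : Vec d)
    (data : ℕ → Vec d × B) {m : ℕ} (hm : 0 < m) :
    innerLoop loss eta gamma theta h (2 * m) y data = y - w₀
      + (1 / (m : ℝ)) • tailSum eta gamma theta Prod.fst (anchorResidual loss h y w₀) (w₀, w₀) m
        (2 * m) data := by
  have hm' : (m : ℝ) ≠ 0 := by positivity
  have h1 : (2 : ℝ) / ((2 * m : ℕ) : ℝ) = 1 / m := by push_cast; field_simp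
  have h2 : 2 * m / 2 = m := by omega
  have h3 : ∑ t ∈ Finset.Icc (m + 1) (2 * m), (innerIter loss eta gamma theta h y data t).1
      = ∑ t ∈ Finset.Ico m (2 * m), (innerIter loss eta gamma theta h y data (t + 1)).1 := by
    rw [Finset.sum_Ico_add' (fun t => (innerIter loss eta gamma theta h y data t).1) m (2 * m) 1]
    refine Finset.sum_congr (Finset.ext fun t => ?_) fun _ _ => rfl
    simp only [Finset.mem_Icc, Finset.mem_Ico]
    omega
  have hcard : (Finset.Ico m (2 * m)).card = m := by simp; omega
  rw [innerLoop, h1, h2, h3]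
  simp_rw [innerIter_eq loss hθ y w₀ data, Prod.fst_add]
  rw [Finset.sum_add_distrib, Finset.sum_const, hcard, smul_add, ← Nat.cast_smul_eq_nsmul ℝ,
    smul_smul, one_div_mul_cancel hm', one_smul, add_comm, tailSum]

variable {D : Measure (Vec d × B)} [IsProbabilityMeasure D] {loss : ℝ → B → ℝ}
  {S Si : Vec d →L[ℝ] Vec d} {mu R kap : ℝ} {G : Vec d → Vec d} {mL L : ℝ} {xs : Vec d}

theorem LossModel.measurable_dloss_inner (hm : LossModel D loss S Si mu R kap G mL L xs)
    (y : Vec d) : Measurable fun p : Vec d × B => dloss loss (inner ℝ p.1 y) p.2 :=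
  hm.measurable_dloss.comp ((measurable_fst.inner_const).prodMk measurable_snd)

/-- The gradient is `L`-Lipschitz at the minimizer, from the `Σ`-norm to its dual. -/
theorem LossModel.quad_grad_le (hm : LossModel D loss S Si mu R kap G mL L xs) (y : Vec d) :
    quad Si (G y) ≤ L ^ 2 * quad S (y - xs) := by
  have hc := hm.cov
  have hi : ∀ v, Integrable (fun p : Vec d × B => (inner ℝ p.1 v : ℝ) ^ 2) D := fun v =>
    (hc.integrable_inner_mul_inner v v).congr (Filter.Eventually.of_forall fun p => (pow_two _).symm)
  have hq : ∀ v, ∫ p, (inner ℝ p.1 v : ℝ) ^ 2 ∂D = quad S v := fun v => by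
    simp_rw [pow_two]; exact hc.integral_inner_mul_inner v v
  set x := Si (G y) with hx
  have h1 : quad Si (G y) = ∫ p, (dloss loss (inner ℝ p.1 y) p.2 * inner ℝ p.1 x
      - dloss loss (inner ℝ p.1 xs) p.2 * inner ℝ p.1 x) ∂D := by
    rw [integral_sub (hm.integrable_grad y x) (hm.integrable_grad xs x), hm.integral_grad,
      hm.integral_grad, hm.smooth.grad_eq_zero, inner_zero_left, sub_zero, quad]
  have h2 : ∫ p, (dloss loss (inner ℝ p.1 y) p.2 * inner ℝ p.1 x
      - dloss loss (inner ℝ p.1 xs) p.2 * inner ℝ p.1 x) ∂D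
      ≤ ∫ p, (L ^ 2 / 2 * (inner ℝ p.1 (y - xs) : ℝ) ^ 2 + 1 / 2 * (inner ℝ p.1 x : ℝ) ^ 2) ∂D := by
    refine integral_mono_ae ((hm.integrable_grad y x).sub (hm.integrable_grad xs x))
      (((hi _).const_mul _).add ((hi _).const_mul _)) ?_
    filter_upwards [hm.lipschitz] with p hp
    have hp := hp y
    rw [← sub_mul]
    set u := dloss loss (inner ℝ p.1 y) p.2 - dloss loss (inner ℝ p.1 xs) p.2
    have h3 : u ^ 2 ≤ (L * |(inner ℝ p.1 (y - xs) : ℝ)|) ^ 2 := by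
      rw [← sq_abs u]
      exact pow_le_pow_left₀ (abs_nonneg _) hp 2
    rw [mul_pow, sq_abs] at h3
    nlinarith [sq_nonneg (u - inner ℝ p.1 x)]
  rw [integral_add ((hi _).const_mul _) ((hi _).const_mul _), integral_const_mul,
    integral_const_mul, hq, hq, hx, hc.quad_S_Si, ← hx, ← h1] at h2
  linarith

/-- Weighted second moments of the residual, in terms of those at the minimizer. -/
theorem LossModel.residual_moment_le (hm : LossModel D loss S Si mu R kap G mL L xs) (h : ℝ)
    (y w₀ : Vec d) {W : Vec d → ℝ} (hW : Measurable W) (hW0 : ∀ v, 0 ≤ W v) {c : ℝ}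
    (hWi : Integrable
      (fun p : Vec d × B => (dloss loss (inner ℝ p.1 xs) p.2) ^ 2 * W p.1) D)
    (hW4 : ∀ v, Integrable (fun p : Vec d × B => W p.1 * (inner ℝ p.1 v : ℝ) ^ 2) D)
    (hWc : ∀ v, ∫ p, W p.1 * (inner ℝ p.1 v : ℝ) ^ 2 ∂D ≤ c * quad S v) :
    Integrable (fun p => anchorResidual loss h y w₀ p ^ 2 * W p.1) D ∧
    ∫ p, anchorResidual loss h y w₀ p ^ 2 * W p.1 ∂D
      ≤ 3 * h ^ 2 * ∫ p, (dloss loss (inner ℝ p.1 xs) p.2) ^ 2 * W p.1 ∂D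
        + 3 * h ^ 2 * L ^ 2 * (c * quad S (y - xs)) + 3 * (c * quad S w₀) := by
  have hi1 := hWi.const_mul (3 * h ^ 2)
  have hi2 := (hW4 (y - xs)).const_mul (3 * h ^ 2 * L ^ 2)
  have hi3 := (hW4 w₀).const_mul 3
  have hi12 : Integrable (fun p : Vec d × B =>
      3 * h ^ 2 * ((dloss loss (inner ℝ p.1 xs) p.2) ^ 2 * W p.1)
      + 3 * h ^ 2 * L ^ 2 * (W p.1 * (inner ℝ p.1 (y - xs) : ℝ) ^ 2)) D := hi1.add hi2
  have hmeas : Measurable fun p : Vec d × B => anchorResidual loss h y w₀ p ^ 2 * W p.1 :=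
    ((((hm.measurable_dloss_inner y).const_mul h).sub
      measurable_fst.inner_const).pow_const 2).mul (hW.comp measurable_fst)
  have hb : ∀ᵐ p ∂D, anchorResidual loss h y w₀ p ^ 2 * W p.1
      ≤ 3 * h ^ 2 * ((dloss loss (inner ℝ p.1 xs) p.2) ^ 2 * W p.1)
      + 3 * h ^ 2 * L ^ 2 * (W p.1 * (inner ℝ p.1 (y - xs) : ℝ) ^ 2)
      + 3 * (W p.1 * (inner ℝ p.1 w₀ : ℝ) ^ 2) := by
    filter_upwards [hm.lipschitz] with p hp
    have hp := hp y
    set u := dloss loss (inner ℝ p.1 y) p.2 with hu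
    set v := dloss loss (inner ℝ p.1 xs) p.2
    have h3 : (u - v) ^ 2 ≤ (L * |(inner ℝ p.1 (y - xs) : ℝ)|) ^ 2 := by
      rw [← sq_abs (u - v)]
      exact pow_le_pow_left₀ (abs_nonneg _) hp 2
    rw [mul_pow, sq_abs] at h3
    have h4 : anchorResidual loss h y w₀ p ^ 2
        ≤ 3 * h ^ 2 * v ^ 2 + 3 * h ^ 2 * (u - v) ^ 2 + 3 * (inner ℝ p.1 w₀ : ℝ) ^ 2 := by
      rw [anchorResidual, ← hu]
      nlinarith [sq_nonneg (h * v - h * (u - v)), sq_nonneg (h * v + inner ℝ p.1 w₀),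
        sq_nonneg (h * (u - v) + inner ℝ p.1 w₀)]
    have h5 := mul_le_mul_of_nonneg_left h3 (by positivity : 0 ≤ 3 * h ^ 2)
    have h6 := mul_le_mul_of_nonneg_right (h4.trans (add_le_add_left (add_le_add_right h5 _) _))
      (hW0 p.1)
    linarith
  have hint : Integrable (fun p => anchorResidual loss h y w₀ p ^ 2 * W p.1) D := by
    refine (hi12.add hi3).mono' hmeas.aestronglyMeasurable ?_
    filter_upwards [hb] with p hp
    rw [Real.norm_of_nonneg (mul_nonneg (sq_nonneg _) (hW0 _))]
    exact hp
  refine ⟨hint, ?_⟩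
  have h1 := integral_mono_ae hint (hi12.add hi3) hb
  simp only [Pi.add_apply] at h1
  rw [integral_add hi12 hi3, integral_add hi1 hi2, integral_const_mul, integral_const_mul,
    integral_const_mul] at h1
  have h2 := mul_le_mul_of_nonneg_left (hWc (y - xs)) (by positivity : 0 ≤ 3 * h ^ 2 * L ^ 2)
  linarith [hWc w₀]

theorem LossModel.residual (hm : LossModel D loss S Si mu R kap G mL L xs) (h : ℝ) (y : Vec d) :
    Residual D Prod.fst (anchorResidual loss h y (h • Si (G y))) where
  measurable := ((hm.measurable_dloss_inner y).const_mul h).sub measurable_fst.inner_const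
  integrable_sq := (hm.residual_moment_le h y (h • Si (G y)) (W := fun v => ‖v‖ ^ 2)
    (measurable_norm.pow_const 2) (fun v => sq_nonneg _) hm.integrable_noise
    hm.cov.integrable_fourth hm.cov.fourth).1
  integral_mul_inner x := by
    have hc := hm.cov
    have hi1 := (hm.integrable_grad y x).const_mul h
    have hi2 := hc.integrable_inner_mul_inner (h • Si (G y)) x
    have : ∀ p : Vec d × B, anchorResidual loss h y (h • Si (G y)) p * inner ℝ p.1 x
        = h * (dloss loss (inner ℝ p.1 y) p.2 * inner ℝ p.1 x)
          - inner ℝ p.1 (h • Si (G y)) * inner ℝ p.1 x := fun p => by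
      rw [anchorResidual]; ring
    simp_rw [this]
    rw [integral_sub hi1 hi2, integral_const_mul, hm.integral_grad, hc.integral_inner_mul_inner,
      hc.symmPos.symm, map_smul, hc.S_Si, inner_smul_right, real_inner_comm x, sub_self]

variable {Ω : Type*} [MeasurableSpace Ω] {P : Measure Ω} [IsProbabilityMeasure P]
  {X : ℕ → Ω → Vec d × B}

/-- The effective gradient noise `κ̃ η tr Q + tr (Σ⁻¹ Q)` at the minimizer. -/
noncomputable def lossNoise (D : Measure (Vec d × B)) (loss : ℝ → B → ℝ)
    (Si : Vec d →L[ℝ] Vec d) (kap eta : ℝ) (xs : Vec d) : ℝ :=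
  effNoise D Prod.fst (fun p : Vec d × B => dloss loss (inner ℝ p.1 xs) p.2) Si kap eta

/-- The noise of an inner loop is that at the minimizer, plus a multiplicative part that vanishes
with the distance of the anchor to the minimizer. -/
theorem LossModel.effNoise_le (hm : LossModel D loss S Si mu R kap G mL L xs)
    {eta gamma theta : ℝ} (hp : InnerParams mu R kap eta gamma theta) (h : ℝ) (y : Vec d) :
    effNoise D Prod.fst (anchorResidual loss h y (h • Si (G y))) Si kap eta
      ≤ 3 * h ^ 2 * lossNoise D loss Si kap eta xs
        + 7 * h ^ 2 * L ^ 2 * kap * quad S (y - xs) := by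
  have hc := hm.cov
  have hI := hc.symmPos_inv
  have h1 := (hm.residual_moment_le h y (h • Si (G y)) (W := fun v => ‖v‖ ^ 2)
    (measurable_norm.pow_const 2) (fun v => sq_nonneg _) hm.integrable_noise
    hc.integrable_fourth hc.fourth).2
  have hi : Integrable (fun p : Vec d × B =>
      (dloss loss (inner ℝ p.1 xs) p.2) ^ 2 * quad Si p.1) D := by
    refine (hm.integrable_noise.div_const mu).mono'
      (((hm.measurable_dloss_inner xs).pow_const 2).mul hc.measurable_quad).aestronglyMeasurable
      (Filter.Eventually.of_forall fun p => ?_)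
    rw [Real.norm_of_nonneg (mul_nonneg (sq_nonneg _) (hI.nonneg _)), le_div_iff₀ hc.mu_pos]
    have := mul_le_mul_of_nonneg_left (hc.mu_mul_quad_inv_le p.1)
      (sq_nonneg (dloss loss (inner ℝ p.1 xs) p.2))
    linarith
  have h2 := (hm.residual_moment_le h y (h • Si (G y)) (W := quad Si)
    (continuous_quad Si).measurable hI.nonneg hi hc.integrable_fourth_inv hc.fourth_inv).2
  have hk : 0 < kap := one_pos.trans_le hc.one_le_kap
  have hη := hp.eta_pos
  have hw : quad S (h • Si (G y)) ≤ h ^ 2 * (L ^ 2 * quad S (y - xs)) := by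
    rw [quad_smul, hc.quad_S_Si]
    exact mul_le_mul_of_nonneg_left (hm.quad_grad_le y) (sq_nonneg h)
  have h3 := mul_le_mul_of_nonneg_left h1 (by positivity : 0 ≤ kap * eta)
  rw [lossNoise, effNoise, effNoise]
  set N := quad S (y - xs)
  have hN : 0 ≤ N := hc.symmPos.nonneg _
  set K := h ^ 2 * L ^ 2 * N with hK
  have hK0 : 0 ≤ K := by positivity
  have h4 : kap * eta * (3 * h ^ 2 * L ^ 2 * (R ^ 2 * N) + 3 * (R ^ 2 * quad S (h • Si (G y))))
      ≤ 6 / 16 * kap * K := by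
    have e1 : R ^ 2 * quad S (h • Si (G y)) ≤ R ^ 2 * K :=
      mul_le_mul_of_nonneg_left (hw.trans (le_of_eq (by rw [hK]; ring))) (sq_nonneg R)
    have e2 : kap * K * (eta * R ^ 2) ≤ kap * K * (1 / 16) :=
      mul_le_mul_of_nonneg_left hp.eta_mul_sq_le (by positivity)
    have e3 := mul_le_mul_of_nonneg_left e1 (by positivity : 0 ≤ kap * eta)
    have e4 : 3 * h ^ 2 * L ^ 2 * (R ^ 2 * N) = 3 * (R ^ 2 * K) := by rw [hK]; ring
    rw [e4]
    linarith
  have h5 : 3 * h ^ 2 * L ^ 2 * (kap * N) + 3 * (kap * quad S (h • Si (G y))) ≤ 6 * kap * K := by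
    have e1 : kap * quad S (h • Si (G y)) ≤ kap * K :=
      mul_le_mul_of_nonneg_left (hw.trans (le_of_eq (by rw [hK]; ring))) hk.le
    have e2 : 3 * h ^ 2 * L ^ 2 * (kap * N) = 3 * (kap * K) := by rw [hK]; ring
    rw [e2]; linarith
  have h6 : 7 * h ^ 2 * L ^ 2 * kap * N = 7 * (kap * K) := by rw [hK]; ring
  have h7 : 0 ≤ kap * K := by positivity
  rw [h6]
  linarith

/-- One outer step on a frozen state, averaged over the samples of its inner loop. -/
theorem LossModel.integral_outer_step_le (hm : LossModel D loss S Si mu R kap G mL L xs)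
    {eta gamma theta : ℝ} (hp : InnerParams mu R kap eta gamma theta) (hX : IIDSample X D P)
    {m : ℕ} (hm1 : 1 ≤ theta * m) (hρ1 : m * (1 - theta) ^ m ≤ 1) {θ θ' h : ℝ}
    (hθ : 0 < θ) (hθ' : 0 < θ') (hle : θ' ≤ θ) (hsmall : θ ≤ 1 / 100)
    (hinv : 1 / θ' ≤ 1 / θ + 1 / 4) (hh : h = 2 * θ' ^ 2 / mL) (hL : 4 * L * h ≤ 1)
    (hρ2 : 64 * (R ^ 2 / mu) * (L / mL) ^ 2 * (1 - theta) ^ m ≤ θ')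
    (hθm : 300000 * (L / mL) ^ 2 * kap * θ' ≤ m) (s : Vec d × Vec d) :
    Integrable (fun ω => lyap S (risk D loss) mL xs θ'
      (innerLoop loss eta gamma theta h (2 * m) (extrap θ' s) (fun i => X i ω), s.1)) P ∧
    ∫ ω, lyap S (risk D loss) mL xs θ'
      (innerLoop loss eta gamma theta h (2 * m) (extrap θ' s) (fun i => X i ω), s.1) ∂P
      ≤ (1 - 2 / 5 * θ') * lyap S (risk D loss) mL xs θ s
        + 7920 * lossNoise D loss Si kap eta xs / (mL * m) * θ' ^ 2 := by
  have hc := hm.cov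
  set y := extrap θ' s with hy
  set w₀ := h • Si (G y) with hw₀
  set r := anchorResidual loss h y w₀ with hr
  have hres : Residual D Prod.fst r := hm.residual h y
  have hmL := hm.smooth.mL_pos
  have hLp := hm.smooth.L_pos
  have hh0 : 0 < h := by rw [hh]; positivity
  have hmpos : 0 < m := by
    rcases Nat.eq_zero_or_pos m with h0 | h0
    · rw [h0] at hm1; norm_num at hm1
    · exact h0
  have hmR : (0 : ℝ) < m := by exact_mod_cast hmpos
  have hk : 0 < kap := one_pos.trans_le hc.one_le_kap
  simp_rw [innerLoop_eq loss hp.theta_pos y w₀ _ hmpos]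
  set ρ := (1 - theta) ^ m with hρ
  have hρ0 : 0 ≤ ρ := pow_nonneg (sub_nonneg.2 hp.theta_le_one) _
  set N := quad S (y - xs) with hN
  have hN0 : 0 ≤ N := hc.symmPos.nonneg _
  have hw : quad S w₀ ≤ h ^ 2 * (L ^ 2 * N) := by
    rw [hw₀, quad_smul, hc.quad_S_Si]
    exact mul_le_mul_of_nonneg_left (hm.quad_grad_le y) (sq_nonneg h)
  obtain ⟨hTi, hTb⟩ := tailSum_bound hc hp hres hX w₀ hm1
  obtain ⟨b, hbq, hb⟩ := exists_mean_tailSum hc hp hres hX w₀ m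
  have hTm : Measurable fun ω =>
      tailSum eta gamma theta Prod.fst r (w₀, w₀) m (2 * m) fun i => X i ω :=
    (measurable_tailSum hc hres _ _ _).comp (measurable_pi_lambda _ hX.measurable)
  set Λ := lossNoise D loss Si kap eta xs with hΛ
  have hΨ : effNoise D Prod.fst r Si kap eta ≤ 3 * h ^ 2 * Λ + 7 * h ^ 2 * L ^ 2 * kap * N :=
    hm.effNoise_le hp h y
  refine integral_lyap_step_le hc.symmPos hc.S_Si hm.smooth hm.measurable_risk hθ hθ' hle hsmall
    hinv hh hL s (e := fun ω => (1 / (m : ℝ)) •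
      tailSum eta gamma theta Prod.fst r (w₀, w₀) m (2 * m) fun i => X i ω)
    (b := (1 / (m : ℝ)) • b) (hTm.const_smul (1 / (m : ℝ))) ?_ ?_ ?_ ?_ ?_
  · simp_rw [quad_smul]
    exact hTi.const_mul _
  · intro x
    simp_rw [inner_smul_left, conj_trivial]
    exact (hb x).1.const_mul _
  · intro x
    simp_rw [inner_smul_left, conj_trivial]
    rw [integral_const_mul, (hb x).2]
  · simp_rw [quad_smul]
    rw [integral_const_mul]
    have e1 : ∫ ω, quad S
        (tailSum eta gamma theta Prod.fst r (w₀, w₀) m (2 * m) fun i => X i ω) ∂P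
        ≤ m ^ 2 * (81 * ρ * (h ^ 2 * (L ^ 2 * N)))
          + 1320 * m * (3 * h ^ 2 * Λ + 7 * h ^ 2 * L ^ 2 * kap * N) := by
      refine hTb.trans (add_le_add ?_ ?_)
      · gcongr
      · gcongr
    have e2 := mul_le_mul_of_nonneg_left e1 (by positivity : 0 ≤ (1 / (m : ℝ)) ^ 2)
    refine e2.trans ?_
    have e3 : (1 / (m : ℝ)) ^ 2 * (m ^ 2 * (81 * ρ * (h ^ 2 * (L ^ 2 * N)))
          + 1320 * m * (3 * h ^ 2 * Λ + 7 * h ^ 2 * L ^ 2 * kap * N))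
        = h * (3960 * h * Λ / m + h * (L ^ 2 * N) / m * (81 * (m * ρ) + 9240 * kap)) := by
      field_simp; ring
    rw [e3]
    refine mul_le_mul_of_nonneg_left (add_le_add (le_of_eq ?_) ?_) hh0.le
    · rw [hh]; field_simp; ring
    · have e4 : 81 * (m * ρ) + 9240 * kap ≤ 9321 * kap := by
        linarith [hc.one_le_kap]
      have e5 : 2 * θ' ^ 2 / mL * (L ^ 2 * N) / m * (9321 * kap)
          = θ' / m * (18642 * (L / mL) ^ 2 * kap * θ') * (mL * N) := by
        field_simp; ring
      have e6 : 18642 * (L / mL) ^ 2 * kap * θ' ≤ m / 16 := by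
        have : 0 ≤ (L / mL) ^ 2 * kap * θ' := by positivity
        linarith
      calc h * (L ^ 2 * N) / m * (81 * (m * ρ) + 9240 * kap)
          ≤ h * (L ^ 2 * N) / m * (9321 * kap) := by gcongr
        _ = θ' / m * (18642 * (L / mL) ^ 2 * kap * θ') * (mL * N) := by rw [hh, e5]
        _ ≤ θ' / m * (m / 16) * (mL * N) := by gcongr
        _ = θ' * (mL / 16) * N := by field_simp
  · rw [quad_smul]
    have e1 : quad S b ≤ m ^ 2 * (2 * (R ^ 2 / mu) * ρ * (h ^ 2 * (L ^ 2 * N))) := by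
      have := hc.mu_pos
      refine hbq.trans ?_
      gcongr
    calc 2 * ((1 / (m : ℝ)) ^ 2 * quad S b)
        ≤ 2 * ((1 / (m : ℝ)) ^ 2 * (m ^ 2 * (2 * (R ^ 2 / mu) * ρ * (h ^ 2 * (L ^ 2 * N))))) := by
          gcongr
      _ = h ^ 2 * ((64 * (R ^ 2 / mu) * (L / mL) ^ 2 * ρ) * (mL ^ 2 / 16) * N) := by
          field_simp; ring
      _ ≤ _ := by gcongr

end Wire

/-! ### The outer loop -/

section OuterChain

variable {d : ℕ} {B : Type*} [MeasurableSpace B]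

theorem measurable_innerIter {loss : ℝ → B → ℝ}
    (hl : Measurable fun q : ℝ × B => dloss loss q.1 q.2) (eta gamma theta h : ℝ) (t : ℕ) :
    Measurable fun q : Vec d × (ℕ → Vec d × B) =>
      innerIter loss eta gamma theta h q.1 q.2 t := by
  induction t with
  | zero => exact measurable_fst.prodMk measurable_fst
  | succ t ih =>
    have hp : Measurable fun q : Vec d × (ℕ → Vec d × B) => q.2 t :=
      (measurable_pi_apply t).comp measurable_snd
    have ha := measurable_fst.comp hp
    have hy : Measurable fun q : Vec d × (ℕ → Vec d × B) =>
        (1 / (1 + theta)) • (innerIter loss eta gamma theta h q.1 q.2 t).1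
        + (theta / (1 + theta)) • (innerIter loss eta gamma theta h q.1 q.2 t).2 :=
      ((measurable_fst.comp ih).const_smul (1 / (1 + theta))).add
        ((measurable_snd.comp ih).const_smul (theta / (1 + theta)))
    have hg := ((((hl.comp ((ha.inner (𝕜 := ℝ) measurable_fst).prodMk
      (measurable_snd.comp hp))).const_mul h).smul ha)).add ((ha.inner (𝕜 := ℝ) (hy.sub measurable_fst)).smul ha)
    exact (hy.sub (hg.const_smul eta)).prodMk
      (((hy.const_smul theta).add ((measurable_snd.comp ih).const_smul (1 - theta))).sub
        (hg.const_smul gamma))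

theorem measurable_innerLoop {loss : ℝ → B → ℝ}
    (hl : Measurable fun q : ℝ × B => dloss loss q.1 q.2) (eta gamma theta h : ℝ) (T : ℕ) :
    Measurable fun q : Vec d × (ℕ → Vec d × B) =>
      innerLoop loss eta gamma theta h T q.1 q.2 := by
  have h1 : Measurable fun q : Vec d × (ℕ → Vec d × B) => ∑ t ∈ Finset.Icc (T / 2 + 1) T,
      (innerIter loss eta gamma theta h q.1 q.2 t).1 :=
    Finset.measurable_sum _ fun t _ =>
      measurable_fst.comp (measurable_innerIter hl eta gamma theta h t)
  exact h1.const_smul (2 / (T : ℝ))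

theorem innerIter_congr (loss : ℝ → B → ℝ) (eta gamma theta h : ℝ) (y : Vec d)
    {x x' : ℕ → Vec d × B} {t : ℕ} (hx : ∀ i < t, x i = x' i) :
    innerIter loss eta gamma theta h y x t = innerIter loss eta gamma theta h y x' t := by
  induction t with
  | zero => rfl
  | succ t ih =>
    simp only [innerIter]
    rw [ih fun i hi => hx i (by omega), hx t (by omega)]

theorem innerLoop_congr (loss : ℝ → B → ℝ) (eta gamma theta h : ℝ) (y : Vec d)
    {x x' : ℕ → Vec d × B} {T : ℕ} (hx : ∀ i < T, x i = x' i) :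
    innerLoop loss eta gamma theta h T y x = innerLoop loss eta gamma theta h T y x' := by
  rw [innerLoop, innerLoop]
  congr 1
  refine Finset.sum_congr rfl fun t ht => ?_
  rw [innerIter_congr loss eta gamma theta h y fun i hi =>
    hx i (by have := (Finset.mem_Icc.1 ht).2; omega)]

theorem measurable_outerIter {loss : ℝ → B → ℝ}
    (hl : Measurable fun q : ℝ × B => dloss loss q.1 q.2) (eta gamma theta : ℝ) (h beta : ℕ → ℝ)
    (T : ℕ) (x0 : Vec d) (k : ℕ) :
    Measurable fun x : ℕ → Vec d × B => outerIter loss eta gamma theta h beta T x0 x k := by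
  induction k with
  | zero => exact measurable_const
  | succ k ih =>
    have h1 := measurable_fst.comp ih
    have h2 := measurable_snd.comp ih
    have hy := h1.add ((h1.sub h2).const_smul (beta (k + 1)))
    have hx : Measurable fun (x : ℕ → Vec d × B) (t : ℕ) => x (k * T + t) :=
      measurable_pi_lambda _ fun t => measurable_pi_apply _
    exact ((measurable_innerLoop hl eta gamma theta (h (k + 1)) T).comp (hy.prodMk hx)).prodMk h1

theorem dependsOn_outerIter (loss : ℝ → B → ℝ) (eta gamma theta : ℝ) (h beta : ℕ → ℝ)
    (T : ℕ) (x0 : Vec d) (k : ℕ) :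
    DependsOn (fun x : ℕ → Vec d × B => outerIter loss eta gamma theta h beta T x0 x k)
      (Finset.range (k * T) : Set ℕ) := by
  induction k with
  | zero => intro x y _; rfl
  | succ k ih =>
    intro x y hxy
    have h1 : outerIter loss eta gamma theta h beta T x0 x k
        = outerIter loss eta gamma theta h beta T x0 y k :=
      ih fun _ hi => hxy _ (by simp at hi ⊢; rw [add_mul]; omega)
    simp only [outerIter]
    rw [h1, innerLoop_congr loss eta gamma theta (h (k + 1)) _ (x := fun t => x (k * T + t))
      (x' := fun t => y (k * T + t)) fun _ hi => hxy _ (by simp; rw [add_mul]; omega)]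

variable {Ω : Type*} [MeasurableSpace Ω] {P : Measure Ω} [IsProbabilityMeasure P]

theorem IIDSample.shift {A : Type*} [MeasurableSpace A] {X : ℕ → Ω → A} {D : Measure A}
    (hX : IIDSample X D P) (n : ℕ) : IIDSample (fun i => X (n + i)) D P where
  measurable _ := hX.measurable _
  indep := hX.indep.precomp (add_right_injective n)
  law _ := hX.law _

variable {X : ℕ → Ω → Vec d × B} {D : Measure (Vec d × B)} [IsProbabilityMeasure D]
  {loss : ℝ → B → ℝ} {S Si : Vec d →L[ℝ] Vec d} {mu R kap : ℝ} {G : Vec d → Vec d} {mL L : ℝ}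
  {xs : Vec d}

/-- The Lyapunov function along the outer loop: the initial gap contracts by `1 - 2θ_j/5` in each
step, and the noise stays at a level proportional to the current momentum parameter. -/
theorem LossModel.integral_lyap_le (hm : LossModel D loss S Si mu R kap G mL L xs)
    {eta gamma theta : ℝ} (hp : InnerParams mu R kap eta gamma theta) (hX : IIDSample X D P)
    {m : ℕ} (hm1 : 1 ≤ theta * m) (hρ1 : m * (1 - theta) ^ m ≤ 1) {θ : ℕ → ℝ} {K : ℕ}
    (hθ : ∀ k, 0 < θ k) (hanti : ∀ k, θ (k + 1) ≤ θ k) (hsmall : ∀ k, θ k ≤ 1 / 100)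
    (hinv : ∀ k, 1 / θ (k + 1) ≤ 1 / θ k + 1 / 4)
    {h beta : ℕ → ℝ} (hh : ∀ k, h k = 2 * θ k ^ 2 / mL) (hL : ∀ k, 4 * L * h k ≤ 1)
    (hbeta : ∀ k, beta k = (1 - θ k) / (1 + θ k))
    (hρ2 : ∀ k ≤ K, 64 * (R ^ 2 / mu) * (L / mL) ^ 2 * (1 - theta) ^ m ≤ θ k)
    (hθm : ∀ k, 300000 * (L / mL) ^ 2 * kap * θ k ≤ m) (x0 : Vec d) (k : ℕ) (hk : k ≤ K) :
    Integrable (fun ω => lyap S (risk D loss) mL xs (θ k)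
      (outerIter loss eta gamma theta h beta (2 * m) x0 (fun i => X i ω) k)) P ∧
    ∫ ω, lyap S (risk D loss) mL xs (θ k)
      (outerIter loss eta gamma theta h beta (2 * m) x0 (fun i => X i ω) k) ∂P
      ≤ (∏ j ∈ Finset.range k, (1 - 2 / 5 * θ (j + 1)))
          * lyap S (risk D loss) mL xs (θ 0) (x0, x0)
        + 10 * (7920 * lossNoise D loss Si kap eta xs / (mL * m)) * θ k := by
  have hc := hm.cov
  set M := 7920 * lossNoise D loss Si kap eta xs / (mL * m) with hM
  have hM0 : 0 ≤ M := by
    have h1 : 0 ≤ lossNoise D loss Si kap eta xs := by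
      have hk : 0 < kap := one_pos.trans_le hc.one_le_kap
      have := hp.eta_pos
      refine add_nonneg (mul_nonneg (by positivity) (integral_nonneg fun p => by positivity))
        (integral_nonneg fun p => mul_nonneg (sq_nonneg _) (hc.symmPos_inv.nonneg _))
    have := hm.smooth.mL_pos
    positivity
  have hmpos : 0 < m := by
    rcases Nat.eq_zero_or_pos m with h0 | h0
    · rw [h0] at hm1; norm_num at hm1
    · exact h0
  induction k with
  | zero =>
    refine ⟨integrable_const (lyap S (risk D loss) mL xs (θ 0) (x0, x0)), ?_⟩
    simp only [outerIter, integral_const, probReal_univ, one_smul, Finset.range_zero,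
      Finset.prod_empty, one_mul]
    have := mul_nonneg (by positivity : 0 ≤ 10 * M) (hθ 0).le
    linarith
  | succ k ih =>
    obtain ⟨ihi, ihb⟩ := ih (by omega)
    -- the block of fresh samples, extended periodically so that it looks at finitely many of them
    set blk : (ℕ → Vec d × B) → ℕ → Vec d × B := fun x i => x (k * (2 * m) + i % (2 * m))
      with hblk
    have hblkm : Measurable blk := measurable_pi_lambda _ fun i => measurable_pi_apply _
    have hblkd : DependsOn blk (Finset.Ico (k * (2 * m)) (k * (2 * m) + 2 * m) : Set ℕ) := by
      intro x y hxy
      funext i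
      refine hxy _ ?_
      have := Nat.mod_lt i (by omega : 0 < 2 * m)
      simp; omega
    have hstep : ∀ (s : Vec d × Vec d) (x : ℕ → Vec d × B),
        innerLoop loss eta gamma theta (h (k + 1)) (2 * m) (extrap (θ (k + 1)) s) (blk x)
        = innerLoop loss eta gamma theta (h (k + 1)) (2 * m) (extrap (θ (k + 1)) s)
          (fun i => x (k * (2 * m) + i)) := fun s x =>
      innerLoop_congr _ _ _ _ _ _ fun i hi => by simp [hblk, Nat.mod_eq_of_lt hi]
    have hind := indepFun_of_dependsOn hX.measurable hX.indep
      (measurable_outerIter hm.measurable_dloss eta gamma theta h beta (2 * m) x0 k) hblkm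
      (I := Finset.range (k * (2 * m))) (J := Finset.Ico (k * (2 * m)) (k * (2 * m) + 2 * m))
      (by
        rw [Finset.disjoint_left]
        intro i hi hj
        have := Finset.mem_range.1 hi
        have := (Finset.mem_Ico.1 hj).1
        omega)
      (dependsOn_outerIter loss eta gamma theta h beta (2 * m) x0 k)
      (by simpa using hblkd)
    have hXm : Measurable fun ω i => X i ω := measurable_pi_lambda _ hX.measurable
    have hone := hm.integral_outer_step_le hp (hX.shift (k * (2 * m))) hm1 hρ1 (hθ k)
      (hθ (k + 1)) (hanti k) (hsmall k) (hinv k) (hh (k + 1)) (hL (k + 1)) (hρ2 (k + 1) hk)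
      (hθm (k + 1))
    have hVm : Measurable fun q : (Vec d × Vec d) × (ℕ → Vec d × B) =>
        lyap S (risk D loss) mL xs (θ (k + 1))
          (innerLoop loss eta gamma theta (h (k + 1)) (2 * m) (extrap (θ (k + 1)) q.1) q.2,
            q.1.1) := by
      have hs1 : Measurable fun q : (Vec d × Vec d) × (ℕ → Vec d × B) => q.1.1 :=
        measurable_fst.comp measurable_fst
      have hs2 : Measurable fun q : (Vec d × Vec d) × (ℕ → Vec d × B) => q.1.2 :=
        measurable_snd.comp measurable_fst
      have hy : Measurable fun q : (Vec d × Vec d) × (ℕ → Vec d × B) =>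
          extrap (θ (k + 1)) q.1 :=
        hs1.add ((hs1.sub hs2).const_smul ((1 - θ (k + 1)) / (1 + θ (k + 1))))
      have hI := (measurable_innerLoop hm.measurable_dloss eta gamma theta (h (k + 1))
        (2 * m)).comp (hy.prodMk measurable_snd)
      refine ((hm.measurable_risk.comp hI).sub_const _).add
        (((continuous_quad S).measurable.comp ?_).const_mul _)
      exact (hs1.add ((hI.sub hs1).const_smul (1 / θ (k + 1)))).sub_const xs
    have hU : Integrable (fun ω => (1 - 2 / 5 * θ (k + 1)) * lyap S (risk D loss) mL xs (θ k)
        (outerIter loss eta gamma theta h beta (2 * m) x0 (fun i => X i ω) k)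
        + M * θ (k + 1) ^ 2) P := (ihi.const_mul _).add (integrable_const _)
    have key := integral_le_of_indepFun (P := P)
      ((measurable_outerIter hm.measurable_dloss eta gamma theta h beta (2 * m) x0 k).comp hXm)
      (hblkm.comp hXm) hind hVm (fun q => lyap_nonneg hc.symmPos hm.smooth _ _)
      (U := fun s => (1 - 2 / 5 * θ (k + 1)) * lyap S (risk D loss) mL xs (θ k) s
        + M * θ (k + 1) ^ 2)
      (fun s => by
        have := (hone s).1
        refine this.congr (Filter.Eventually.of_forall fun ω => ?_)
        have h1 := hstep s fun i => X i ω
        simp only [Function.comp]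
        rw [h1])
      (fun s => by
        refine le_trans (le_of_eq ?_) (hone s).2
        refine integral_congr_ae (Filter.Eventually.of_forall fun ω => ?_)
        have h1 := hstep s fun i => X i ω
        simp only [Function.comp]
        rw [h1])
      hU
    have hsucc : ∀ ω, outerIter loss eta gamma theta h beta (2 * m) x0 (fun i => X i ω) (k + 1)
        = (innerLoop loss eta gamma theta (h (k + 1)) (2 * m) (extrap (θ (k + 1))
            (outerIter loss eta gamma theta h beta (2 * m) x0 (fun i => X i ω) k))
            (blk fun i => X i ω),
          (outerIter loss eta gamma theta h beta (2 * m) x0 (fun i => X i ω) k).1) := by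
      intro ω
      have h1 := hstep (outerIter loss eta gamma theta h beta (2 * m) x0 (fun i => X i ω) k)
        fun i => X i ω
      rw [h1]
      simp only [outerIter, extrap, hbeta]
    simp_rw [hsucc]
    refine ⟨key.1, key.2.trans ?_⟩
    simp only [Function.comp]
    rw [integral_add (ihi.const_mul _) (integrable_const _), integral_const_mul, integral_const,
      probReal_univ, one_smul, Finset.prod_range_succ]
    have hθ' := hθ (k + 1)
    have hs' := hsmall (k + 1)
    have h1 := mul_le_mul_of_nonneg_left ihb (by linarith : 0 ≤ 1 - 2 / 5 * θ (k + 1))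
    -- the noise level is a supersolution because `1/θ` grows by at most `1/4`
    have h2 : 10 * ((1 - 2 / 5 * θ (k + 1)) * θ k) + θ (k + 1) ^ 2 ≤ 10 * θ (k + 1) := by
      have e1 : θ k ≤ θ (k + 1) + θ k * θ (k + 1) / 4 := by
        have := mul_le_mul_of_nonneg_left (hinv k) (mul_pos (hθ k) hθ').le
        have := hθ k
        field_simp at *
        linarith
      have e2 : θ k * (1 - θ (k + 1) / 4) ≤ θ (k + 1) := by linarith
      have e3 := hθ k
      have e4 := mul_le_mul_of_nonneg_right e2 (by linarith : 0 ≤ 1 - 3 / 20 * θ (k + 1))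
      have e5 : 0 ≤ θ k * θ (k + 1) ^ 2 := by positivity
      have e6 : θ k * (1 - 2 / 5 * θ (k + 1))
          ≤ θ k * ((1 - θ (k + 1) / 4) * (1 - 3 / 20 * θ (k + 1))) := by
        have : 0 ≤ θ k * (θ (k + 1) * θ (k + 1)) := by positivity
        linarith
      have e7 : 0 ≤ θ (k + 1) ^ 2 := sq_nonneg _
      linarith
    have h3 := mul_le_mul_of_nonneg_left h2 hM0
    linarith

end OuterChain

/-! ### One-dimensional Taylor bounds for the loss -/

theorem taylor_lower {f : ℝ → ℝ} {m : ℝ} (hf : Differentiable ℝ f)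
    (hf' : Differentiable ℝ (deriv f))
    (hm : ∀ s, m ≤ deriv (deriv f) s) (u v : ℝ) :
    f u + deriv f u * (v - u) + m / 2 * (v - u) ^ 2 ≤ f v := by
  -- `s ↦ f s - m s² / 2` has a monotone derivative
  have hmono : Monotone fun s => deriv f s - m * s := by
    refine monotone_of_deriv_nonneg (hf'.sub (differentiable_id.const_mul m)) fun s => ?_
    have h1 : HasDerivAt (fun s => deriv f s - m * s) (deriv (deriv f) s - m * 1) s :=
      (hf' s).hasDerivAt.sub ((hasDerivAt_id s).const_mul m)
    rw [h1.deriv]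
    linarith [hm s]
  have hg : ∀ s, HasDerivAt (fun s => f s - m / 2 * s ^ 2) (deriv f s - m * s) s := fun s => by
    have h1 : HasDerivAt (fun s => f s - m / 2 * s ^ 2)
        (deriv f s - m / 2 * ((2 : ℕ) * s ^ (2 - 1) * 1)) s :=
      (hf s).hasDerivAt.sub (((hasDerivAt_id s).pow 2).const_mul (m / 2))
    convert h1 using 1
    push_cast
    ring
  have hcont : Continuous fun s => f s - m / 2 * s ^ 2 :=
    continuous_iff_continuousAt.2 fun s => (hg s).continuousAt
  rcases lt_trichotomy u v with h | h | h
  · obtain ⟨c, hc, hceq⟩ := exists_hasDerivAt_eq_slope (fun s => f s - m / 2 * s ^ 2)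
      (fun s => deriv f s - m * s) h hcont.continuousOn fun s _ => hg s
    rw [eq_div_iff (sub_pos.2 h).ne'] at hceq
    have h1 := mul_le_mul_of_nonneg_right (hmono hc.1.le) (sub_pos.2 h).le
    simp only at h1
    nlinarith
  · rw [h]; simp
  · obtain ⟨c, hc, hceq⟩ := exists_hasDerivAt_eq_slope (fun s => f s - m / 2 * s ^ 2)
      (fun s => deriv f s - m * s) h hcont.continuousOn fun s _ => hg s
    rw [eq_div_iff (sub_pos.2 h).ne'] at hceq
    have h1 := mul_le_mul_of_nonneg_right (hmono hc.2.le) (sub_pos.2 h).le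
    simp only at h1
    nlinarith

theorem taylor_upper {f : ℝ → ℝ} {m : ℝ} (hf : Differentiable ℝ f)
    (hf' : Differentiable ℝ (deriv f))
    (hm : ∀ s, deriv (deriv f) s ≤ m) (u v : ℝ) :
    f v ≤ f u + deriv f u * (v - u) + m / 2 * (v - u) ^ 2 := by
  have hd : deriv (fun s => -f s) = fun s => -deriv f s := funext fun s => deriv.fun_neg
  have h := taylor_lower (f := fun s => -f s) (m := -m) hf.neg (by rw [hd]; exact hf'.neg)
    (fun s => by rw [hd, deriv.fun_neg]; exact neg_le_neg (hm s)) u v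
  rw [hd] at h
  linarith

theorem abs_deriv_sub_le {f : ℝ → ℝ} {m L : ℝ} (hm0 : 0 < m) (hf' : Differentiable ℝ (deriv f))
    (hm : ∀ s, m ≤ deriv (deriv f) s) (hL : ∀ s, deriv (deriv f) s ≤ L) (u v : ℝ) :
    |deriv f v - deriv f u| ≤ L * |v - u| := by
  refine Convex.norm_image_sub_le_of_norm_deriv_le (s := Set.univ) (fun s _ => hf' s)
    (fun s _ => ?_) convex_univ (Set.mem_univ u) (Set.mem_univ v)
  rw [Real.norm_of_nonneg (hm0.le.trans (hm s))]
  exact hL s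

/-! ### Moment matrices as operators -/

section Matrices

variable {d : ℕ} {B : Type*} [MeasurableSpace B]

/-- The operator of a matrix on Euclidean space. -/
noncomputable def matOp (M : Matrix (Fin d) (Fin d) ℝ) : Vec d →L[ℝ] Vec d :=
  Matrix.toEuclideanCLM (𝕜 := ℝ) M

theorem matOp_apply (M : Matrix (Fin d) (Fin d) ℝ) (x : Vec d) (i : Fin d) :
    matOp M x i = ∑ j, M i j * x j := rfl

theorem inner_eq_sum (x y : Vec d) : inner ℝ x y = ∑ i, x i * y i := by
  rw [PiLp.inner_apply]
  refine Finset.sum_congr rfl fun i _ => ?_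
  simp [mul_comm]

theorem inner_matOp (M : Matrix (Fin d) (Fin d) ℝ) (x y : Vec d) :
    inner ℝ x (matOp M y) = ∑ i, ∑ j, x i * M i j * y j := by
  rw [inner_eq_sum]
  refine Finset.sum_congr rfl fun i _ => ?_
  rw [matOp_apply, Finset.mul_sum]
  exact Finset.sum_congr rfl fun j _ => by ring

theorem quad_matOp (M : Matrix (Fin d) (Fin d) ℝ) (x : Vec d) :
    quad (matOp M) x = sqNorm M x := inner_matOp M x x

theorem isSymmPos_matOp {M : Matrix (Fin d) (Fin d) ℝ} (hM : M.PosSemidef) :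
    IsSymmPos (matOp M) where
  symm x y := by
    rw [inner_matOp, inner_matOp, Finset.sum_comm]
    refine Finset.sum_congr rfl fun i _ => Finset.sum_congr rfl fun j _ => ?_
    have := hM.1.apply i j
    simp only [star_trivial] at this
    rw [this]; ring
  nonneg x := by
    rw [quad, inner_matOp]
    have := hM.dotProduct_mulVec_nonneg (x : Fin d → ℝ)
    simp only [dotProduct, Matrix.mulVec, star_trivial, Finset.mul_sum] at this
    refine this.trans (le_of_eq ?_)
    exact Finset.sum_congr rfl fun i _ => Finset.sum_congr rfl fun j _ => by ring

variable {D : Measure (Vec d × B)}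

theorem integrable_weighted {w : Vec d × B → ℝ} (hw : AEStronglyMeasurable w D)
    (h : Integrable (fun p => |w p| * ‖p.1‖ ^ 2) D) (i j : Fin d) :
    Integrable (fun p => w p * (p.1 i * p.1 j)) D := by
  have hm : ∀ i, Measurable fun p : Vec d × B => p.1 i := fun i =>
    (EuclideanSpace.proj (𝕜 := ℝ) i).continuous.measurable.comp measurable_fst
  refine h.mono' (hw.mul ((hm i).mul (hm j)).aestronglyMeasurable)
    (Filter.Eventually.of_forall fun p => ?_)
  rw [norm_mul, norm_mul, Real.norm_eq_abs (w p), pow_two]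
  exact mul_le_mul_of_nonneg_left (mul_le_mul (PiLp.norm_apply_le p.1 i) (PiLp.norm_apply_le p.1 j)
    (norm_nonneg _) (norm_nonneg _)) (abs_nonneg _)

theorem sum_weightedMoment {w : Vec d × B → ℝ} (hw : AEStronglyMeasurable w D)
    (h : Integrable (fun p => |w p| * ‖p.1‖ ^ 2) D) (c : Fin d → Fin d → ℝ) :
    ∑ i, ∑ j, c i j * weightedMoment D w i j
      = ∫ p, w p * ∑ i, ∑ j, c i j * (p.1 i * p.1 j) ∂D := by
  have hi := integrable_weighted hw h
  have h1 : ∀ p : Vec d × B, w p * ∑ i, ∑ j, c i j * (p.1 i * p.1 j)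
      = ∑ i, ∑ j, c i j * (w p * (p.1 i * p.1 j)) := fun p => by
    simp only [Finset.mul_sum]
    exact Finset.sum_congr rfl fun i _ => Finset.sum_congr rfl fun j _ => by ring
  simp_rw [h1]
  rw [integral_finsetSum _ fun i _ => integrable_finsetSum _ fun j _ => (hi i j).const_mul _]
  refine Finset.sum_congr rfl fun i _ => ?_
  rw [integral_finsetSum _ fun j _ => (hi i j).const_mul _]
  refine Finset.sum_congr rfl fun j _ => ?_
  rw [integral_const_mul]
  rfl

theorem inner_weightedMoment {w : Vec d × B → ℝ} (hw : AEStronglyMeasurable w D)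
    (h : Integrable (fun p => |w p| * ‖p.1‖ ^ 2) D) (x y : Vec d) :
    inner ℝ x (matOp (weightedMoment D w) y)
      = ∫ p, w p * (inner ℝ p.1 x * inner ℝ p.1 y) ∂D := by
  have h1 := sum_weightedMoment hw h fun i j => x i * y j
  have h2 : ∀ p : Vec d × B, ∑ i, ∑ j, x i * y j * (p.1 i * p.1 j)
      = inner ℝ p.1 x * inner ℝ p.1 y := fun p => by
    rw [inner_eq_sum, inner_eq_sum, Finset.sum_mul_sum]
    exact Finset.sum_congr rfl fun i _ => Finset.sum_congr rfl fun j _ => by ring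
  simp_rw [h2] at h1
  rw [← h1, inner_matOp]
  exact Finset.sum_congr rfl fun i _ => Finset.sum_congr rfl fun j _ => by ring

theorem trace_mul_weightedMoment {w : Vec d × B → ℝ} (hw : AEStronglyMeasurable w D)
    (h : Integrable (fun p => |w p| * ‖p.1‖ ^ 2) D) (M : Matrix (Fin d) (Fin d) ℝ) :
    Matrix.trace (M * weightedMoment D w) = ∫ p, w p * sqNorm M p.1 ∂D := by
  have h1 := sum_weightedMoment hw h fun i j => M j i
  have h2 : ∀ p : Vec d × B, ∑ i, ∑ j, M j i * (p.1 i * p.1 j) = sqNorm M p.1 := fun p => by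
    rw [Finset.sum_comm, sqNorm]
    exact Finset.sum_congr rfl fun i _ => Finset.sum_congr rfl fun j _ => by ring
  simp_rw [h2] at h1
  rw [← h1, Finset.sum_comm]
  rfl

theorem sqNorm_one (x : Vec d) : sqNorm 1 x = ‖x‖ ^ 2 := by
  rw [← real_inner_self_eq_norm_sq, inner_eq_sum, sqNorm]
  refine Finset.sum_congr rfl fun i _ => ?_
  rw [Finset.sum_eq_single i]
  · simp
  · intro j _ hj; simp [Matrix.one_apply_ne hj.symm]
  · simp

/-- A Loewner inequality `M₂ ⪯ c M₁` in terms of quadratic forms. -/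
theorem quad_le_of_posSemidef_sub {M₁ M₂ : Matrix (Fin d) (Fin d) ℝ} {c : ℝ}
    (h : (c • M₁ - M₂).PosSemidef) (x : Vec d) : quad (matOp M₂) x ≤ c * quad (matOp M₁) x := by
  have h1 := (isSymmPos_matOp h).nonneg x
  have h2 : quad (matOp (c • M₁ - M₂)) x = c * quad (matOp M₁) x - quad (matOp M₂) x := by
    simp only [quad, inner_matOp, Finset.mul_sum, ← Finset.sum_sub_distrib, Matrix.sub_apply,
      Matrix.smul_apply, smul_eq_mul]
    exact Finset.sum_congr rfl fun i _ => Finset.sum_congr rfl fun j _ => by ring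
  linarith

/-- A symmetric matrix dominates its least eigenvalue. -/
theorem posSemidef_sub_least {M : Matrix (Fin d) (Fin d) ℝ} (hM : M.IsHermitian) {mu : ℝ}
    (hmu : ∀ x ∈ spectrum ℝ M, mu ≤ x) : (M - mu • 1).PosSemidef := by
  have hH : (M - mu • (1 : Matrix (Fin d) (Fin d) ℝ)).IsHermitian := by
    refine hM.sub ?_
    rw [Matrix.IsHermitian, Matrix.conjTranspose_smul, Matrix.conjTranspose_one, star_trivial]
  rw [hH.posSemidef_iff_eigenvalues_nonneg]
  intro i
  have h1 : hH.eigenvalues i ∈ spectrum ℝ (M - mu • (1 : Matrix (Fin d) (Fin d) ℝ)) := by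
    rw [hH.spectrum_real_eq_range_eigenvalues]; exact ⟨i, rfl⟩
  generalize hH.eigenvalues i = e at h1 ⊢
  rw [← Algebra.algebraMap_eq_smul_one, ← spectrum.sub_singleton_eq] at h1
  obtain ⟨x, hx, y, hy, hxy⟩ := Set.mem_sub.1 h1
  rw [Set.mem_singleton_iff] at hy
  have := hmu x hx
  simp only [Pi.zero_apply]
  linarith

end Matrices

/-! ### The standing assumptions give a loss model -/

section Model

variable {d : ℕ} {B : Type*} [MeasurableSpace B]

/-- The derivative is jointly measurable, as a limit of difference quotients. -/
theorem measurable_dloss_of {loss : ℝ → B → ℝ} (hl : Measurable (Function.uncurry loss))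
    (hd : ∀ b, Differentiable ℝ fun s => loss s b) :
    Measurable fun q : ℝ × B => dloss loss q.1 q.2 := by
  have hinv : Filter.Tendsto (fun n : ℕ => (1 : ℝ) / (n + 1)) Filter.atTop
      (nhdsWithin 0 {0}ᶜ) := by
    refine tendsto_nhdsWithin_iff.2 ⟨tendsto_one_div_add_atTop_nhds_zero_nat, ?_⟩
    refine Filter.Eventually.of_forall fun n => ?_
    have : (0 : ℝ) < 1 / (n + 1) := by positivity
    exact this.ne'
  refine measurable_of_tendsto_metrizable (f := fun (n : ℕ) (q : ℝ × B) =>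
    (1 / ((n : ℝ) + 1))⁻¹ • (loss (q.1 + 1 / ((n : ℝ) + 1)) q.2 - loss q.1 q.2)) (fun n => ?_) ?_
  · have h1 : Measurable fun q : ℝ × B => loss (q.1 + 1 / ((n : ℝ) + 1)) q.2 :=
      hl.comp ((measurable_fst.add_const _).prodMk measurable_snd)
    exact (h1.sub hl).const_smul ((1 / ((n : ℝ) + 1))⁻¹)
  · rw [tendsto_pi_nhds]
    intro q
    exact ((hd q.2 q.1).hasDerivAt.tendsto_slope_zero).comp hinv

variable {D : Measure (Vec d × B)} [IsProbabilityMeasure D] {loss : ℝ → B → ℝ} {xstar : Vec d}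
  {muLoss LLoss mu R kappaT : ℝ}

/-- Second-order bounds for the loss along all linear predictions, for almost every sample. Samples
with `a ≠ 0` reach every prediction; for `a = 0` there is nothing to compare. -/
theorem Assumptions.ae_taylor (hA : Assumptions D loss xstar muLoss LLoss mu R kappaT) :
    ∀ᵐ p ∂D, ∀ x y : Vec d,
      loss (inner ℝ p.1 x) p.2 + dloss loss (inner ℝ p.1 x) p.2 * inner ℝ p.1 (y - x)
          + muLoss / 2 * (inner ℝ p.1 (y - x) : ℝ) ^ 2 ≤ loss (inner ℝ p.1 y) p.2 ∧
      loss (inner ℝ p.1 y) p.2 ≤ loss (inner ℝ p.1 x) p.2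
          + dloss loss (inner ℝ p.1 x) p.2 * inner ℝ p.1 (y - x)
          + LLoss / 2 * (inner ℝ p.1 (y - x) : ℝ) ^ 2 ∧
      |dloss loss (inner ℝ p.1 y) p.2 - dloss loss (inner ℝ p.1 x) p.2|
          ≤ LLoss * |(inner ℝ p.1 (y - x) : ℝ)| := by
  filter_upwards [hA.curvature] with p hp x y
  rcases eq_or_ne p.1 0 with h0 | h0
  · simp [h0]
  · have hn : ‖p.1‖ ^ 2 ≠ 0 := by simpa using h0
    have hb : ∀ s : ℝ, muLoss ≤ ddloss loss s p.2 ∧ ddloss loss s p.2 ≤ LLoss := fun s => by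
      have := hp ((s / ‖p.1‖ ^ 2) • p.1)
      rwa [inner_smul_right, real_inner_self_eq_norm_sq, div_mul_cancel₀ _ hn] at this
    rw [inner_sub_right]
    exact ⟨taylor_lower (hA.differentiable_loss p.2) (hA.differentiable_dloss p.2)
        (fun s => (hb s).1) _ _,
      taylor_upper (hA.differentiable_loss p.2) (hA.differentiable_dloss p.2)
        (fun s => (hb s).2) _ _,
      abs_deriv_sub_le hA.muLoss_pos (hA.differentiable_dloss p.2) (fun s => (hb s).1)
        (fun s => (hb s).2) _ _⟩

/-- The gradient of the risk. -/
noncomputable def riskGrad (D : Measure (Vec d × B)) (loss : ℝ → B → ℝ) (x : Vec d) : Vec d :=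
  ∫ p, dloss loss (inner ℝ p.1 x) p.2 • p.1 ∂D

section Moments

theorem Assumptions.inner_cov (hA : Assumptions D loss xstar muLoss LLoss mu R kappaT)
    (x y : Vec d) :
    ∫ p, inner ℝ p.1 x * inner ℝ p.1 y ∂D = inner ℝ x (matOp (covMat D) y) := by
  rw [covMat, inner_weightedMoment aestronglyMeasurable_const (by simpa using hA.integrable_sq)]
  simp

theorem Assumptions.posSemidef_sub (hA : Assumptions D loss xstar muLoss LLoss mu R kappaT) :
    (covMat D - mu • 1).PosSemidef := by
  refine posSemidef_sub_least (Matrix.IsHermitian.ext fun i j => ?_) fun x hx => hA.isLeast_mu.2 hx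
  simp only [covMat, weightedMoment, Matrix.of_apply, star_trivial]
  simp_rw [mul_comm]

theorem Assumptions.mu_le (hA : Assumptions D loss xstar muLoss LLoss mu R kappaT) (x : Vec d) :
    mu * ‖x‖ ^ 2 ≤ quad (matOp (covMat D)) x := by
  have h : ((1 : ℝ) • covMat D - mu • 1).PosSemidef := by rw [one_smul]; exact hA.posSemidef_sub
  have h1 := quad_le_of_posSemidef_sub h x
  have h2 : quad (matOp (mu • (1 : Matrix (Fin d) (Fin d) ℝ))) x = mu * ‖x‖ ^ 2 := by
    rw [← sqNorm_one, quad_matOp]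
    simp only [sqNorm, Finset.mul_sum, Matrix.smul_apply, smul_eq_mul]
    exact Finset.sum_congr rfl fun i _ => Finset.sum_congr rfl fun j _ => by ring
  rw [h2, one_mul] at h1
  exact h1

theorem Assumptions.posDef (hA : Assumptions D loss xstar muLoss LLoss mu R kappaT) :
    (covMat D).PosDef := by
  have h1 : (mu • (1 : Matrix (Fin d) (Fin d) ℝ)).PosDef := Matrix.PosDef.one.smul hA.mu_pos
  have h2 := h1.add_posSemidef hA.posSemidef_sub
  rwa [add_sub_cancel] at h2

theorem Assumptions.matOp_mul_inv (hA : Assumptions D loss xstar muLoss LLoss mu R kappaT) :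
    (∀ x, matOp (covMat D) (matOp (covMat D)⁻¹ x) = x) ∧
      ∀ x, matOp (covMat D)⁻¹ (matOp (covMat D) x) = x := by
  have hu := (Matrix.isUnit_iff_isUnit_det _).1 hA.posDef.isUnit
  constructor
  · intro x
    have h : matOp (covMat D) * matOp (covMat D)⁻¹ = 1 := by
      rw [matOp, matOp, ← map_mul, Matrix.mul_nonsing_inv _ hu, map_one]
    exact congrArg (fun T : Vec d →L[ℝ] Vec d => T x) h
  · intro x
    have h : matOp (covMat D)⁻¹ * matOp (covMat D) = 1 := by
      rw [matOp, matOp, ← map_mul, Matrix.nonsing_inv_mul _ hu, map_one]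
    exact congrArg (fun T : Vec d →L[ℝ] Vec d => T x) h

theorem Assumptions.integrable_weight_mul_inner (hA : Assumptions D loss xstar muLoss LLoss mu R kappaT)
    {W : Vec d → ℝ} (hW : Measurable W) {c : ℝ} (hWc : ∀ v, |W v| ≤ c * ‖v‖ ^ 2) (x y : Vec d) :
    Integrable (fun p : Vec d × B => W p.1 * (inner ℝ p.1 x * inner ℝ p.1 y)) D := by
  refine (hA.integrable_fourth.const_mul (c * ‖x‖ * ‖y‖)).mono'
    ((hW.comp measurable_fst).mul (measurable_fst.inner_const.mul
      measurable_fst.inner_const)).aestronglyMeasurable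
    (Filter.Eventually.of_forall fun p => ?_)
  rw [norm_mul, norm_mul, Real.norm_eq_abs]
  have h1 := norm_inner_le_norm (𝕜 := ℝ) p.1 x
  have h2 := norm_inner_le_norm (𝕜 := ℝ) p.1 y
  calc |W p.1| * (‖(inner ℝ p.1 x : ℝ)‖ * ‖(inner ℝ p.1 y : ℝ)‖)
      ≤ (c * ‖p.1‖ ^ 2) * ((‖p.1‖ * ‖x‖) * (‖p.1‖ * ‖y‖)) :=
        mul_le_mul (hWc _) (mul_le_mul h1 h2 (norm_nonneg _) (by positivity)) (by positivity)
          ((abs_nonneg _).trans (hWc _))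
    _ = _ := by ring

/-- A Loewner bound on a fourth-moment matrix, as an inequality of integrals. -/
theorem Assumptions.fourth_le (hA : Assumptions D loss xstar muLoss LLoss mu R kappaT)
    {W : Vec d → ℝ} (hW : Measurable W) {c : ℝ} (hWc : ∀ v, |W v| ≤ c * ‖v‖ ^ 2) {C : ℝ}
    (h : (C • covMat D - weightedMoment D fun p => W p.1).PosSemidef) (x : Vec d) :
    ∫ p, W p.1 * (inner ℝ p.1 x : ℝ) ^ 2 ∂D ≤ C * quad (matOp (covMat D)) x := by
  have hWm : Measurable fun p : Vec d × B => W p.1 := hW.comp measurable_fst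
  have h1 := quad_le_of_posSemidef_sub h x
  rw [quad, inner_weightedMoment hWm.aestronglyMeasurable] at h1
  · simpa only [pow_two] using h1
  · refine (hA.integrable_fourth.const_mul c).mono'
      (hWm.abs.mul (measurable_fst.norm.pow_const 2)).aestronglyMeasurable
      (Filter.Eventually.of_forall fun p => ?_)
    rw [Real.norm_of_nonneg (by positivity)]
    have := mul_le_mul_of_nonneg_right (hWc p.1) (sq_nonneg ‖p.1‖)
    linarith

/-- Jensen's inequality for the fourth moment of a linear functional. -/
theorem Assumptions.quad_sq_le (hA : Assumptions D loss xstar muLoss LLoss mu R kappaT)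
    (x : Vec d) :
    Integrable (fun p : Vec d × B => (inner ℝ p.1 x : ℝ) ^ 4) D ∧
    quad (matOp (covMat D)) x ^ 2 ≤ ∫ p, (inner ℝ p.1 x : ℝ) ^ 4 ∂D := by
  have hi2 : Integrable (fun p : Vec d × B => (inner ℝ p.1 x : ℝ) ^ 2) D := by
    refine (hA.integrable_sq.mul_const (‖x‖ ^ 2)).mono'
      (measurable_fst.inner_const.pow_const 2).aestronglyMeasurable
      (Filter.Eventually.of_forall fun p => ?_)
    rw [Real.norm_of_nonneg (sq_nonneg _)]
    exact inner_sq_le_norm _ _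
  have hi4 : Integrable (fun p : Vec d × B => (inner ℝ p.1 x : ℝ) ^ 4) D := by
    refine (hA.integrable_fourth.mul_const (‖x‖ ^ 4)).mono'
      (measurable_fst.inner_const.pow_const 4).aestronglyMeasurable
      (Filter.Eventually.of_forall fun p => ?_)
    rw [Real.norm_of_nonneg (by positivity)]
    have := pow_le_pow_left₀ (sq_nonneg _) (inner_sq_le_norm p.1 x) 2
    calc (inner ℝ p.1 x : ℝ) ^ 4 = ((inner ℝ p.1 x : ℝ) ^ 2) ^ 2 := by ring
      _ ≤ (‖p.1‖ ^ 2 * ‖x‖ ^ 2) ^ 2 := this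
      _ = _ := by ring
  refine ⟨hi4, ?_⟩
  set N := quad (matOp (covMat D)) x with hN
  have hq : ∫ p, (inner ℝ p.1 x : ℝ) ^ 2 ∂D = N := by
    simp_rw [pow_two]; exact hA.inner_cov x x
  have h1 : 0 ≤ ∫ p, ((inner ℝ p.1 x : ℝ) ^ 4 - 2 * N * (inner ℝ p.1 x : ℝ) ^ 2 + N ^ 2) ∂D :=
    integral_nonneg fun p => by
      have := sq_nonneg ((inner ℝ p.1 x : ℝ) ^ 2 - N)
      simp only [Pi.zero_apply]
      linarith
  have hi5 : Integrable (fun p : Vec d × B =>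
      (inner ℝ p.1 x : ℝ) ^ 4 - 2 * N * (inner ℝ p.1 x : ℝ) ^ 2) D := hi4.sub (hi2.const_mul _)
  rw [integral_add hi5 (integrable_const _), integral_sub hi4 (hi2.const_mul _),
    integral_const_mul, hq, integral_const, probReal_univ, one_smul] at h1
  linarith

/-- The bounds `κ̃ ≥ 1` and `Σ ⪯ R²` are not assumed; both follow from the fourth-moment bounds by
Jensen's inequality. -/
theorem Assumptions.covModel (hA : Assumptions D loss xstar muLoss LLoss mu R kappaT) :
    CovModel D Prod.fst (matOp (covMat D)) (matOp (covMat D)⁻¹) mu R kappaT := by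
  have hS := isSymmPos_matOp hA.posDef.posSemidef
  have hSi := isSymmPos_matOp hA.posDef.inv.posSemidef
  obtain ⟨hSSi, hSiS⟩ := hA.matOp_mul_inv
  have hmu := hA.mu_pos
  set S := matOp (covMat D) with hSdef
  set Si := matOp (covMat D)⁻¹ with hSidef
  have hMS : ∀ x, quad Si (S x) = quad S x := fun x => by
    rw [quad, quad, hSiS, real_inner_comm]
  have hnormb : ∀ v : Vec d, |‖v‖ ^ 2| ≤ 1 * ‖v‖ ^ 2 := fun v => by
    rw [abs_of_nonneg (sq_nonneg _), one_mul]
  have hinvb : ∀ v : Vec d, |quad Si v| ≤ 1 / mu * ‖v‖ ^ 2 := fun v => by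
    rw [abs_of_nonneg (hSi.nonneg v)]
    have h1 := hA.mu_le (Si v)
    have h2 : quad S (Si v) = quad Si v := by rw [quad, quad, hSSi, real_inner_comm]
    rw [← hSdef, h2] at h1
    have h3 : quad Si v ≤ ‖v‖ * ‖Si v‖ := real_inner_le_norm _ _
    rw [one_div_mul_eq_div, le_div_iff₀ hmu]
    nlinarith [sq_nonneg (‖v‖ - mu * ‖Si v‖)]
  have hmi : Measurable (quad Si) := (continuous_quad Si).measurable
  have h4 : ∀ x, ∫ p, ‖p.1‖ ^ 2 * (inner ℝ p.1 x : ℝ) ^ 2 ∂D ≤ R ^ 2 * quad S x :=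
    hA.fourth_le (W := fun v => ‖v‖ ^ 2) (measurable_norm.pow_const 2) hnormb hA.fourth_moment
  have h4i : ∀ x, ∫ p, quad Si p.1 * (inner ℝ p.1 x : ℝ) ^ 2 ∂D ≤ kappaT * quad S x := by
    refine hA.fourth_le (W := quad Si) hmi hinvb ?_
    have h := hA.fourth_moment_inv
    simp_rw [← quad_matOp] at h
    exact h
  have hi4 : ∀ x, Integrable (fun p : Vec d × B => ‖p.1‖ ^ 2 * (inner ℝ p.1 x : ℝ) ^ 2) D :=
    fun x => by
      simp_rw [pow_two (inner ℝ _ x : ℝ)]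
      exact hA.integrable_weight_mul_inner (W := fun v => ‖v‖ ^ 2)
        (measurable_norm.pow_const 2) hnormb x x
  have hi4i : ∀ x, Integrable (fun p : Vec d × B => quad Si p.1 * (inner ℝ p.1 x : ℝ) ^ 2) D :=
    fun x => by
      simp_rw [pow_two (inner ℝ _ x : ℝ)]
      exact hA.integrable_weight_mul_inner (W := quad Si) hmi hinvb x x
  refine ⟨measurable_fst, hA.integrable_fourth, hA.inner_cov, hSSi, hSiS, hmu, ?_,
    hA.mu_le, ?_, h4, h4i⟩
  · -- the Cauchy–Schwarz inequality `⟪a, x⟫² ≤ ‖a‖²_{Σ⁻¹} ‖x‖²_Σ` at one nonzero vector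
    have hspec := hA.isLeast_mu.1
    rw [hA.posDef.1.spectrum_real_eq_range_eigenvalues] at hspec
    obtain ⟨i, -⟩ := hspec
    set x : Vec d := EuclideanSpace.single i 1 with hx
    have hNpos : 0 < quad S x := by
      refine lt_of_lt_of_le ?_ (hA.mu_le x)
      have : ‖x‖ = 1 := by rw [hx]; simp
      rw [this]; simpa using hmu
    obtain ⟨hq4, hq⟩ := hA.quad_sq_le x
    have h1 : ∫ p, (inner ℝ p.1 x : ℝ) ^ 4 ∂D
        ≤ ∫ p, quad S x * (quad Si p.1 * (inner ℝ p.1 x : ℝ) ^ 2) ∂D := by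
      refine integral_mono hq4 ((hi4i x).const_mul _) fun p => ?_
      have h2 := hSi.inner_sq_le p.1 (S x)
      rw [hSiS, hMS] at h2
      have := mul_le_mul_of_nonneg_right h2 (sq_nonneg (inner ℝ p.1 x : ℝ))
      simp only
      linarith
    rw [integral_const_mul] at h1
    have h2 := mul_le_mul_of_nonneg_left (h4i x) hNpos.le
    rw [← hSdef] at hq
    have h3 : quad S x ^ 2 ≤ kappaT * quad S x ^ 2 := by linarith
    have : 0 < quad S x ^ 2 := by positivity
    by_contra hlt
    nlinarith
  · intro x
    obtain ⟨hq4, hq⟩ := hA.quad_sq_le x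
    have h1 : ∫ p, (inner ℝ p.1 x : ℝ) ^ 4 ∂D
        ≤ ∫ p, ‖x‖ ^ 2 * (‖p.1‖ ^ 2 * (inner ℝ p.1 x : ℝ) ^ 2) ∂D := by
      refine integral_mono hq4 ((hi4 x).const_mul _) fun p => ?_
      have := mul_le_mul_of_nonneg_right (inner_sq_le_norm p.1 x) (sq_nonneg (inner ℝ p.1 x : ℝ))
      simp only
      linarith
    rw [integral_const_mul] at h1
    have h2 := mul_le_mul_of_nonneg_left (h4 x) (sq_nonneg ‖x‖)
    rw [← hSdef] at hq
    rcases (hS.nonneg x).eq_or_lt with h | h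
    · rw [← h]; positivity
    · nlinarith

end Moments

/-- The stochastic gradients are integrable: at `x⋆` by the second moment of the noise, elsewhere by
the Lipschitz bound on `ℓ'`. -/
theorem Assumptions.integrable_dloss_mul_norm
    (hA : Assumptions D loss xstar muLoss LLoss mu R kappaT) (x : Vec d) :
    Integrable (fun p : Vec d × B => |dloss loss (inner ℝ p.1 x) p.2| * ‖p.1‖) D := by
  have hmd := measurable_dloss_of hA.measurable_loss hA.differentiable_loss
  have hm : Measurable fun p : Vec d × B => dloss loss (inner ℝ p.1 x) p.2 :=
    hmd.comp (measurable_fst.inner_const.prodMk measurable_snd)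
  refine ((hA.integrable_noise.add (integrable_const (1 : ℝ))).add
    (hA.integrable_sq.const_mul (LLoss * ‖x - xstar‖))).mono'
    (hm.abs.mul measurable_fst.norm).aestronglyMeasurable ?_
  filter_upwards [hA.ae_taylor] with p hp
  have h1 := (hp xstar x).2.2
  have h2 : |(inner ℝ p.1 (x - xstar) : ℝ)| ≤ ‖p.1‖ * ‖x - xstar‖ := abs_real_inner_le_norm _ _
  rw [Real.norm_of_nonneg (by positivity)]
  simp only [Pi.add_apply]
  set u := dloss loss (inner ℝ p.1 x) p.2
  set v := dloss loss (inner ℝ p.1 xstar) p.2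
  have h3 : |u| ≤ |v| + LLoss * (‖p.1‖ * ‖x - xstar‖) := by
    have h4 := mul_le_mul_of_nonneg_left h2 hA.LLoss_pos.le
    have h5 := abs_sub_abs_le_abs_sub u v
    linarith
  have h6 := mul_le_mul_of_nonneg_right h3 (norm_nonneg p.1)
  have h7 : |v| * ‖p.1‖ ≤ v ^ 2 * ‖p.1‖ ^ 2 + 1 := by
    rw [← sq_abs v]
    nlinarith [sq_nonneg (|v| * ‖p.1‖ - 1), sq_nonneg (|v| * ‖p.1‖)]
  linarith

theorem Assumptions.lossModel (hA : Assumptions D loss xstar muLoss LLoss mu R kappaT) :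
    LossModel D loss (matOp (covMat D)) (matOp (covMat D)⁻¹) mu R kappaT (riskGrad D loss)
      muLoss LLoss xstar := by
  have hmd := measurable_dloss_of hA.measurable_loss hA.differentiable_loss
  have hm : ∀ x, Measurable fun p : Vec d × B => dloss loss (inner ℝ p.1 x) p.2 := fun x =>
    hmd.comp (measurable_fst.inner_const.prodMk measurable_snd)
  have hc := hA.covModel
  have hgi : ∀ x, Integrable (fun p : Vec d × B => dloss loss (inner ℝ p.1 x) p.2 • p.1) D :=
    fun x => by
      refine (hA.integrable_dloss_mul_norm x).mono'
        ((hm x).smul measurable_fst).aestronglyMeasurable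
        (Filter.Eventually.of_forall fun p => ?_)
      rw [norm_smul, Real.norm_eq_abs]
  have hgii : ∀ y x, Integrable (fun p : Vec d × B =>
      dloss loss (inner ℝ p.1 y) p.2 * inner ℝ p.1 x) D := fun y x => by
    have := (hgi y).inner_const (𝕜 := ℝ) x
    simpa only [inner_smul_left, conj_trivial] using this
  have hge : ∀ y x, ∫ p, dloss loss (inner ℝ p.1 y) p.2 * inner ℝ p.1 x ∂D
      = inner ℝ (riskGrad D loss y) x := fun y x => by
    have h := integral_inner (hgi y) x (𝕜 := ℝ)
    rw [real_inner_comm, riskGrad, ← h]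
    refine integral_congr_ae (Filter.Eventually.of_forall fun p => ?_)
    simp only [inner_smul_right]
    rw [real_inner_comm p.1 x]
  have hsq : ∀ v, Integrable (fun p : Vec d × B => (inner ℝ p.1 v : ℝ) ^ 2) D := fun v =>
    (hc.integrable_inner_mul_inner v v).congr
      (Filter.Eventually.of_forall fun p => (pow_two _).symm)
  have hq : ∀ v, ∫ p, (inner ℝ p.1 v : ℝ) ^ 2 ∂D = quad (matOp (covMat D)) v := fun v => by
    simp_rw [pow_two]; exact hA.inner_cov v v
  have hquad : ∀ (c : ℝ) (x y : Vec d), Integrable (fun p : Vec d × B =>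
      loss (inner ℝ p.1 x) p.2 + dloss loss (inner ℝ p.1 x) p.2 * inner ℝ p.1 (y - x)
        + c * (inner ℝ p.1 (y - x) : ℝ) ^ 2) D ∧
      ∫ p, (loss (inner ℝ p.1 x) p.2 + dloss loss (inner ℝ p.1 x) p.2 * inner ℝ p.1 (y - x)
        + c * (inner ℝ p.1 (y - x) : ℝ) ^ 2) ∂D
      = risk D loss x + inner ℝ (riskGrad D loss x) (y - x)
        + c * quad (matOp (covMat D)) (y - x) := fun c x y => by
    have h1 : Integrable (fun p : Vec d × B => loss (inner ℝ p.1 x) p.2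
      + dloss loss (inner ℝ p.1 x) p.2 * inner ℝ p.1 (y - x)) D :=
      (hA.integrable_loss x).add (hgii x (y - x))
    refine ⟨h1.add ((hsq _).const_mul c), ?_⟩
    rw [integral_add h1 ((hsq _).const_mul c), integral_add (hA.integrable_loss x)
      (hgii x (y - x)), integral_const_mul, hq, hge]
    rfl
  have hlower : ∀ x y, risk D loss x + inner ℝ (riskGrad D loss x) (y - x)
      + muLoss / 2 * quad (matOp (covMat D)) (y - x) ≤ risk D loss y := fun x y => by
    rw [← (hquad (muLoss / 2) x y).2]
    refine integral_mono_ae (hquad (muLoss / 2) x y).1 (hA.integrable_loss y) ?_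
    filter_upwards [hA.ae_taylor] with p hp using (hp x y).1
  have hupper : ∀ x y, risk D loss y ≤ risk D loss x + inner ℝ (riskGrad D loss x) (y - x)
      + LLoss / 2 * quad (matOp (covMat D)) (y - x) := fun x y => by
    rw [← (hquad (LLoss / 2) x y).2]
    refine integral_mono_ae (hA.integrable_loss y) (hquad (LLoss / 2) x y).1 ?_
    filter_upwards [hA.ae_taylor] with p hp using (hp x y).2.1
  have hgrad : riskGrad D loss xstar = 0 := by
    -- a short step along the negative gradient would decrease the risk
    set g := riskGrad D loss xstar with hg
    set N := quad (matOp (covMat D)) g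
    have hN : 0 ≤ N := hc.symmPos.nonneg g
    have hL := hA.LLoss_pos
    set t := ‖g‖ ^ 2 / (LLoss * N + 1) with ht
    have h1 := hupper xstar (xstar - t • g)
    have h2 := hA.isMinimizer (xstar - t • g)
    rw [sub_sub_cancel_left, quad_neg, quad_smul, inner_neg_right, inner_smul_right, ← hg,
      real_inner_self_eq_norm_sq] at h1
    have hpos : 0 < LLoss * N + 1 := by positivity
    have htg : ‖g‖ ^ 2 = t * (LLoss * N + 1) := by rw [ht]; field_simp
    rw [htg] at h1
    have h3 : t ^ 2 * (LLoss * N / 2 + 1) ≤ 0 := by linarith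
    have h4 : 0 ≤ LLoss * N / 2 := by positivity
    have h5 : t = 0 := by
      by_contra h0
      have : 0 < t ^ 2 := by positivity
      nlinarith
    rw [h5, zero_mul] at htg
    simpa using htg
  refine ⟨hc, ⟨hA.muLoss_pos, hA.LLoss_pos, hlower, hupper, hgrad⟩, ?_, hmd, ?_,
    hA.integrable_noise, hgii, hge⟩
  · have h1 : Measurable fun q : Vec d × (Vec d × B) => loss (inner ℝ q.2.1 q.1) q.2.2 :=
      hA.measurable_loss.comp (((measurable_fst.comp measurable_snd).inner measurable_fst).prodMk
        (measurable_snd.comp measurable_snd))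
    exact h1.stronglyMeasurable.integral_prod_right'.measurable
  · filter_upwards [hA.ae_taylor] with p hp y using (hp xstar y).2.2

theorem Assumptions.muLoss_le (hA : Assumptions D loss xstar muLoss LLoss mu R kappaT) :
    muLoss ≤ LLoss := by
  obtain ⟨p, hp⟩ := hA.curvature.exists
  exact (hp 0).1.trans (hp 0).2

theorem Assumptions.measurable_dloss_sq
    (hA : Assumptions D loss xstar muLoss LLoss mu R kappaT) :
    Measurable fun p : Vec d × B => (dloss loss (inner ℝ p.1 xstar) p.2) ^ 2 :=
  ((measurable_dloss_of hA.measurable_loss hA.differentiable_loss).comp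
    (measurable_fst.inner_const.prodMk measurable_snd)).pow_const 2

theorem Assumptions.trace_mul_gradNoise (hA : Assumptions D loss xstar muLoss LLoss mu R kappaT)
    (M : Matrix (Fin d) (Fin d) ℝ) :
    Matrix.trace (M * gradNoise D loss xstar)
      = ∫ p, (dloss loss (inner ℝ p.1 xstar) p.2) ^ 2 * sqNorm M p.1 ∂D := by
  refine trace_mul_weightedMoment hA.measurable_dloss_sq.aestronglyMeasurable ?_ M
  refine hA.integrable_noise.congr (Filter.Eventually.of_forall fun p => ?_)
  dsimp only
  rw [abs_of_nonneg (sq_nonneg (dloss loss (inner ℝ p.1 xstar) p.2))]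

theorem Assumptions.trace_gradNoise (hA : Assumptions D loss xstar muLoss LLoss mu R kappaT) :
    (gradNoise D loss xstar).trace
      = ∫ p, (dloss loss (inner ℝ p.1 xstar) p.2) ^ 2 * ‖p.1‖ ^ 2 ∂D := by
  have := hA.trace_mul_gradNoise 1
  simp_rw [sqNorm_one] at this
  rw [← this, one_mul]

theorem Assumptions.LLoss_mul_trace (hA : Assumptions D loss xstar muLoss LLoss mu R kappaT) :
    LLoss * Matrix.trace ((LLoss • covMat D)⁻¹ * gradNoise D loss xstar)
      = ∫ p, (dloss loss (inner ℝ p.1 xstar) p.2) ^ 2 * quad (matOp (covMat D)⁻¹) p.1 ∂D := by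
  have hL := hA.LLoss_pos.ne'
  have hu := (Matrix.isUnit_iff_isUnit_det _).1 hA.posDef.isUnit
  have hinv : (LLoss • covMat D)⁻¹ = LLoss⁻¹ • (covMat D)⁻¹ :=
    Matrix.inv_smul' (covMat D) (Units.mk0 LLoss hL) hu
  rw [hinv, Matrix.smul_mul, Matrix.trace_smul, smul_eq_mul, mul_inv_cancel_left₀ hL,
    hA.trace_mul_gradNoise]
  simp_rw [quad_matOp]

/-- The effective noise in terms of the traces in the complexity bound. -/
theorem Assumptions.lossNoise_eq (hA : Assumptions D loss xstar muLoss LLoss mu R kappaT)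
    (eta : ℝ) :
    lossNoise D loss (matOp (covMat D)⁻¹) kappaT eta xstar
      = kappaT * eta * (gradNoise D loss xstar).trace
        + LLoss * Matrix.trace ((LLoss • covMat D)⁻¹ * gradNoise D loss xstar) := by
  rw [lossNoise, effNoise, hA.trace_gradNoise, hA.LLoss_mul_trace]

theorem Assumptions.trace_gradNoise_nonneg
    (hA : Assumptions D loss xstar muLoss LLoss mu R kappaT) :
    0 ≤ (gradNoise D loss xstar).trace := by
  rw [hA.trace_gradNoise]
  exact integral_nonneg fun p => by positivity

theorem Assumptions.trace_inv_mul_gradNoise_nonneg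
    (hA : Assumptions D loss xstar muLoss LLoss mu R kappaT) :
    0 ≤ Matrix.trace ((LLoss • covMat D)⁻¹ * gradNoise D loss xstar) := by
  refine nonneg_of_mul_nonneg_right ?_ hA.LLoss_pos
  rw [hA.LLoss_mul_trace]
  exact integral_nonneg fun p => mul_nonneg (sq_nonneg _) (hA.covModel.symmPos_inv.nonneg _)

end Model

/-! ### The momentum schedule -/

section Schedule

variable {tmax : ℝ} {K k : ℕ}

/-- The inverse momentum is constant on the first half and then grows linearly with slope `1/4`. -/
theorem one_div_thetaTilde (tmax : ℝ) (K k : ℕ) :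
    1 / thetaTilde tmax K k = 1 / tmax + max 0 ((k : ℝ) - K / 2) / 4 := by
  rw [thetaTilde]
  split_ifs with h
  · rw [max_eq_left (by linarith)]; ring
  · push Not at h
    rw [max_eq_right (by linarith), one_div_div]
    ring

theorem thetaTilde_pos (ht : 0 < tmax) (K k : ℕ) : 0 < thetaTilde tmax K k := by
  refine one_div_pos.1 ?_
  rw [one_div_thetaTilde]
  have := le_max_left 0 ((k : ℝ) - K / 2)
  positivity

theorem thetaTilde_le (ht : 0 < tmax) (K k : ℕ) : thetaTilde tmax K k ≤ tmax := by
  refine (one_div_le_one_div ht (thetaTilde_pos ht K k)).1 ?_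
  rw [one_div_thetaTilde]
  have := le_max_left 0 ((k : ℝ) - K / 2)
  linarith

theorem thetaTilde_succ_le (ht : 0 < tmax) (K k : ℕ) :
    thetaTilde tmax K (k + 1) ≤ thetaTilde tmax K k := by
  refine (one_div_le_one_div (thetaTilde_pos ht K k) (thetaTilde_pos ht K (k + 1))).1 ?_
  rw [one_div_thetaTilde, one_div_thetaTilde]
  have : max 0 ((k : ℝ) - K / 2) ≤ max 0 (((k + 1 : ℕ) : ℝ) - K / 2) :=
    max_le_max le_rfl (by push_cast; linarith)
  linarith

theorem one_div_thetaTilde_succ_le (tmax : ℝ) (K k : ℕ) :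
    1 / thetaTilde tmax K (k + 1) ≤ 1 / thetaTilde tmax K k + 1 / 4 := by
  rw [one_div_thetaTilde, one_div_thetaTilde]
  have : max 0 (((k + 1 : ℕ) : ℝ) - K / 2) ≤ max 0 ((k : ℝ) - K / 2) + 1 := by
    refine max_le ?_ ?_
    · linarith [le_max_left 0 ((k : ℝ) - K / 2)]
    · push_cast; linarith [le_max_right 0 ((k : ℝ) - K / 2)]
  linarith

theorem one_div_thetaTilde_le (tmax : ℝ) (hk : k ≤ K) :
    1 / thetaTilde tmax K k ≤ 1 / tmax + K / 8 := by
  rw [one_div_thetaTilde]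
  have hk' : (k : ℝ) ≤ K := by exact_mod_cast hk
  have : max 0 ((k : ℝ) - K / 2) ≤ K / 2 := max_le (by positivity) (by linarith)
  linarith

theorem mul_thetaTilde_self_le (ht : 0 < tmax) (K : ℕ) : (K : ℝ) * thetaTilde tmax K K ≤ 8 := by
  have h := thetaTilde_pos ht K K
  have h1 : (K : ℝ) / 8 ≤ 1 / thetaTilde tmax K K := by
    rw [one_div_thetaTilde]
    have := le_max_right 0 ((K : ℝ) - K / 2)
    have := one_div_pos.2 ht
    linarith
  rw [le_div_iff₀ h] at h1
  linarith

/-- The first half of the schedule alone contracts by `exp (-2 K θ̃_max / 15)`. -/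
theorem prod_thetaTilde_le (ht : 0 < tmax) (ht1 : tmax ≤ 1) (hK : 2 ≤ K) :
    ∏ j ∈ Finset.range K, (1 - 2 / 5 * thetaTilde tmax K (j + 1))
      ≤ Real.exp (-(2 / 15 * (K * tmax))) := by
  have h1 : ∏ j ∈ Finset.range K, (1 - 2 / 5 * thetaTilde tmax K (j + 1))
      ≤ ∏ j ∈ Finset.range K, Real.exp (-(2 / 5 * thetaTilde tmax K (j + 1))) := by
    refine Finset.prod_le_prod (fun j _ => ?_) fun j _ => ?_
    · have := thetaTilde_le ht K (j + 1)
      linarith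
    · exact Real.one_sub_le_exp_neg _
  refine h1.trans ?_
  rw [← Real.exp_sum]
  refine Real.exp_le_exp.2 ?_
  rw [Finset.sum_neg_distrib, neg_le_neg_iff, ← Finset.mul_sum]
  have h2 : ∑ j ∈ Finset.range (K / 2), tmax
      ≤ ∑ j ∈ Finset.range K, thetaTilde tmax K (j + 1) := by
    refine (Finset.sum_le_sum fun j hj => ?_).trans
      (Finset.sum_le_sum_of_subset_of_nonneg (Finset.range_mono (Nat.div_le_self K 2))
        fun j _ _ => (thetaTilde_pos ht K (j + 1)).le)
    have hj' : ((2 * (j + 1) : ℕ) : ℝ) ≤ K := by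
      have := Finset.mem_range.1 hj
      exact_mod_cast (by omega : 2 * (j + 1) ≤ K)
    rw [thetaTilde, if_pos]
    push_cast at hj' ⊢
    linarith
  rw [Finset.sum_const, Finset.card_range, nsmul_eq_mul] at h2
  have h3 : (K : ℝ) / 3 ≤ ((K / 2 : ℕ) : ℝ) := by
    have : K ≤ 3 * (K / 2) := by omega
    have : (K : ℝ) ≤ 3 * ((K / 2 : ℕ) : ℝ) := by exact_mod_cast this
    linarith
  have := mul_le_mul_of_nonneg_right h3 ht.le
  linarith

end Schedule

/-! ### Sample size arithmetic -/

/-- The logarithmic factor at the complexity may be traded for the one at the sample size. -/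
theorem mul_log_sq_mul_le {c n X g : ℝ} (hc : 1 ≤ c) (hX : 1 ≤ X) (hg : 0 ≤ g)
    (h : (64 * c) ^ 2 * Real.log (Real.exp 1 + X + g) ^ 2 * X ≤ n) :
    c * Real.log (Real.exp 1 + n + g) ^ 2 * X ≤ n := by
  have hX0 : 0 < X := by linarith
  have he := Real.exp_pos 1
  set lX := Real.log (Real.exp 1 + X + g) with hlX
  have hlX1 : 1 ≤ lX := by
    rw [hlX, Real.le_log_iff_exp_le (by positivity)]
    linarith
  obtain ⟨r, rfl⟩ : ∃ r, n = r * X := ⟨n / X, by field_simp⟩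
  have hr : (64 * c) ^ 2 * lX ^ 2 ≤ r := le_of_mul_le_mul_right h hX0
  have hlX2 : 1 ≤ lX ^ 2 := one_le_pow₀ hlX1
  have hr2 : (64 * c) ^ 2 ≤ r := by nlinarith [sq_nonneg (64 * c)]
  have hr1 : 1 ≤ r := by nlinarith
  have hr0 : 0 < r := by linarith
  have hlog : Real.log (Real.exp 1 + r * X + g) ≤ Real.log r + lX := by
    rw [hlX, ← Real.log_mul hr0.ne' (by positivity)]
    refine Real.log_le_log (by positivity) ?_
    nlinarith
  have hlog0 : 0 ≤ Real.log (Real.exp 1 + r * X + g) := by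
    refine Real.log_nonneg ?_
    have : 0 ≤ r * X := by positivity
    linarith [Real.add_one_le_exp 1]
  -- `log r = 4 log r^{1/4} ≤ 4 r^{1/4}`
  have hlr : Real.log r ^ 2 ≤ 16 * √r := by
    have h1 : Real.log r = 4 * Real.log (√(√r)) := by
      rw [Real.log_sqrt (Real.sqrt_nonneg _), Real.log_sqrt hr0.le]; ring
    have h2 : Real.log (√(√r)) ≤ √(√r) := (Real.log_le_self (Real.sqrt_nonneg _))
    have h3 : 0 ≤ Real.log r := Real.log_nonneg hr1
    have h4 : √(√r) ^ 2 = √r := Real.sq_sqrt (Real.sqrt_nonneg _)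
    nlinarith [Real.sqrt_nonneg (√r)]
  have hsr : 64 * c ≤ √r := Real.le_sqrt_of_sq_le hr2
  have hsr2 : √r ^ 2 = r := Real.sq_sqrt hr0.le
  have h5 : Real.log (Real.exp 1 + r * X + g) ^ 2 ≤ 2 * Real.log r ^ 2 + 2 * lX ^ 2 := by
    nlinarith [sq_nonneg (Real.log r - lX)]
  refine mul_le_mul_of_nonneg_right ?_ hX0.le
  have h6 : c * (2 * Real.log r ^ 2) ≤ r / 2 := by nlinarith
  have h7 : c * (2 * lX ^ 2) ≤ r / 2 := by nlinarith
  nlinarith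

/-- The sample size condition `n ≥ 10¹⁴ l² X`, split into the terms of the complexity `X` other than
`α tr (H⁻¹Q) / ε`, together with the elementary relations between the problem constants. Here
`alpha = L/μ_ℓ`, `tau = tr Q`, and `l` is the logarithmic factor at `n`. -/
structure SampleBudget (alpha kap mu L R eps tau n l : ℝ) : Prop where
  one_le_alpha : 1 ≤ alpha
  one_le_kap : 1 ≤ kap
  mu_pos : 0 < mu
  R_pos : 0 < R
  mu_le : mu ≤ R ^ 2
  L_pos : 0 < L
  eps_pos : 0 < eps
  tau_nonneg : 0 ≤ tau
  one_le_l : 1 ≤ l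
  sqrt_le : 10 ^ 14 * l ^ 2 * √(alpha * (R ^ 2 / mu) * kap) ≤ n
  sq_le : 10 ^ 14 * l ^ 2 * (alpha ^ 2 * kap) ≤ n
  rpow_le : 10 ^ 14 * l ^ 2 * (alpha ^ 2 * kap ^ 2 * tau / (L * mu * eps)) ^ (1 / 3 : ℝ) ≤ n

namespace SampleBudget

variable {alpha kap mu L R eps tau l : ℝ} {n : ℕ}

theorem le_sampleSize (h : SampleBudget alpha kap mu L R eps tau n l) : (10 : ℝ) ^ 14 ≤ n := by
  have h1 := h.sq_le
  have h2 : 1 ≤ l ^ 2 := one_le_pow₀ h.one_le_l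
  have h3 : 1 ≤ alpha ^ 2 := one_le_pow₀ h.one_le_alpha
  have h4 : 1 ≤ alpha ^ 2 * kap := one_le_mul_of_one_le_of_one_le h3 h.one_le_kap
  nlinarith

/-- The smallest admissible step size meets both upper bounds, by the square of `sqrt_le` and the
cube of `rpow_le`. -/
theorem exists_stepSize (h : SampleBudget alpha kap mu L R eps tau n l) :
    ∃ eta, StepSizeOK ((256 * 10 ^ 8) ^ 2) (1 / 10 ^ 7) l alpha L mu R kap tau eps n eta := by
  have hn : (0 : ℝ) < n := lt_of_lt_of_le (by norm_num) h.le_sampleSize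
  have ha := h.one_le_alpha
  have hk := h.one_le_kap
  have hmu := h.mu_pos
  have hR := h.R_pos
  have hL := h.L_pos
  have he := h.eps_pos
  have hl := h.one_le_l
  have hτ := h.tau_nonneg
  refine ⟨_, le_rfl, ?_, ?_⟩
  · have h1 := pow_le_pow_left₀ (by positivity) h.sqrt_le 2
    rw [mul_pow, Real.sq_sqrt (by positivity)] at h1
    have e1 : (256 * 10 ^ 8) ^ 2 * l ^ 4 * (alpha * kap / (mu * (n : ℝ) ^ 2))
        = (256 * 10 ^ 8) ^ 2 * (l ^ 4 * (alpha * (R ^ 2 / mu) * kap)) / n ^ 2 * (1 / R ^ 2) := by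
      field_simp
    rw [e1]
    refine mul_le_mul_of_nonneg_right ?_ (by positivity)
    rw [div_le_iff₀ (by positivity)]
    have h2 : 0 ≤ l ^ 4 * (alpha * (R ^ 2 / mu) * kap) := by positivity
    nlinarith
  · have h1 := pow_le_pow_left₀ (by positivity) h.rpow_le 3
    have h0 : 0 ≤ alpha ^ 2 * kap ^ 2 * tau / (L * mu * eps) := by positivity
    have h3 : ((alpha ^ 2 * kap ^ 2 * tau / (L * mu * eps)) ^ (1 / 3 : ℝ)) ^ 3
        = alpha ^ 2 * kap ^ 2 * tau / (L * mu * eps) := by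
      rw [← Real.rpow_natCast, ← Real.rpow_mul h0]; norm_num
    rw [mul_pow, h3] at h1
    have e1 : (256 * 10 ^ 8) ^ 2 * l ^ 4 * (alpha * kap / (mu * (n : ℝ) ^ 2)) * (alpha * kap * tau)
        = (256 * 10 ^ 8) ^ 2 * (l ^ 4 * (alpha ^ 2 * kap ^ 2 * tau / (L * mu * eps))) / n ^ 3
          * (n * eps * L) := by
      field_simp
    rw [e1]
    refine mul_le_mul_of_nonneg_right ?_ (by positivity)
    rw [div_le_iff₀ (by positivity)]
    have h4 : l ^ 4 * (alpha ^ 2 * kap ^ 2 * tau / (L * mu * eps))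
        ≤ l ^ 6 * (alpha ^ 2 * kap ^ 2 * tau / (L * mu * eps)) :=
      mul_le_mul_of_nonneg_right (pow_le_pow_right₀ hl (by norm_num)) h0
    have h5 : 0 ≤ l ^ 6 * (alpha ^ 2 * kap ^ 2 * tau / (L * mu * eps)) := by positivity
    nlinarith

variable {eta : ℝ} {T : ℕ}

theorem eta_pos (h : SampleBudget alpha kap mu L R eps tau n l)
    (hη : StepSizeOK ((256 * 10 ^ 8) ^ 2) (1 / 10 ^ 7) l alpha L mu R kap tau eps n eta) :
    0 < eta := by
  have hn : (0 : ℝ) < n := lt_of_lt_of_le (by norm_num) h.le_sampleSize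
  have ha := h.one_le_alpha
  have hk := h.one_le_kap
  have hmu := h.mu_pos
  have hl := h.one_le_l
  exact lt_of_lt_of_le (by positivity) hη.1

theorem eta_mul_sq_le (h : SampleBudget alpha kap mu L R eps tau n l)
    (hη : StepSizeOK ((256 * 10 ^ 8) ^ 2) (1 / 10 ^ 7) l alpha L mu R kap tau eps n eta) :
    eta * R ^ 2 ≤ 1 / 16 := by
  have h1 := hη.2.1
  have hR := h.R_pos
  rw [mul_one_div, le_div_iff₀ (by positivity)] at h1
  linarith

theorem mu_mul_eta_le (h : SampleBudget alpha kap mu L R eps tau n l)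
    (hη : StepSizeOK ((256 * 10 ^ 8) ^ 2) (1 / 10 ^ 7) l alpha L mu R kap tau eps n eta) :
    mu * eta ≤ 1 / 16 := by
  have h1 := mul_le_mul_of_nonneg_right h.mu_le (h.eta_pos hη).le
  linarith [h.eta_mul_sq_le hη]

theorem one_le_sqrt (h : SampleBudget alpha kap mu L R eps tau n l)
    (hη : StepSizeOK ((256 * 10 ^ 8) ^ 2) (1 / 10 ^ 7) l alpha L mu R kap tau eps n eta) :
    1 ≤ √(kap / (mu * eta)) := by
  have h0 : 0 < mu * eta := mul_pos h.mu_pos (h.eta_pos hη)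
  rw [Real.one_le_sqrt, le_div_iff₀ h0]
  linarith [h.mu_mul_eta_le hη, h.one_le_kap]

/-- The interval `[A, 2A]` prescribed for `T` has `A ≥ 128`, so it contains an even integer. -/
theorem exists_innerLength (h : SampleBudget alpha kap mu L R eps tau n l)
    (hη : StepSizeOK ((256 * 10 ^ 8) ^ 2) (1 / 10 ^ 7) l alpha L mu R kap tau eps n eta) :
    ∃ T, InnerLengthOK 128 l mu kap eta T := by
  have h1 := h.one_le_sqrt hη
  have h2 : 1 ≤ l * √(kap / (mu * eta)) := one_le_mul_of_one_le_of_one_le h.one_le_l h1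
  have h3 : 128 ≤ 128 * l * √(kap / (mu * eta)) := by linarith
  set A := 128 * l * √(kap / (mu * eta)) with hA
  refine ⟨2 * ⌈A / 2⌉₊, even_two_mul _, ?_, ?_⟩
  · push_cast
    linarith [Nat.le_ceil (A / 2)]
  · push_cast
    linarith [Nat.ceil_lt_add_one (by linarith : 0 ≤ A / 2)]

theorem innerLength_pos (h : SampleBudget alpha kap mu L R eps tau n l)
    (hη : StepSizeOK ((256 * 10 ^ 8) ^ 2) (1 / 10 ^ 7) l alpha L mu R kap tau eps n eta)
    (hT : InnerLengthOK 128 l mu kap eta T) : (1 : ℝ) ≤ T := by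
  have h1 := h.one_le_sqrt hη
  have h2 : 1 ≤ l * √(kap / (mu * eta)) := one_le_mul_of_one_le_of_one_le h.one_le_l h1
  linarith [hT.2.1]

/-- The lower bound on the step size makes the inner loops short. -/
theorem innerLength_mul_le (h : SampleBudget alpha kap mu L R eps tau n l)
    (hη : StepSizeOK ((256 * 10 ^ 8) ^ 2) (1 / 10 ^ 7) l alpha L mu R kap tau eps n eta)
    (hT : InnerLengthOK 128 l mu kap eta T) : 10 ^ 8 * l * √alpha * T ≤ n := by
  have hn : (0 : ℝ) < n := lt_of_lt_of_le (by norm_num) h.le_sampleSize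
  have ha : 0 < alpha := lt_of_lt_of_le one_pos h.one_le_alpha
  have hk : 0 < kap := lt_of_lt_of_le one_pos h.one_le_kap
  have hmu := h.mu_pos
  have hl : 0 < l := lt_of_lt_of_le one_pos h.one_le_l
  have h0 := h.eta_pos hη
  have hsa := Real.sqrt_pos.2 ha
  have h1 : √(kap / (mu * eta)) ≤ n / (256 * 10 ^ 8 * l ^ 2 * √alpha) := by
    rw [Real.sqrt_le_left (by positivity), div_pow, mul_pow, Real.sq_sqrt ha.le,
      div_le_div_iff₀ (by positivity) (by positivity)]
    have h2 := hη.1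
    rw [← mul_div_assoc, div_le_iff₀ (by positivity)] at h2
    nlinarith
  rw [le_div_iff₀ (by positivity)] at h1
  have h3 := mul_le_mul_of_nonneg_right hT.2.2 (by positivity : 0 ≤ 10 ^ 8 * l * √alpha)
  linarith

theorem innerLength_le_half (h : SampleBudget alpha kap mu L R eps tau n l)
    (hη : StepSizeOK ((256 * 10 ^ 8) ^ 2) (1 / 10 ^ 7) l alpha L mu R kap tau eps n eta)
    (hT : InnerLengthOK 128 l mu kap eta T) : (T : ℝ) ≤ n / 2 := by
  have h1 := h.innerLength_mul_le hη hT
  have h2 : 1 ≤ √alpha := Real.one_le_sqrt.2 h.one_le_alpha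
  have h3 : 1 ≤ l * √alpha := one_le_mul_of_one_le_of_one_le h.one_le_l h2
  have h4 : (0 : ℝ) ≤ T := Nat.cast_nonneg T
  nlinarith

/-- The outer loop uses at least half of the samples. -/
theorem half_le_mul (h : SampleBudget alpha kap mu L R eps tau n l)
    (hη : StepSizeOK ((256 * 10 ^ 8) ^ 2) (1 / 10 ^ 7) l alpha L mu R kap tau eps n eta)
    (hT : InnerLengthOK 128 l mu kap eta T) : (n : ℝ) / 2 ≤ (n / T : ℕ) * T := by
  have h1 := h.innerLength_le_half hη hT
  have h2 : 0 < T := by exact_mod_cast one_pos.trans_le (h.innerLength_pos hη hT)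
  have h3 : (n : ℝ) ≤ (n / T : ℕ) * T + T := by
    have := Nat.lt_div_mul_add h2 (a := n)
    exact_mod_cast this.le
  linarith

theorem thetaMax_pos (h : SampleBudget alpha kap mu L R eps tau n l) (hT : (1 : ℝ) ≤ T) :
    0 < thetaMax (1 / 10 ^ 6) alpha kap T := by
  have ha : 0 < alpha := lt_of_lt_of_le one_pos h.one_le_alpha
  have hk : 0 < kap := lt_of_lt_of_le one_pos h.one_le_kap
  have := Real.sqrt_pos.2 ha
  have h1 : 0 < min (1 / √alpha) ((T : ℝ) / (alpha ^ 2 * kap)) :=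
    lt_min (by positivity) (by positivity)
  rw [thetaMax]
  positivity

theorem thetaMax_mul_sqrt_le (h : SampleBudget alpha kap mu L R eps tau n l) :
    thetaMax (1 / 10 ^ 6) alpha kap T * √alpha ≤ 1 / 10 ^ 6 := by
  have ha : 0 < alpha := lt_of_lt_of_le one_pos h.one_le_alpha
  have hs := Real.sqrt_pos.2 ha
  have := min_le_left (1 / √alpha) ((T : ℝ) / (alpha ^ 2 * kap))
  rw [le_div_iff₀ hs] at this
  rw [thetaMax]
  linarith

theorem thetaMax_mul_le (h : SampleBudget alpha kap mu L R eps tau n l) :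
    thetaMax (1 / 10 ^ 6) alpha kap T * (alpha ^ 2 * kap) ≤ 1 / 10 ^ 6 * T := by
  have ha : 0 < alpha := lt_of_lt_of_le one_pos h.one_le_alpha
  have hk : 0 < kap := lt_of_lt_of_le one_pos h.one_le_kap
  have := min_le_right (1 / √alpha) ((T : ℝ) / (alpha ^ 2 * kap))
  rw [le_div_iff₀ (by positivity)] at this
  rw [thetaMax]
  linarith

theorem thetaMax_le (h : SampleBudget alpha kap mu L R eps tau n l) (hT : (1 : ℝ) ≤ T) :
    thetaMax (1 / 10 ^ 6) alpha kap T ≤ 1 / 10 ^ 6 := by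
  have h1 := h.thetaMax_mul_sqrt_le (T := T)
  have h2 : 1 ≤ √alpha := Real.one_le_sqrt.2 h.one_le_alpha
  have h3 := h.thetaMax_pos hT
  nlinarith

/-- The outer loop is long enough to contract by a power of `exp l`. -/
theorem le_mul_thetaMax (h : SampleBudget alpha kap mu L R eps tau n l)
    (hη : StepSizeOK ((256 * 10 ^ 8) ^ 2) (1 / 10 ^ 7) l alpha L mu R kap tau eps n eta)
    (hT : InnerLengthOK 128 l mu kap eta T) :
    50 * l ≤ (n / T : ℕ) * thetaMax (1 / 10 ^ 6) alpha kap T := by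
  have ha : 0 < alpha := lt_of_lt_of_le one_pos h.one_le_alpha
  have hk : 0 < kap := lt_of_lt_of_le one_pos h.one_le_kap
  have hs := Real.sqrt_pos.2 ha
  have hl := h.one_le_l
  have h1 := h.half_le_mul hη hT
  have h2 := h.innerLength_mul_le hη hT
  have h3 := h.sq_le
  have hT1 := h.innerLength_pos hη hT
  have hT0 : (0 : ℝ) < T := by linarith
  set K : ℝ := ((n / T : ℕ) : ℝ) with hK
  have hK0 : 0 ≤ K := Nat.cast_nonneg _
  have h4 : 50 * 10 ^ 6 * l / K ≤ min (1 / √alpha) ((T : ℝ) / (alpha ^ 2 * kap)) := by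
    have hn : (0 : ℝ) < n := lt_of_lt_of_le (by norm_num) h.le_sampleSize
    have hKpos : 0 < K := by
      rcases hK0.lt_or_eq with hh | hh
      · exact hh
      · rw [← hh] at h1; linarith
    refine le_min ?_ ?_
    · rw [div_le_div_iff₀ hKpos hs]
      refine le_of_mul_le_mul_right ?_ hT0
      linarith
    · rw [div_le_div_iff₀ hKpos (by positivity)]
      have h5 : l * (alpha ^ 2 * kap) ≤ l ^ 2 * (alpha ^ 2 * kap) := by
        refine mul_le_mul_of_nonneg_right ?_ (by positivity)
        nlinarith
      have h6 : 0 ≤ l * (alpha ^ 2 * kap) := by positivity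
      linarith
  have h5 := mul_le_mul_of_nonneg_left h4 hK0
  have h6 : K * (50 * 10 ^ 6 * l / K) = 50 * 10 ^ 6 * l := by
    have hn : (0 : ℝ) < n := lt_of_lt_of_le (by norm_num) h.le_sampleSize
    have : K ≠ 0 := by
      intro hh
      rw [hh] at h1; linarith
    field_simp
  rw [h6] at h5
  rw [thetaMax]
  linarith

theorem one_div_thetaMax_le (h : SampleBudget alpha kap mu L R eps tau n l) (hT : (1 : ℝ) ≤ T) :
    1 / thetaMax (1 / 10 ^ 6) alpha kap T ≤ n := by
  have ha := h.one_le_alpha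
  have hk : 0 < kap := lt_of_lt_of_le one_pos h.one_le_kap
  have hs := Real.sqrt_pos.2 (one_pos.trans_le ha)
  have hn : (0 : ℝ) < n := lt_of_lt_of_le (by norm_num) h.le_sampleSize
  have hak : alpha ^ 2 * kap ≤ n / 10 ^ 14 := by
    rw [le_div_iff₀ (by norm_num)]
    have h2 : 1 ≤ l ^ 2 := one_le_pow₀ h.one_le_l
    have : 0 < alpha ^ 2 * kap := by positivity
    nlinarith [h.sq_le]
  rw [div_le_iff₀ (h.thetaMax_pos hT), thetaMax]
  have h1 : 10 ^ 6 / (n : ℝ) ≤ min (1 / √alpha) ((T : ℝ) / (alpha ^ 2 * kap)) := by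
    refine le_min ?_ ?_
    · rw [div_le_div_iff₀ hn hs]
      have h2 : √alpha ≤ alpha ^ 2 * kap := by
        have h3 : √alpha ≤ alpha := Real.sqrt_le_iff.2 ⟨by linarith, by nlinarith⟩
        have h4 : alpha ^ 2 ≤ alpha ^ 2 * kap :=
          le_mul_of_one_le_right (by positivity) h.one_le_kap
        nlinarith
      linarith
    · rw [div_le_div_iff₀ hn (by positivity)]
      nlinarith
  rw [div_le_iff₀ hn] at h1
  linarith

theorem innerParams (h : SampleBudget alpha kap mu L R eps tau n l)
    (hη : StepSizeOK ((256 * 10 ^ 8) ^ 2) (1 / 10 ^ 7) l alpha L mu R kap tau eps n eta) :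
    InnerParams mu R kap eta (gammaPar mu kap eta) (thetaPar mu kap eta) := by
  have hk : 0 < kap := lt_of_lt_of_le one_pos h.one_le_kap
  have hmu := h.mu_pos
  have h0 := h.eta_pos hη
  refine ⟨h0, h.eta_mul_sq_le hη, ?_, ?_, ?_, ?_, ?_⟩
  · rw [gammaPar]
    have := Real.sqrt_pos.2 (by positivity : 0 < eta / (kap * mu))
    positivity
  · rw [gammaPar, thetaPar]
    have : mu * eta / kap = eta / (kap * mu) * mu ^ 2 := by field_simp
    rw [this, Real.sqrt_mul (by positivity), Real.sqrt_sq hmu.le]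
    ring
  · rw [gammaPar, mul_pow, Real.sq_sqrt (by positivity)]
    field_simp
    norm_num
  · rw [thetaPar]
    have := Real.sqrt_pos.2 (by positivity : 0 < mu * eta / kap)
    positivity
  · rw [thetaPar]
    have : √(mu * eta / kap) ≤ 1 := by
      refine Real.sqrt_le_one.2 ((div_le_one hk).2 ?_)
      linarith [h.mu_mul_eta_le hη, h.one_le_kap]
    linarith

/-- The inner loops are long on the time scale `1/θ`. -/
theorem le_thetaPar_mul (h : SampleBudget alpha kap mu L R eps tau n l)
    (hη : StepSizeOK ((256 * 10 ^ 8) ^ 2) (1 / 10 ^ 7) l alpha L mu R kap tau eps n eta)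
    (hT : InnerLengthOK 128 l mu kap eta T) : 32 * l ≤ thetaPar mu kap eta * T := by
  have hk : 0 < kap := lt_of_lt_of_le one_pos h.one_le_kap
  have hmu := h.mu_pos
  have h0 := h.eta_pos hη
  have h1 : √(mu * eta / kap) * √(kap / (mu * eta)) = 1 := by
    rw [← Real.sqrt_mul (by positivity), ← Real.sqrt_one]
    congr 1
    field_simp
  have h2 := mul_le_mul_of_nonneg_left hT.2.1 (h.innerParams hη).theta_pos.le
  refine le_trans (le_of_eq ?_) h2
  calc 32 * l = 32 * l * (√(mu * eta / kap) * √(kap / (mu * eta))) := by rw [h1, mul_one]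
    _ = _ := by rw [thetaPar]; ring

/-- Over half an inner loop the initial condition is forgotten to polynomial accuracy in `n`. -/
theorem one_sub_thetaPar_pow_le (h : SampleBudget alpha kap mu L R eps tau n l)
    (hη : StepSizeOK ((256 * 10 ^ 8) ^ 2) (1 / 10 ^ 7) l alpha L mu R kap tau eps n eta)
    {m : ℕ} (hT : InnerLengthOK 128 l mu kap eta (2 * m)) (hl : (n : ℝ) ≤ Real.exp l) :
    (1 - thetaPar mu kap eta) ^ m ≤ 1 / (n : ℝ) ^ 5 := by
  have hn : (0 : ℝ) < n := lt_of_lt_of_le (by norm_num) h.le_sampleSize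
  have h1 := h.le_thetaPar_mul hη hT
  have hl1 := h.one_le_l
  push_cast at h1
  calc (1 - thetaPar mu kap eta) ^ m ≤ Real.exp (-thetaPar mu kap eta) ^ m :=
        pow_le_pow_left₀ (by linarith [(h.innerParams hη).theta_le_one])
          (Real.one_sub_le_exp_neg _) m
    _ = Real.exp (-(thetaPar mu kap eta * m)) := by rw [← Real.exp_nat_mul]; congr 1; ring
    _ ≤ Real.exp (-(5 * l)) := Real.exp_le_exp.2 (by linarith)
    _ = 1 / Real.exp l ^ 5 := by
        rw [Real.exp_neg, ← Real.exp_nat_mul, one_div]; norm_num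
    _ ≤ 1 / (n : ℝ) ^ 5 :=
        one_div_le_one_div_of_le (by positivity) (pow_le_pow_left₀ hn.le hl 5)

theorem sq_div_le (h : SampleBudget alpha kap mu L R eps tau n l) : R ^ 2 / mu ≤ (n : ℝ) ^ 2 := by
  have hmu := h.mu_pos
  have ha := h.one_le_alpha
  have hk := h.one_le_kap
  have h1 := pow_le_pow_left₀ (by positivity) h.sqrt_le 2
  rw [mul_pow, Real.sq_sqrt (by positivity)] at h1
  have h2 : 1 ≤ l ^ 2 := one_le_pow₀ h.one_le_l
  have h3 : 1 * (R ^ 2 / mu) * 1 ≤ alpha * (R ^ 2 / mu) * kap := by gcongr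
  have h4 : 1 ≤ (10 ^ 14 * l ^ 2) ^ 2 := one_le_pow₀ (by linarith)
  have h5 : 0 ≤ R ^ 2 / mu := by positivity
  nlinarith

theorem alpha_sq_le (h : SampleBudget alpha kap mu L R eps tau n l) : alpha ^ 2 ≤ n := by
  have h1 := h.sq_le
  have h2 : 1 ≤ l ^ 2 := one_le_pow₀ h.one_le_l
  have h3 : alpha ^ 2 ≤ alpha ^ 2 * kap := le_mul_of_one_le_right (by positivity) h.one_le_kap
  nlinarith [sq_nonneg alpha]

end SampleBudget

/-! ### From the sample size to the excess risk -/

section Final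

variable {d : ℕ} {B : Type*} [MeasurableSpace B] {D : Measure (Vec d × B)} [IsProbabilityMeasure D]
  {loss : ℝ → B → ℝ} {xstar : Vec d} {muLoss LLoss mu R kappaT eps : ℝ}

/-- There is a nonzero vector to compare the two bounds on: the spectrum of `Σ` is nonempty. -/
theorem Assumptions.mu_le_R_sq (hA : Assumptions D loss xstar muLoss LLoss mu R kappaT) :
    mu ≤ R ^ 2 := by
  have hd : Nonempty (Fin d) := by
    by_contra hd
    rw [not_nonempty_iff] at hd
    have h := hA.isLeast_mu.1
    rw [spectrum.of_subsingleton] at h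
    exact h
  obtain ⟨i⟩ := hd
  have h := (hA.covModel.mu_le (EuclideanSpace.single i 1)).trans
    (hA.covModel.le_R (EuclideanSpace.single i 1))
  simpa using h

theorem Assumptions.one_le_alpha (hA : Assumptions D loss xstar muLoss LLoss mu R kappaT) :
    1 ≤ LLoss / muLoss := by
  rw [one_le_div hA.muLoss_pos]
  exact hA.muLoss_le

theorem Assumptions.one_le_complexity (hA : Assumptions D loss xstar muLoss LLoss mu R kappaT)
    (heps : 0 < eps) :
    1 ≤ complexity (covMat D) (gradNoise D loss xstar) muLoss LLoss mu R kappaT eps := by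
  have h1 := hA.one_le_alpha
  have h2 := hA.covModel.one_le_kap
  have h3 := hA.trace_gradNoise_nonneg
  have h4 := hA.trace_inv_mul_gradNoise_nonneg
  have h5 : 1 ≤ (LLoss / muLoss) ^ 2 * kappaT :=
    one_le_mul_of_one_le_of_one_le (one_le_pow₀ h1) h2
  have hL := hA.LLoss_pos
  have hmu := hA.mu_pos
  have hml := hA.muLoss_pos
  have h6 : 0 ≤ LLoss / muLoss * Matrix.trace ((LLoss • covMat D)⁻¹ * gradNoise D loss xstar)
      / eps := by positivity
  have h7 : 0 ≤ ((LLoss / muLoss) ^ 2 * kappaT ^ 2 * Matrix.trace (gradNoise D loss xstar)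
      / (LLoss * mu * eps)) ^ (1 / 3 : ℝ) := by positivity
  rw [complexity]
  linarith [Real.sqrt_nonneg (LLoss / muLoss * (R ^ 2 / mu) * kappaT)]

theorem Assumptions.sampleBudget (hA : Assumptions D loss xstar muLoss LLoss mu R kappaT)
    (heps : 0 < eps) {n l : ℝ} (hl : 1 ≤ l)
    (hn : 10 ^ 14 * l ^ 2
      * complexity (covMat D) (gradNoise D loss xstar) muLoss LLoss mu R kappaT eps ≤ n) :
    SampleBudget (LLoss / muLoss) kappaT mu LLoss R eps (gradNoise D loss xstar).trace n l ∧
    10 ^ 14 * (LLoss / muLoss * Matrix.trace ((LLoss • covMat D)⁻¹ * gradNoise D loss xstar)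
      / eps) ≤ n := by
  have h1 := hA.one_le_alpha
  have h2 := hA.covModel.one_le_kap
  have h3 := hA.trace_gradNoise_nonneg
  have h4 := hA.trace_inv_mul_gradNoise_nonneg
  have hL := hA.LLoss_pos
  have hmu := hA.mu_pos
  have hml := hA.muLoss_pos
  have h5 : 0 ≤ (LLoss / muLoss) ^ 2 * kappaT := by positivity
  have h6 : 0 ≤ LLoss / muLoss * Matrix.trace ((LLoss • covMat D)⁻¹ * gradNoise D loss xstar)
      / eps := by positivity
  have h7 : 0 ≤ ((LLoss / muLoss) ^ 2 * kappaT ^ 2 * Matrix.trace (gradNoise D loss xstar)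
      / (LLoss * mu * eps)) ^ (1 / 3 : ℝ) := by positivity
  have h8 := Real.sqrt_nonneg (LLoss / muLoss * (R ^ 2 / mu) * kappaT)
  have hl2 : 1 ≤ l ^ 2 := one_le_pow₀ hl
  have hl0 : (0 : ℝ) ≤ 10 ^ 14 * l ^ 2 := by positivity
  rw [complexity] at hn
  refine ⟨⟨h1, h2, hmu, hA.R_pos, hA.mu_le_R_sq, hL, heps, h3, hl, ?_, ?_, ?_⟩, ?_⟩
  · exact (mul_le_mul_of_nonneg_left (by linarith) hl0).trans hn
  · exact (mul_le_mul_of_nonneg_left (by linarith) hl0).trans hn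
  · exact (mul_le_mul_of_nonneg_left (by linarith) hl0).trans hn
  · refine (mul_le_mul_of_nonneg_right (?_ : (10 : ℝ) ^ 14 ≤ 10 ^ 14 * l ^ 2) h6).trans
      ((mul_le_mul_of_nonneg_left ?_ hl0).trans hn)
    · linarith
    · linarith

/-- With `x⁻ = x` the Lyapunov function is at most `3/2` of the excess risk. -/
theorem lyap_self_le {E : Type*} [NormedAddCommGroup E] [InnerProductSpace ℝ E] {S : E →L[ℝ] E}
    {F : E → ℝ} {G : E → E} {mL L : ℝ} {xs : E} (hF : RelSmooth S F G mL L xs) (θ : ℝ) (x : E) :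
    lyap S F mL xs θ (x, x) ≤ 3 / 2 * (F x - F xs) := by
  have h := hF.growth x
  have : momErr xs θ (x, x) = x - xs := by simp [momErr]
  rw [lyap, this]
  linarith

theorem sub_le_lyap {E : Type*} [NormedAddCommGroup E] [InnerProductSpace ℝ E] {S : E →L[ℝ] E}
    (hS : IsSymmPos S) {F : E → ℝ} {mL : ℝ} (hm : 0 < mL) (xs : E) (θ : ℝ) (s : E × E) :
    F s.1 - F xs ≤ lyap S F mL xs θ s := by
  rw [lyap]
  have := mul_nonneg (by linarith : 0 ≤ mL / 4) (hS.nonneg (momErr xs θ s))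
  linarith

/-- The tuned algorithm satisfies the hypotheses of the outer-loop bound, which yields the excess
risk as a bias term, contracted over the whole run, plus a variance term. -/
theorem Assumptions.integral_excess_le
    (hA : Assumptions D loss xstar muLoss LLoss mu R kappaT) {n : ℕ} {l eta : ℝ}
    (hb : SampleBudget (LLoss / muLoss) kappaT mu LLoss R eps (gradNoise D loss xstar).trace n l)
    (hη : StepSizeOK ((256 * 10 ^ 8) ^ 2) (1 / 10 ^ 7) l (LLoss / muLoss) LLoss mu R kappaT
      (gradNoise D loss xstar).trace eps n eta) (hl : (n : ℝ) ≤ Real.exp l)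
    {m : ℕ} (hT : InnerLengthOK 128 l mu kappaT eta (2 * m))
    {Ω : Type*} [MeasurableSpace Ω] {P : Measure Ω} [IsProbabilityMeasure P]
    {X : ℕ → Ω → Vec d × B} (hX : IIDSample X D P) (x0 : Vec d) :
    Integrable (fun ω => risk D loss (sadaTuned loss (1 / 10 ^ 6) muLoss LLoss mu kappaT eta
      (n / (2 * m)) (2 * m) x0 fun i => X i ω)) P ∧
    ∫ ω, risk D loss (sadaTuned loss (1 / 10 ^ 6) muLoss LLoss mu kappaT eta
      (n / (2 * m)) (2 * m) x0 fun i => X i ω) ∂P - risk D loss xstar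
      ≤ Real.exp (-(6 * l)) * (3 / 2 * (risk D loss x0 - risk D loss xstar))
        + 79200 * lossNoise D loss (matOp (covMat D)⁻¹) kappaT eta xstar / muLoss * (32 / n) := by
  set tmax := thetaMax (1 / 10 ^ 6) (LLoss / muLoss) kappaT (2 * m) with htmax
  set K := n / (2 * m) with hK
  have hm := hA.lossModel
  have hS := hA.covModel.symmPos
  have hn : (10 : ℝ) ^ 14 ≤ n := hb.le_sampleSize
  have hn0 : (0 : ℝ) < n := lt_of_lt_of_le (by norm_num) hn
  have hml := hA.muLoss_pos
  have hL := hA.LLoss_pos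
  have hmu := hA.mu_pos
  have hT1 := hb.innerLength_pos hη hT
  have ht : 0 < tmax := hb.thetaMax_pos hT1
  have hp := hb.innerParams hη
  have hl1 := hb.one_le_l
  have hpow := hb.one_sub_thetaPar_pow_le hη hT hl
  have hTn := hb.innerLength_le_half hη hT
  have hhalf := hb.half_le_mul hη hT
  have hKt := hb.le_mul_thetaMax hη hT
  have htle := hb.thetaMax_le hT1
  have htinv := hb.one_div_thetaMax_le hT1
  rw [← htmax] at hKt htle htinv
  rw [← hK] at hKt hhalf
  push_cast at hT1 hTn hhalf
  have hm0 : (0 : ℝ) < m := by linarith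
  have hthm : 1 ≤ thetaPar mu kappaT eta * m := by
    have := hb.le_thetaPar_mul hη hT
    push_cast at this
    linarith
  have hn5 : (n : ℝ) * (1 / (n : ℝ) ^ 5) ≤ 1 := by
    rw [mul_one_div, div_le_one (by positivity)]
    exact le_self_pow₀ (by linarith) (by norm_num)
  have hρ0 : 0 ≤ (1 - thetaPar mu kappaT eta) ^ m := pow_nonneg (by linarith [hp.theta_le_one]) m
  have hρ1 : m * (1 - thetaPar mu kappaT eta) ^ m ≤ 1 :=
    (mul_le_mul (by linarith) hpow hρ0 hn0.le).trans hn5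
  have hKn : (K : ℝ) ≤ n := by exact_mod_cast Nat.div_le_self _ _
  have hρ2 : ∀ k ≤ K, 64 * (R ^ 2 / mu) * (LLoss / muLoss) ^ 2 * (1 - thetaPar mu kappaT eta) ^ m
      ≤ thetaTilde tmax K k := fun k hk => by
    have h1 := one_div_thetaTilde_le tmax hk
    have h3 := thetaTilde_pos ht K k
    -- `κ ≤ n²` and `α² ≤ n`, while `θ̃_k` never falls below `1/(2n)`
    have h4 : 1 / (2 * n : ℝ) ≤ thetaTilde tmax K k := by
      rw [one_div_le (by positivity) h3]
      linarith
    have h5 : 64 * (R ^ 2 / mu) * (LLoss / muLoss) ^ 2 * (1 - thetaPar mu kappaT eta) ^ m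
        ≤ 64 * (n : ℝ) ^ 2 * n * (1 / (n : ℝ) ^ 5) := by
      have := hb.sq_div_le
      have := hb.alpha_sq_le
      gcongr
    refine (h5.trans ?_).trans h4
    rw [mul_one_div, div_le_div_iff₀ (by positivity) (by positivity)]
    nlinarith [pow_pos hn0 3, pow_pos hn0 4]
  -- `h_k ≤ 2 c₀² / L_ℓ` because `θ̃_k² ≤ c₀² / α`, and `α² κ̃ θ̃_k ≤ c₀ T`
  have hbound := hm.integral_lyap_le hp hX hthm hρ1 (θ := thetaTilde tmax K) (K := K)
    (h := hPar (LLoss / muLoss) LLoss tmax K) (beta := betaPar tmax K)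
    (thetaTilde_pos ht K) (thetaTilde_succ_le ht K)
    (fun k => by linarith [thetaTilde_le ht K k]) (one_div_thetaTilde_succ_le tmax K)
    (fun k => by rw [hPar]; field_simp)
    (fun k => by
      have h1 := hb.thetaMax_mul_sqrt_le (T := 2 * m)
      rw [← htmax] at h1
      have h2 := thetaTilde_le ht K k
      have h3 := thetaTilde_pos ht K k
      have h4 : √(LLoss / muLoss) ^ 2 = LLoss / muLoss := Real.sq_sqrt (by positivity)
      have h5 : thetaTilde tmax K k * √(LLoss / muLoss) ≤ 1 / 10 ^ 6 :=
        (mul_le_mul_of_nonneg_right h2 (Real.sqrt_nonneg _)).trans h1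
      have h6 := pow_le_pow_left₀ (by positivity) h5 2
      rw [mul_pow, h4] at h6
      have h7 : 4 * LLoss * hPar (LLoss / muLoss) LLoss tmax K k
          = 8 * (thetaTilde tmax K k ^ 2 * (LLoss / muLoss)) := by
        rw [hPar]; field_simp; norm_num
      rw [h7]
      linarith)
    (fun k => rfl) hρ2
    (fun k => by
      have h1 := hb.thetaMax_mul_le (T := 2 * m)
      rw [← htmax] at h1
      push_cast at h1
      have h2 := mul_le_mul_of_nonneg_right (thetaTilde_le ht K k)
        (by have := hA.covModel.one_le_kap; positivity : 0 ≤ (LLoss / muLoss) ^ 2 * kappaT)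
      linarith) x0 K le_rfl
  have hout : ∀ ω, sadaTuned loss (1 / 10 ^ 6) muLoss LLoss mu kappaT eta K (2 * m) x0
      (fun i => X i ω) = (outerIter loss eta (gammaPar mu kappaT eta) (thetaPar mu kappaT eta)
        (hPar (LLoss / muLoss) LLoss tmax K) (betaPar tmax K) (2 * m) x0 (fun i => X i ω) K).1 :=
    fun ω => rfl
  simp_rw [hout]
  have hXm : Measurable fun ω i => X i ω := measurable_pi_lambda _ hX.measurable
  have hmeas := hm.measurable_risk.comp (measurable_fst.comp
    ((measurable_outerIter hm.measurable_dloss eta (gammaPar mu kappaT eta)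
      (thetaPar mu kappaT eta) (hPar (LLoss / muLoss) LLoss tmax K) (betaPar tmax K) (2 * m)
      x0 K).comp hXm))
  have hint : Integrable (fun ω => risk D loss (outerIter loss eta (gammaPar mu kappaT eta)
      (thetaPar mu kappaT eta) (hPar (LLoss / muLoss) LLoss tmax K) (betaPar tmax K) (2 * m) x0
      (fun i => X i ω) K).1 - risk D loss xstar) P := by
    refine hbound.1.mono' (hmeas.sub_const _).aestronglyMeasurable
      (Filter.Eventually.of_forall fun ω => ?_)
    rw [Real.norm_of_nonneg (sub_nonneg.2 (hA.isMinimizer _))]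
    exact sub_le_lyap hS hml xstar _ _
  have hint' := hint.add (integrable_const (risk D loss xstar))
  simp only [Pi.add_def, sub_add_cancel] at hint'
  refine ⟨hint', ?_⟩
  have h1 : ∫ ω, risk D loss (outerIter loss eta (gammaPar mu kappaT eta)
      (thetaPar mu kappaT eta) (hPar (LLoss / muLoss) LLoss tmax K) (betaPar tmax K) (2 * m) x0
      (fun i => X i ω) K).1 ∂P - risk D loss xstar
      = ∫ ω, (risk D loss (outerIter loss eta (gammaPar mu kappaT eta)
      (thetaPar mu kappaT eta) (hPar (LLoss / muLoss) LLoss tmax K) (betaPar tmax K) (2 * m) x0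
      (fun i => X i ω) K).1 - risk D loss xstar) ∂P := by
    rw [integral_sub hint' (integrable_const _)]; simp
  rw [h1]
  refine (integral_mono hint hbound.1 fun ω => sub_le_lyap hS hml xstar _ _).trans
    (hbound.2.trans (add_le_add ?_ ?_))
  · have hK2 : 2 ≤ K := by
      have h2 : (2 : ℝ) ≤ K := by nlinarith
      exact_mod_cast h2
    refine mul_le_mul ((prod_thetaTilde_le ht (by linarith) hK2).trans
      (Real.exp_le_exp.2 (by linarith))) (lyap_self_le hm.smooth _ x0)
      (lyap_nonneg hS hm.smooth _ _) (Real.exp_pos _).le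
  · have hΛ : 0 ≤ lossNoise D loss (matOp (covMat D)⁻¹) kappaT eta xstar := by
      rw [hA.lossNoise_eq]
      have := hA.trace_gradNoise_nonneg
      have := hA.trace_inv_mul_gradNoise_nonneg
      have := hA.covModel.one_le_kap
      have := hp.eta_pos
      positivity
    have h2 := mul_thetaTilde_self_le ht K
    have h3 : thetaTilde tmax K K / m ≤ 32 / n := by
      rw [div_le_div_iff₀ hm0 hn0]
      have h4 := thetaTilde_pos ht K K
      have h5 := mul_le_mul_of_nonneg_right hhalf h4.le
      have h6 := mul_le_mul_of_nonneg_right h2 hm0.le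
      linarith
    calc 10 * (7920 * lossNoise D loss (matOp (covMat D)⁻¹) kappaT eta xstar / (muLoss * m))
          * thetaTilde tmax K K
        = 79200 * lossNoise D loss (matOp (covMat D)⁻¹) kappaT eta xstar / muLoss
          * (thetaTilde tmax K K / m) := by field_simp; ring
      _ ≤ _ := mul_le_mul_of_nonneg_left h3 (by positivity)

/-- The upper bound on the step size and the sample size make the variance term small. -/
theorem Assumptions.variance_le (hA : Assumptions D loss xstar muLoss LLoss mu R kappaT)
    {n : ℕ} {l eta : ℝ} (hn : 0 < (n : ℝ)) (heps : 0 < eps)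
    (hη : StepSizeOK ((256 * 10 ^ 8) ^ 2) (1 / 10 ^ 7) l (LLoss / muLoss) LLoss mu R kappaT
      (gradNoise D loss xstar).trace eps n eta)
    (hσ : 10 ^ 14 * (LLoss / muLoss
      * Matrix.trace ((LLoss • covMat D)⁻¹ * gradNoise D loss xstar) / eps) ≤ n) :
    79200 * lossNoise D loss (matOp (covMat D)⁻¹) kappaT eta xstar / muLoss * (32 / n)
      ≤ eps / 2 := by
  have hml := hA.muLoss_pos
  have hL := hA.LLoss_pos
  set τ := (gradNoise D loss xstar).trace
  set σ := Matrix.trace ((LLoss • covMat D)⁻¹ * gradNoise D loss xstar)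
  have h1 : eta * kappaT * τ / muLoss ≤ 1 / 10 ^ 7 * (n * eps) := by
    have h := hη.2.2
    have e : eta * (LLoss / muLoss * kappaT * τ) = eta * kappaT * τ / muLoss * LLoss := by
      field_simp
    rw [e, ← mul_assoc] at h
    exact le_of_mul_le_mul_right h hL
  have h2 : LLoss / muLoss * σ ≤ 1 / 10 ^ 14 * (n * eps) := by
    rw [← mul_div_assoc, div_le_iff₀ heps] at hσ
    linarith
  have h3 : lossNoise D loss (matOp (covMat D)⁻¹) kappaT eta xstar / muLoss
      = eta * kappaT * τ / muLoss + LLoss / muLoss * σ := by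
    rw [hA.lossNoise_eq]; ring
  rw [mul_div_assoc, h3]
  have h4 : 79200 * (eta * kappaT * τ / muLoss + LLoss / muLoss * σ) * (32 / n)
      = 2534400 * (eta * kappaT * τ / muLoss + LLoss / muLoss * σ) / n := by ring
  rw [h4, div_le_iff₀ hn]
  have h5 : 0 < n * eps := mul_pos hn heps
  linarith

end Final

end SADA

theorem corollary1 :
    -- universal constants, depending on nothing
    ∃ C c₀ c₁ c₂ c₃ : ℝ, 0 < C ∧ (0 < c₀ ∧ c₀ ≤ 1) ∧ 0 < c₁ ∧ (0 < c₂ ∧ c₂ ≤ 1 / 16) ∧ 1 ≤ c₃ ∧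
    ∀ (d : ℕ) (B : Type*) [MeasurableSpace B]
      (D : MeasureTheory.Measure (SADA.Vec d × B)) [MeasureTheory.IsProbabilityMeasure D]
      (loss : ℝ → B → ℝ) (xstar x0 : SADA.Vec d) (muLoss LLoss mu R kappaT eps : ℝ),
      SADA.Assumptions D loss xstar muLoss LLoss mu R kappaT → 0 < eps →
    ∀ n : ℕ,
      -- `n ≥ C · 𝓛² · (complexity)`
      C * SADA.logFactor
            (SADA.complexity (SADA.covMat D) (SADA.gradNoise D loss xstar)
              muLoss LLoss mu R kappaT eps)
            (SADA.risk D loss x0 - SADA.risk D loss xstar) eps ^ 2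
        * SADA.complexity (SADA.covMat D) (SADA.gradNoise D loss xstar)
            muLoss LLoss mu R kappaT eps ≤ (n : ℝ) →
      -- an admissible step size exists
      (∃ eta : ℝ,
        SADA.StepSizeOK c₁ c₂
          (SADA.logFactor n (SADA.risk D loss x0 - SADA.risk D loss xstar) eps)
          (LLoss / muLoss) LLoss mu R kappaT (SADA.gradNoise D loss xstar).trace eps n eta) ∧
      ∀ eta : ℝ,
        SADA.StepSizeOK c₁ c₂
          (SADA.logFactor n (SADA.risk D loss x0 - SADA.risk D loss xstar) eps)
          (LLoss / muLoss) LLoss mu R kappaT (SADA.gradNoise D loss xstar).trace eps n eta →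
        -- an admissible inner length exists
        (∃ T : ℕ, SADA.InnerLengthOK c₃
          (SADA.logFactor n (SADA.risk D loss x0 - SADA.risk D loss xstar) eps)
          mu kappaT eta T) ∧
        -- and every admissible choice, with `K = ⌊n / T⌋ ≥ 1`, reaches excess risk `ε`
        ∀ T : ℕ, SADA.InnerLengthOK c₃
          (SADA.logFactor n (SADA.risk D loss x0 - SADA.risk D loss xstar) eps)
          mu kappaT eta T →
          1 ≤ n / T ∧
          ∀ (Ω : Type*) [MeasurableSpace Ω] (P : MeasureTheory.Measure Ω)
            [MeasureTheory.IsProbabilityMeasure P] (sample : ℕ → Ω → SADA.Vec d × B),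
            (∀ i, Measurable (sample i)) →
            ProbabilityTheory.iIndepFun sample P →
            (∀ i, P.map (sample i) = D) →
            MeasureTheory.Integrable (fun ω => SADA.risk D loss
              (SADA.sadaTuned loss c₀ muLoss LLoss mu kappaT eta (n / T) T x0
                (fun i => sample i ω))) P ∧
            (∫ ω, SADA.risk D loss
              (SADA.sadaTuned loss c₀ muLoss LLoss mu kappaT eta (n / T) T x0
                (fun i => sample i ω)) ∂P) - SADA.risk D loss xstar ≤ eps := by
  -- `c₀` and `c₃` are what the analysis of the two loops needs. Then `c₁` makes the outer loop long
  -- enough for the bias to contract, `c₂` makes the part `κ̃ η tr Q` of the noise harmless, and `C`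
  -- leaves room for all of them after passing from `𝓛(X)` to `𝓛(n)`.
  refine ⟨(64 * 10 ^ 14) ^ 2, 1 / 10 ^ 6, (256 * 10 ^ 8) ^ 2, 1 / 10 ^ 7, 128, by norm_num,
    by norm_num, by norm_num, by norm_num, by norm_num, ?_⟩
  intro d B _ D _ loss xstar x0 muLoss LLoss mu R kappaT eps hA heps n hn
  have hgap : 0 ≤ (SADA.risk D loss x0 - SADA.risk D loss xstar) / eps :=
    div_nonneg (sub_nonneg.2 (hA.isMinimizer x0)) heps.le
  have hn' := SADA.mul_log_sq_mul_le (by norm_num) (hA.one_le_complexity heps) hgap hn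
  have he := Real.exp_pos 1
  have hn0 : (0 : ℝ) ≤ n := Nat.cast_nonneg n
  have hpos : 0 < Real.exp 1 + n + (SADA.risk D loss x0 - SADA.risk D loss xstar) / eps := by
    positivity
  have hl1 : 1 ≤ SADA.logFactor n (SADA.risk D loss x0 - SADA.risk D loss xstar) eps := by
    rw [SADA.logFactor, Real.le_log_iff_exp_le hpos]
    linarith
  have hexp : Real.exp (SADA.logFactor n (SADA.risk D loss x0 - SADA.risk D loss xstar) eps)
      = Real.exp 1 + n + (SADA.risk D loss x0 - SADA.risk D loss xstar) / eps :=
    Real.exp_log hpos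
  obtain ⟨hb, hσ⟩ := hA.sampleBudget heps hl1 hn'
  set l := SADA.logFactor n (SADA.risk D loss x0 - SADA.risk D loss xstar) eps
  refine ⟨hb.exists_stepSize, fun eta hη => ⟨hb.exists_innerLength hη, fun T hT => ⟨?_, ?_⟩⟩⟩
  · have h1 := hb.innerLength_le_half hη hT
    have h2 : (1 : ℝ) ≤ T := hb.innerLength_pos hη hT
    refine (Nat.one_le_div_iff (by exact_mod_cast one_pos.trans_le h2)).2 ?_
    have : (T : ℝ) ≤ n := by linarith
    exact_mod_cast this
  · intro Ω _ P _ sample hmeas hindep hlaw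
    obtain ⟨m, rfl⟩ := hT.1.two_dvd
    obtain ⟨hint, hle⟩ := hA.integral_excess_le hb hη (by linarith) hT ⟨hmeas, hindep, hlaw⟩ x0
    refine ⟨hint, hle.trans ?_⟩
    have hvar := hA.variance_le (lt_of_lt_of_le (by norm_num) hb.le_sampleSize) heps hη hσ
    have hΔ : SADA.risk D loss x0 - SADA.risk D loss xstar ≤ eps * Real.exp l := by
      rw [hexp, ← div_le_iff₀' heps]
      linarith
    have hbias : Real.exp (-(6 * l)) * (3 / 2 * (SADA.risk D loss x0 - SADA.risk D loss xstar))
        ≤ eps / 2 := by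
      calc Real.exp (-(6 * l)) * (3 / 2 * (SADA.risk D loss x0 - SADA.risk D loss xstar))
          ≤ Real.exp (-(6 * l)) * (3 / 2 * (eps * Real.exp l)) := by gcongr
        _ = 3 / 2 * eps * Real.exp (-(5 * l)) := by
          rw [show -(5 * l) = -(6 * l) + l by ring, Real.exp_add]; ring
        _ ≤ 3 / 2 * eps * (1 / 3) := by
          gcongr
          rw [Real.exp_neg, ← one_div]
          exact one_div_le_one_div_of_le (by norm_num) (by linarith [Real.add_one_le_exp (5 * l)])
        _ = eps / 2 := by ring
    linarith
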